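/- Let $n\ge 1$, let $S$ be a Hermitian $m\times m$ matrix, and let $\Lambda>0$, $d>0$. Write $\widehat f(\xi)=\int_{\mathbb R^n}e^{-ix\cdot\xi}f(x)\,dx$ and $D=-i\partial$, let $\sigma$ be the surface measure on $\mathbb S^{n-1}$, and let $\|\cdot\|_\infty$ be the norm of $(L^\infty(\mathbb S^{n-1}))^{m^2}$ (maximum over the matrix entries). For $K>0$, let $\mathscr K(\Lambda,K)$ be the class of $m\times m$ matrix symbols $A(t,\xi)$, $t\in\mathbb R$, $\xi\in\mathbb R^n\setminus 0$, positively homogeneous of order one in $\xi$, such that $t\mapsto A(t,\omega)$ is locally Lipschitz with values in $(L^\infty(\mathbb S^{n-1}))^{m^2}$ and $$\sup_{t\in\mathbb R}\|A(t,\cdot)\|_\infty\le\Lambda,\qquad \int_{-\infty}^{\infty}\|\partial_tA(t,\cdot)\|_\infty\,dt\le K .$$ Let $\mathscr Y(\mathbb R^n)$ be defined by finiteness of $$|U_0|_{\mathscr Y}=\sum_{j,k}\int_{-\infty}^\infty\int_{\mathbb S^{n-1}}\left|\int_0^\infty e^{i\tau\rho}\,\widehat f_j(\rho\omega)\overline{\widehat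 f_k(\rho\omega)}\,\rho^n\,d\rho\right|d\sigma(\omega)\,d\tau,\qquad U_0=(f_0,\dots,f_{m-1}),$$ the integrals over $\rho$ being Lebesgue integrals that exist for almost every $\omega$. Then there are constants $K_0>0$, $c>0$, $M>0$ with $cK_0<1$, depending only on $n,m,S,\Lambda,d$, such that the following holds. Let $0<K\le K_0$ and let $A\in\mathscr K(\Lambda,K)$ be strictly hyperbolic with gap $d$: for all $t\in\mathbb R$ and $\xi\ne0$ the polynomial $\det(\tau I-A(t,\xi))$ has $m$ real roots $\varphi_1(t,\xi),\dots,\varphi_m(t,\xi)$, and $|\varphi_j(t,\xi)-\varphi_k(t,\xi)|\ge d$ whenever $j\ne k$ and $|\xi|=1$. Let $U\in C(\mathbb R;(L^2(\mathbb R^n))^m)$ be a (distributional) solution of $$D_tU=A(t,D_x)U,\qquad U(0)=U_0\in (L^2(\mathbb R^n))^m\cap\mathscr Y(\mathbb R^n),$$ and put $s(t)=\langle SU(t),U(t)\rangle_{(L^2)^m}$. Then $s$ is absolutely continuous on every bounded interval, $s'\in L^1(\mathbb R)$, and $$\int_{-\infty}^\infty|s'(t)|\,dt\le M\left(K\|U_0\|_{(L^2)^m}^2+\frac1{1-cK}|U_0|_{\mathscr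 Y}\right).$$ Moreover, $r\mapsto A(r,\cdot)$ is Lipschitz on the range of $s$ as a map into $(L^\infty(\mathbb S^{n-1}))^{m^2}$, and if $L\ge 0$ is any Lipschitz constant of it there, then for all $t\in\mathbb R$ $$\|A(s(t),\cdot)\|_\infty\le\|A(s(0),\cdot)\|_\infty+ML\left(K\|U_0\|_{(L^2)^m}^2+\frac1{1-cK}|U_0|_{\mathscr Y}\right),$$ $$\int_{-\infty}^\infty\left\|\partial_t[A(s(t),\cdot)]\right\|_\infty dt\le ML\left(K\|U_0\|_{(L^2)^m}^2+\frac1{1-cK}|U_0|_{\mathscr Y}\right).$$ Here $\partial_tG=B$ for a curve $G$ in $(L^\infty(\mathbb S^{n-1}))^{m^2}$ means that $G(t',\omega)-G(t,\omega)=\int_t^{t'}B(\tau,\omega)\,d\tau$ for almost every $\omega$, for all $t,t'$. -/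

import Mathlib

open MeasureTheory Set
open scoped ENNReal NNReal FourierTransform SchwartzMap

noncomputable section

namespace Kirchhoff

/-- The physical / frequency space `ℝⁿ`. -/
abbrev Space (n : ℕ) : Type := EuclideanSpace ℝ (Fin n)

/-- The unit sphere `𝕊ⁿ⁻¹` of `ℝⁿ`. -/
abbrev Sphere (n : ℕ) : Type := Metric.sphere (0 : Space n) 1

/-- The surface measure on `𝕊ⁿ⁻¹`, i.e. the normalised `(n-1)`-dimensional Hausdorff measure
(counting measure on two points when `n = 1`). -/
def surf (n : ℕ) : Measure (Sphere n) := (volume : Measure (Space n)).toSphere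

/-- The space `(L²(ℝⁿ))ᵐ`, with norm `‖U‖² = ∑ⱼ ‖Uⱼ‖²`. -/
abbrev L2 (n m : ℕ) : Type :=
  Lp (EuclideanSpace ℂ (Fin m)) 2 (volume : Measure (Space n))

/-- Complex `m × m` matrices. -/
abbrev Mat (m : ℕ) : Type := Matrix (Fin m) (Fin m) ℂ

/-- A representative of the Fourier transform `Û(ξ) = ∫ e^{-i x·ξ} U(x) dx` of `U ∈ (L²(ℝⁿ))ᵐ`.
Mathlib's `𝓕` has the kernel `e^{-2πi x·ξ}`, whence the rescaling. -/
def fhat {n m : ℕ} (u : L2 n m) (ξ : Space n) : EuclideanSpace ℂ (Fin m) :=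
  (𝓕 u : L2 n m) ((2 * Real.pi)⁻¹ • ξ)

/-- `ρ ↦ Ûⱼ(ρω) conj(Ûₖ(ρω)) ρⁿ`, the radial density in the `𝒴`-norm. -/
def radial {n m : ℕ} (u : L2 n m) (j k : Fin m) (ω : Sphere n) (ρ : ℝ) : ℂ :=
  fhat u (ρ • (ω : Space n)) j * (starRingEnd ℂ) (fhat u (ρ • (ω : Space n)) k) * (ρ : ℂ) ^ n

/-- The quantity `|U|_𝒴 = ∑_{j,k} ∫_ℝ ∫_{𝕊ⁿ⁻¹} |∫₀^∞ e^{iτρ} Ûⱼ conj(Ûₖ) ρⁿ dρ| dσ(ω) dτ`. -/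
def yNorm {n m : ℕ} (u : L2 n m) : ℝ≥0∞ :=
  ∑ j : Fin m, ∑ k : Fin m, ∫⁻ τ : ℝ, ∫⁻ ω : Sphere n,
    ‖∫ ρ in Ioi (0 : ℝ), Complex.exp (Complex.I * τ * ρ) * radial u j k ω ρ‖ₑ ∂(surf n)

/-- Membership in `(L²)ᵐ ∩ 𝒴`: the radial integrals exist as Lebesgue integrals for almost every
direction, and `|U|_𝒴 < ∞`. -/
def MemY {n m : ℕ} (u : L2 n m) : Prop :=
  (∀ᵐ ω ∂(surf n), ∀ j k : Fin m, IntegrableOn (radial u j k ω) (Ioi 0)) ∧ yNorm u < ∞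

/-- The norm of `(L^∞(𝕊ⁿ⁻¹))^{m²}` (maximum over the entries). For a symbol that is homogeneous
of order one, this is the `L^∞(ℝⁿ∖0)`-norm of its restriction `ξ ↦ A(ξ/|ξ|)`. -/
def linftyNorm {n m : ℕ} (B : Sphere n → Mat m) : ℝ≥0∞ :=
  ⨆ i : Fin m, ⨆ j : Fin m, eLpNorm (fun ω => B ω i j) ∞ (surf n)

/-- `B = ∂ₜG` for a curve `G` in `(L^∞(𝕊ⁿ⁻¹))^{m²}`: for all `t, t'`, the identity
`G(t',ω) - G(t,ω) = ∫ₜ^{t'} B(τ,ω) dτ` holds for almost every `ω`. This determines `B` up to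
null sets of `ℝ × 𝕊ⁿ⁻¹` and does not depend on the representatives of the classes `G(t,·)`. -/
def IsTimeDeriv {n m : ℕ} (G B : ℝ → Sphere n → Mat m) : Prop :=
  (∀ i j, AEStronglyMeasurable (fun p : ℝ × Sphere n => B p.1 p.2 i j)
    ((volume : Measure ℝ).prod (surf n))) ∧
  ∀ t t' : ℝ, ∀ᵐ ω ∂(surf n), ∀ i j,
    IntervalIntegrable (fun τ => B τ ω i j) volume t t' ∧
      G t' ω i j - G t ω i j = ∫ τ in t..t', B τ ω i j

/-- The restriction of a symbol `A(t,ξ)` to the unit sphere. -/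
def restr {n m : ℕ} (A : ℝ → Space n → Mat m) (t : ℝ) (ω : Sphere n) : Mat m := A t ω

/-- The class `𝒦(Λ,K)` of symbols, positively homogeneous of order one in `ξ`. -/
structure ClassK {n m : ℕ} (Λ K : ℝ) (A : ℝ → Space n → Mat m) : Prop where
  homogeneous : ∀ (t r : ℝ) (ξ : Space n), 0 < r → ξ ≠ 0 → A t (r • ξ) = (r : ℂ) • A t ξ
  measurable : ∀ (t : ℝ) (i j : Fin m),
    AEStronglyMeasurable (fun ω : Sphere n => restr A t ω i j) (surf n)
  locally_lipschitz : ∀ R : ℝ, ∃ L : ℝ≥0, ∀ t ∈ Icc (-R) R, ∀ t' ∈ Icc (-R) R,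
    linftyNorm (fun ω => restr A t ω - restr A t' ω) ≤ ENNReal.ofReal (L * |t - t'|)
  bounded : ∀ t : ℝ, linftyNorm (restr A t) ≤ ENNReal.ofReal Λ
  variation : ∃ B : ℝ → Sphere n → Mat m, IsTimeDeriv (restr A) B ∧
    ∫⁻ t : ℝ, linftyNorm (B t) ≤ ENNReal.ofReal K

/-- Strict hyperbolicity: for all `t` and all `ξ ≠ 0`, `det(τI - A(t,ξ))` has the real roots
`φ₁(t,ξ), …, φₘ(t,ξ)`, and `|φⱼ - φₖ| ≥ d` for `j ≠ k`, `|ξ| = 1`. (For `d > 0` and by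
homogeneity, they are distinct for every `ξ ≠ 0`.) -/
def StrictlyHyperbolic {n m : ℕ} (d : ℝ) (A : ℝ → Space n → Mat m) : Prop :=
  ∃ φ : Fin m → ℝ → Space n → ℝ,
    (∀ (t : ℝ) (ξ : Space n), ξ ≠ 0 →
      (A t ξ).charpoly = ∏ j, (Polynomial.X - Polynomial.C (φ j t ξ : ℂ))) ∧
    ∀ (t : ℝ) (ξ : Space n), ‖ξ‖ = 1 → ∀ j k, j ≠ k → d ≤ |φ j t ξ - φ k t ξ|

/-- `Dₜ U = A(t,Dₓ) U`, `Dₜ = -i∂ₜ`, for `U ∈ C(ℝ; (L²(ℝⁿ))ᵐ)`. The Fourier transform of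
`A(t,Dₓ)U(t)` is `A(t,ξ) Û(t,ξ)`, and the equation `∂ₜ Û = i A(t,ξ) Û` holds in the space of
tempered distributions, i.e. against every Schwartz function `ψ`. -/
def IsSolution {n m : ℕ} (A : ℝ → Space n → Mat m) (U : ℝ → L2 n m) : Prop :=
  Continuous U ∧
  ∀ (ψ : 𝓢(Space n, ℂ)) (j : Fin m) (t : ℝ),
    HasDerivAt (fun τ : ℝ => ∫ ξ : Space n, ψ ξ * fhat (U τ) ξ j)
      (Complex.I * ∫ ξ : Space n, ψ ξ * ∑ k : Fin m, A t ξ j k * fhat (U t) ξ k) t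

/-- The quadratic form `⟨S u, u⟩ = ∫ ᵀ(S u(x)) conj(u(x)) dx`; it is real when `S` is Hermitian. -/
def quadForm {n m : ℕ} (S : Mat m) (u : L2 n m) : ℝ :=
  (∫ x : Space n, ∑ b : Fin m, ∑ l : Fin m,
    S b l * u x l * (starRingEnd ℂ) (u x b)).re

/-- The function `s(t) = ⟨S U(t), U(t)⟩`. -/
def sFun {n m : ℕ} (S : Mat m) (U : ℝ → L2 n m) (t : ℝ) : ℝ := quadForm S (U t)

/-- The quantity `K ‖U₀‖² + (1 - cK)⁻¹ |U₀|_𝒴`. -/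
def dataSize {n m : ℕ} (c K : ℝ) (u : L2 n m) : ℝ :=
  K * ‖u‖ ^ 2 + (1 / (1 - c * K)) * (yNorm u).toReal

/-- `r ↦ A(r,·)` is `L`-Lipschitz on the range of `s`, with values in `(L^∞(𝕊ⁿ⁻¹))^{m²}`. -/
def LipOnRange {n m : ℕ} (L : ℝ) (A : ℝ → Space n → Mat m) (s : ℝ → ℝ) : Prop :=
  ∀ t t' : ℝ, linftyNorm (fun ω => restr A (s t) ω - restr A (s t') ω)
    ≤ ENNReal.ofReal (L * |s t - s t'|)

end Kirchhoff

end

/-! On the Fourier side the equation decouples into linear systems `∂ₜv = iρ a(t,ω) v` on the rays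
`ξ = ρω`. The matrix `X = v v^*` then solves `∂ₜX = iρ (aX - X a^*)`, and `s` is, up to `(2π)⁻ⁿ`,
the integral of `tr(S X) ρⁿ⁻¹` over `ρ` and `ω`. Differentiating in time produces one more factor
`ρ`, so `s'` is the integral over `ω` of `i tr(S(aw - w a^*))` with `w(t) = ∫ ρⁿ X(t,ρ) dρ`. This is
the value at `τ = 0` of `w(t,τ) = ∫ e^{iτρ} ρⁿ X(t,ρ) dρ`, and `|U₀|_𝒴` is the `L¹` norm of the
entries of `w(0,τ)` over `τ` and `ω`.

If `Pⱼ` are the spectral projections of `a`, the maps `Π_{jk} : X ↦ Pⱼ X Pₖ^*` diagonalise the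
commutator `X ↦ aX - X a^*`, with eigenvalues `φⱼ - φₖ`. Hence the components of `w` are transported
with speeds `φⱼ - φₖ` and are coupled only through `∂ₜΠ_{jk}` (`DiagonalFlow.transport_identity`).
The gap makes the projections Lipschitz functions of `a`, so this coupling has a small integral in
time. By absorption, `∫ |w(t,τ)| dτ` is bounded by its initial value, uniformly in `t`
(`DiagonalFlow.lintegral_radialFourier_le`).

The components with `j = k` have eigenvalue zero and do not enter the commutator. The others cross
`τ = 0` with speed at least `d`, so their time integral at `τ = 0` is controlled by an integral over
`τ` (`DiagonalFlow.lintegral_proj_radialFourier_zero_le`, `exists_ray_bounds`). Integration over `ω`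
gives `∫ |s'| ≤ M |U₀|_𝒴`, which is stronger than the asserted bound.

Two matters of rigour remain. The symbol is given only as an `L^∞` class at each time and needs a
representative that is good on almost every ray (`exists_representative`). A distributional solution
must be shown to coincide with the solution on the rays (`FundamentalFlow.fhat_eq_rayVec`), by a
uniqueness argument on balls in frequency (`IsWeakSolution.contraction`). The bounds for `A(s(t),·)`
follow because a curve that is Lipschitz with respect to `s` inherits the absolute continuity of
`s`. -/

namespace Kirchhoff
open MeasureTheory Set Filter Topology
open scoped ENNReal NNReal FourierTransform SchwartzMap
noncomputable section
set_option linter.unusedSectionVars false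

/-! ### Absolutely continuous curves in normed spaces. -/

section AbsolutelyContinuous

/-- A local comparison suffices: an interval of a family of total length less than `η` is itself
shorter than `η`. Two comparison functions are allowed so that products can be treated. -/
theorem absolutelyContinuousOnInterval_of_dist_le {X Y Z : Type*} [PseudoMetricSpace X]
    [PseudoMetricSpace Y] [PseudoMetricSpace Z] {f : ℝ → X} {g : ℝ → Y} {h : ℝ → Z} {a b C η : ℝ}
    (hη : 0 < η) (hg : AbsolutelyContinuousOnInterval g a b)
    (hh : AbsolutelyContinuousOnInterval h a b)
    (hf : ∀ x ∈ uIcc a b, ∀ y ∈ uIcc a b, dist x y < η →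
      dist (f x) (f y) ≤ C * (dist (g x) (g y) + dist (h x) (h y))) :
    AbsolutelyContinuousOnInterval f a b := by
  rw [absolutelyContinuousOnInterval_iff] at hg hh ⊢
  intro ε hε
  have hC : 0 < |C| + 1 := by positivity
  obtain ⟨δ₁, hδ₁, h₁⟩ := hg (ε / (2 * (|C| + 1))) (by positivity)
  obtain ⟨δ₂, hδ₂, h₂⟩ := hh (ε / (2 * (|C| + 1))) (by positivity)
  refine ⟨min η (min δ₁ δ₂), by positivity, fun E hE hlen => ?_⟩
  have g₁ := h₁ E hE (hlen.trans_le ((min_le_right _ _).trans (min_le_left _ _)))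
  have g₂ := h₂ E hE (hlen.trans_le ((min_le_right _ _).trans (min_le_right _ _)))
  have hsum : ∑ i ∈ Finset.range E.1, dist (f (E.2 i).1) (f (E.2 i).2) ≤
      (|C| + 1) * (∑ i ∈ Finset.range E.1, dist (g (E.2 i).1) (g (E.2 i).2) +
        ∑ i ∈ Finset.range E.1, dist (h (E.2 i).1) (h (E.2 i).2)) := by
    rw [← Finset.sum_add_distrib, Finset.mul_sum]
    refine Finset.sum_le_sum fun i hi => ?_
    have hmem := hE.1 i hi
    refine (hf _ hmem.1 _ hmem.2 ?_).trans ?_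
    · refine lt_of_le_of_lt ?_ (hlen.trans_le (min_le_left _ _))
      exact Finset.single_le_sum (f := fun i => dist (E.2 i).1 (E.2 i).2)
        (fun _ _ => dist_nonneg) hi
    · gcongr
      linarith [le_abs_self C]
  calc _ ≤ _ := hsum
    _ < (|C| + 1) * (ε / (2 * (|C| + 1)) + ε / (2 * (|C| + 1))) := by gcongr
    _ = ε := by field_simp; ring

variable {F : Type*} [NormedAddCommGroup F] [NormedSpace ℝ F]

theorem absolutelyContinuousOnInterval_of_contDiff {f : ℝ → F} (hf : ContDiff ℝ 1 f) (a b : ℝ) :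
    AbsolutelyContinuousOnInterval f a b :=
  hf.contDiffOn.absolutelyContinuousOnInterval

/-- The increments are dominated by those of the real-valued primitive of `‖f‖`. -/
theorem absolutelyContinuousOnInterval_primitive {f : ℝ → F}
    (hf : ∀ a b, IntervalIntegrable f volume a b) (c a b : ℝ) :
    AbsolutelyContinuousOnInterval (fun x => ∫ v in c..x, f v) a b := by
  have hn : AbsolutelyContinuousOnInterval (fun x => ∫ v in a..x, ‖f v‖) a b :=
    (hf a b).norm.absolutelyContinuousOnInterval_intervalIntegral left_mem_uIcc
  refine absolutelyContinuousOnInterval_of_dist_le (C := 1) one_pos hn hn fun x _ y _ _ => ?_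
  rw [dist_comm, dist_eq_norm, intervalIntegral.integral_interval_sub_left (hf _ _) (hf _ _),
    dist_comm, Real.dist_eq,
    intervalIntegral.integral_interval_sub_left (hf _ _).norm (hf _ _).norm]
  have := intervalIntegral.norm_integral_le_abs_integral_norm (f := f) (a := x) (b := y)
    (μ := volume)
  linarith [abs_nonneg (∫ v in x..y, ‖f v‖)]

/-- Subtracting the primitive of `f'` leaves an absolutely continuous function with derivative zero
almost everywhere, hence a constant. -/
theorem integral_eq_sub_of_absolutelyContinuous [CompleteSpace F] {f f' : ℝ → F} {a b : ℝ}
    (hf : AbsolutelyContinuousOnInterval f a b) (hf' : ∀ᵐ x, HasDerivAt f (f' x) x)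
    (hi : ∀ a b, IntervalIntegrable f' volume a b) :
    ∫ x in a..b, f' x = f b - f a := by
  have hg : AbsolutelyContinuousOnInterval (fun x => f x - ∫ t in a..x, f' t) a b :=
    hf.sub (absolutelyContinuousOnInterval_primitive hi a a b)
  obtain ⟨C, hC⟩ := hg.const_of_ae_hasDerivAt_zero (by
    filter_upwards [hf', (hi a b).ae_hasDerivAt_integral] with x hx₁ hx₂ hx₃
    have := hx₁.sub (hx₂ hx₃ a left_mem_uIcc)
    rwa [sub_self] at this)
  have h₁ := hC a left_mem_uIcc
  have h₂ := hC b right_mem_uIcc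
  simp only [intervalIntegral.integral_same, sub_zero] at h₁
  rw [← h₁] at h₂
  rw [← h₂]; abel

theorem ae_differentiableAt_of_absolutelyContinuous [FiniteDimensional ℝ F] {f : ℝ → F}
    (hf : ∀ a b, AbsolutelyContinuousOnInterval f a b) : ∀ᵐ x, DifferentiableAt ℝ f x := by
  refine LocallyBoundedVariationOn.ae_differentiableAt fun a b _ _ => ?_
  refine BoundedVariationOn.mono (hf a b).boundedVariationOn ?_
  intro x hx
  exact Icc_subset_uIcc hx.2

/-- Pass to the limit in the slopes. This turns Lipschitz dependence on a moving parameter into a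
pointwise bound for derivatives, both for spectral projections and for `A(s(t),·)`. -/
theorem norm_deriv_le_of_eventually_norm_sub_le {G : Type*} [NormedAddCommGroup G]
    [NormedSpace ℝ G] {f : ℝ → F} {g : ℝ → G} {f' : F} {g' : G} {t C : ℝ}
    (hf : HasDerivAt f f' t) (hg : HasDerivAt g g' t)
    (h : ∀ᶠ s in 𝓝 t, ‖f s - f t‖ ≤ C * ‖g s - g t‖) : ‖f'‖ ≤ C * ‖g'‖ := by
  have h₁ := (hasDerivAt_iff_tendsto_slope.1 hf).norm
  have h₂ := ((hasDerivAt_iff_tendsto_slope.1 hg).norm).const_mul C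
  refine le_of_tendsto_of_tendsto h₁ h₂ ?_
  filter_upwards [h.filter_mono nhdsWithin_le_nhds] with s hs
  simp only [slope, vsub_eq_sub, norm_smul]
  calc _ ≤ ‖(s - t)⁻¹‖ * (C * ‖g s - g t‖) := by gcongr
    _ = _ := by ring

end AbsolutelyContinuous

/-! ### Dyson series: a fundamental solution jointly measurable in time and parameter. -/

section Dyson

variable {𝔸 X : Type*} [NormedRing 𝔸] [NormedAlgebra ℝ 𝔸] [CompleteSpace 𝔸] [MeasurableSpace X]

/-- The terms of the Dyson series of the linear equation `Y' = A Y`, `Y(0) = 1`. -/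
def dysonTerm (A : ℝ → X → 𝔸) : ℕ → ℝ → X → 𝔸
  | 0 => fun _ _ => 1
  | k + 1 => fun t x => ∫ r in (0 : ℝ)..t, A r x * dysonTerm A k r x

variable {A : ℝ → X → 𝔸}

theorem continuous_dysonTerm (hc : ∀ x, Continuous fun t => A t x) (k : ℕ) (x : X) :
    Continuous fun t => dysonTerm A k t x := by
  induction k with
  | zero => exact continuous_const
  | succ k ih =>
    exact intervalIntegral.continuous_primitive
      (fun a b => ((hc x).mul ih).intervalIntegrable a b) 0

theorem hasDerivAt_dysonTerm (hc : ∀ x, Continuous fun t => A t x) (k : ℕ) (x : X) (t : ℝ) :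
    HasDerivAt (fun t => dysonTerm A (k + 1) t x) (A t x * dysonTerm A k t x) t := by
  have h := (hc x).mul (continuous_dysonTerm hc k x)
  exact intervalIntegral.integral_hasDerivAt_right (h.intervalIntegrable 0 t)
    h.aestronglyMeasurable.stronglyMeasurableAtFilter h.continuousAt

theorem stronglyMeasurable_intervalIntegral {G : Type*} [NormedAddCommGroup G] [NormedSpace ℝ G]
    {f : ℝ → X → G} (hf : StronglyMeasurable (Function.uncurry f)) (a b : ℝ) :
    StronglyMeasurable fun x => ∫ r in a..b, f r x := by
  simp only [intervalIntegral]
  exact (hf.integral_prod_left (μ := volume.restrict (Ioc a b))).sub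
    (hf.integral_prod_left (μ := volume.restrict (Ioc b a)))

theorem stronglyMeasurable_dysonTerm (hm : StronglyMeasurable (Function.uncurry A))
    (hc : ∀ x, Continuous fun t => A t x) (k : ℕ) :
    StronglyMeasurable (Function.uncurry (dysonTerm A k)) := by
  refine stronglyMeasurable_uncurry_of_continuous_of_stronglyMeasurable
    (continuous_dysonTerm hc k) ?_
  induction k with
  | zero => exact fun _ => stronglyMeasurable_const
  | succ k ih =>
    have := stronglyMeasurable_uncurry_of_continuous_of_stronglyMeasurable
      (continuous_dysonTerm hc k) ih
    exact fun t => stronglyMeasurable_intervalIntegral (f := fun r x => A r x * dysonTerm A k r x)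
      (hm.mul this) 0 t

theorem norm_dysonTerm_le {C : X → ℝ} (hC : ∀ t x, ‖A t x‖ ≤ C x)
    (k : ℕ) (t : ℝ) (x : X) :
    ‖dysonTerm A k t x‖ ≤ ‖(1 : 𝔸)‖ * ((C x * |t|) ^ k / k.factorial) := by
  induction k generalizing t with
  | zero => simp [dysonTerm]
  | succ k ih =>
    have hC0 : 0 ≤ C x := (norm_nonneg _).trans (hC 0 x)
    have hInt : ∀ t : ℝ, 0 ≤ t → ∫ r in (0 : ℝ)..t, ‖(1 : 𝔸)‖ * C x ^ (k + 1) / k.factorial * r ^ k =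
        ‖(1 : 𝔸)‖ * ((C x * |t|) ^ (k + 1) / (k + 1).factorial) := by
      intro t ht
      rw [intervalIntegral.integral_const_mul, integral_pow, abs_of_nonneg ht, Nat.factorial_succ]
      push_cast
      field_simp
      simp [mul_pow, mul_assoc]
    have hpt : ∀ r, ‖A r x * dysonTerm A k r x‖ ≤
        ‖(1 : 𝔸)‖ * C x ^ (k + 1) / k.factorial * |r| ^ k := by
      intro r
      calc _ ≤ ‖A r x‖ * ‖dysonTerm A k r x‖ := norm_mul_le _ _
        _ ≤ C x * (‖(1 : 𝔸)‖ * ((C x * |r|) ^ k / k.factorial)) := by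
          gcongr
          · exact hC r x
          · exact ih r
        _ = _ := by rw [mul_pow]; ring
    -- Negative times are reduced to positive ones by the substitution `r ↦ -r`.
    rcases le_total 0 t with ht | ht
    · rw [← hInt t ht]
      refine intervalIntegral.norm_integral_le_of_norm_le ht ?_ ?_
      · refine Eventually.of_forall fun r hr => (hpt r).trans_eq ?_
        rw [abs_of_pos hr.1]
      · exact (by fun_prop : Continuous _).intervalIntegrable _ _
    · have : ‖dysonTerm A (k + 1) t x‖ ≤ ∫ r in t..(0 : ℝ),
          ‖(1 : 𝔸)‖ * C x ^ (k + 1) / k.factorial * (-r) ^ k := by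
        change ‖∫ r in (0 : ℝ)..t, A r x * dysonTerm A k r x‖ ≤ _
        rw [intervalIntegral.integral_symm, norm_neg]
        refine intervalIntegral.norm_integral_le_of_norm_le ht ?_ ?_
        · refine Eventually.of_forall fun r hr => (hpt r).trans_eq ?_
          rw [abs_of_nonpos hr.2]
        · exact (by fun_prop : Continuous _).intervalIntegrable _ _
      refine this.trans_eq ?_
      rw [intervalIntegral.integral_comp_neg (fun r => ‖(1 : 𝔸)‖ * C x ^ (k + 1) / k.factorial * r ^ k),
        neg_zero, hInt (-t) (by linarith), abs_neg]

/-- The factorial bounds make the series and its termwise derivative converge locally uniformly in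
time. The explicit series is used because measurability in the parameter passes from its partial
sums to the limit. -/
theorem exists_measurable_fundamental_solution (hm : StronglyMeasurable (Function.uncurry A))
    (hc : ∀ x, Continuous fun t => A t x) {C : X → ℝ} (hC : ∀ t x, ‖A t x‖ ≤ C x) :
    ∃ Y : ℝ → X → 𝔸, StronglyMeasurable (Function.uncurry Y) ∧ (∀ x, Y 0 x = 1) ∧
      ∀ t x, HasDerivAt (fun t => Y t x) (A t x * Y t x) t := by
  have hsum : ∀ t x, Summable fun k => dysonTerm A k t x := fun t x =>
    Summable.of_norm_bounded ((Real.summable_pow_div_factorial _).mul_left _)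
      fun k => norm_dysonTerm_le hC k t x
  refine ⟨fun t x => ∑' k, dysonTerm A k t x, ?_, fun x => ?_, fun t x => ?_⟩
  · refine stronglyMeasurable_of_tendsto atTop
      (f := fun N p => ∑ k ∈ Finset.range N, Function.uncurry (dysonTerm A k) p) (fun N => ?_) ?_
    · exact Finset.stronglyMeasurable_fun_sum _ fun k _ => stronglyMeasurable_dysonTerm hm hc k
    · rw [tendsto_pi_nhds]
      exact fun p => (hsum p.1 p.2).hasSum.tendsto_sum_nat
  · change ∑' k, dysonTerm A k 0 x = 1
    rw [tsum_eq_single 0]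
    · rfl
    · intro k hk
      obtain ⟨k, rfl⟩ := Nat.exists_eq_succ_of_ne_zero hk
      simp [dysonTerm]
  · have hC0 : 0 ≤ C x := (norm_nonneg _).trans (hC 0 x)
    -- The zeroth term is constant, so differentiation shifts the index by one and reproduces `A`
    -- times the series. The majorant uses the radius `|t| + 1` of a ball containing `t`.
    set g' : ℕ → ℝ → 𝔸 := fun k t => match k with
      | 0 => 0
      | k + 1 => A t x * dysonTerm A k t x with hg'
    set u : ℕ → ℝ := fun k => match k with
      | 0 => 0
      | k + 1 => C x * (‖(1 : 𝔸)‖ * ((C x * (|t| + 1)) ^ k / k.factorial)) with hu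
    have husum : Summable u := by
      rw [← summable_nat_add_iff 1]
      exact ((Real.summable_pow_div_factorial _).mul_left _).mul_left _
    have key := hasDerivAt_tsum_of_isPreconnected (t := Metric.ball (0 : ℝ) (|t| + 1))
      (g := fun k t => dysonTerm A k t x) (g' := g') (y₀ := t) (y := t) husum Metric.isOpen_ball
      (convex_ball _ _).isPreconnected ?_ ?_ (by simp) (hsum t x) (by simp)
    · have h2 : ∑' k, g' k t = A t x * ∑' k, dysonTerm A k t x := by
        have hs' : Summable fun k => g' k t := by
          rw [← summable_nat_add_iff 1]
          exact (hsum t x).mul_left _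
        rw [hs'.tsum_eq_zero_add, ← (hsum t x).tsum_mul_left]
        simp [hg']
      rwa [h2] at key
    · intro k y _
      rcases k with _ | k
      · exact hasDerivAt_const _ _
      · exact hasDerivAt_dysonTerm hc k x y
    · intro k y hy
      rcases k with _ | k
      · simp [hg', hu]
      · have hy' : |y| ≤ |t| + 1 := by simpa using (mem_ball_zero_iff.1 hy).le
        calc _ ≤ ‖A y x‖ * ‖dysonTerm A k y x‖ := norm_mul_le _ _
          _ ≤ C x * (‖(1 : 𝔸)‖ * ((C x * |y|) ^ k / k.factorial)) := by
            gcongr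
            · exact hC y x
            · exact norm_dysonTerm_le hC k y x
          _ ≤ _ := by simp only [hu]; gcongr

end Dyson

/-! ### Absorption and a one-dimensional change of variables. -/

theorem ENNReal_le_two_mul_of_le_add_half {X Y : ℝ≥0∞} (hX : X ≠ ∞) (h : X ≤ Y + 2⁻¹ * X) :
    X ≤ 2 * Y := by
  have h2 : 2⁻¹ * X + 2⁻¹ * X = X := by rw [← add_mul, ENNReal.inv_two_add_inv_two, one_mul]
  have hX' : 2⁻¹ * X ≠ ∞ := ENNReal.mul_ne_top (by simp) hX
  have h3 : 2⁻¹ * X ≤ Y := by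
    rw [← ENNReal.add_le_add_iff_right hX', h2]; exact h
  calc X = 2 * (2⁻¹ * X) := by
        rw [← mul_assoc, ENNReal.mul_inv_cancel (by simp) (by simp), one_mul]
    _ ≤ 2 * Y := by gcongr

/-- The substitution `τ = g t` is injective because `g` is strictly monotone, and its Jacobian is at
least `d`. This converts integrability in `τ` into integrability in time. -/
theorem lintegral_comp_le_of_le_deriv {f : ℝ → ℝ≥0∞} {g g' : ℝ → ℝ} {d : ℝ} (hd : 0 < d)
    (hg : ∀ t, HasDerivAt g (g' t) t) (h : (∀ t, d ≤ g' t) ∨ ∀ t, g' t ≤ -d) :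
    ∫⁻ t, f (g t) ≤ ENNReal.ofReal d⁻¹ * ∫⁻ τ, f τ := by
  have hinj : InjOn g univ := by
    rcases h with h | h
    · exact (strictMono_of_hasDerivAt_pos hg fun t => hd.trans_le (h t)).injective.injOn
    · exact (strictAnti_of_hasDerivAt_neg hg
        fun t => (h t).trans_lt (by linarith)).injective.injOn
  have habs : ∀ t, d ≤ |g' t| := fun t => by
    rcases h with h | h
    · exact (h t).trans (le_abs_self _)
    · exact (by linarith [h t] : d ≤ -g' t).trans (neg_le_abs _)
  have key := lintegral_image_eq_lintegral_abs_deriv_mul MeasurableSet.univ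
    (fun t _ => (hg t).hasDerivWithinAt) hinj f
  rw [Measure.restrict_univ] at key
  calc ∫⁻ t, f (g t) = ENNReal.ofReal d⁻¹ * (ENNReal.ofReal d * ∫⁻ t, f (g t)) := by
        rw [← mul_assoc, ← ENNReal.ofReal_mul (by positivity), inv_mul_cancel₀ hd.ne']; simp
    _ ≤ ENNReal.ofReal d⁻¹ * ∫⁻ t, ENNReal.ofReal |g' t| * f (g t) := by
        rw [← lintegral_const_mul' _ _ ENNReal.ofReal_ne_top]
        gcongr with t
        exact habs t
    _ ≤ _ := by rw [← key]; gcongr; exact Measure.restrict_le_self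

/-! ### Transport estimates for a diagonalised flow. -/

variable {E ι : Type*} [NormedAddCommGroup E] [NormedSpace ℂ E] [FiniteDimensional ℂ E] [Fintype ι]

/-- A family `x(·,ρ)` of solutions of `x' = iρ ∑ λ_α Π_α x`, where the `Π_α` are a resolution of
the identity by projections whose variation is integrable and small. -/
structure DiagonalFlow (lam : ι → ℝ → ℝ) (Pr : ι → ℝ → E →L[ℂ] E) (β : ℝ → ℝ) (ℓ C : ℝ)
    (x : ℝ → ℝ → E) : Prop where
  lam_cont : ∀ α, Continuous (lam α)
  lam_bound : ∀ α t, |lam α t| ≤ ℓ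
  sum_one : ∀ t, ∑ α, Pr α t = 1
  norm_le : ∀ α t, ‖Pr α t‖ ≤ C
  ac : ∀ α a b, AbsolutelyContinuousOnInterval (Pr α) a b
  deriv_le : ∀ α, ∀ᵐ t, ‖deriv (Pr α) t‖ ≤ β t
  β_nonneg : ∀ t, 0 ≤ β t
  β_int : Integrable β
  small : Fintype.card ι * ∫ t, β t ≤ 1 / 2
  flow : ∀ t ρ, HasDerivAt (fun t => x t ρ)
    ((Complex.I * (ρ : ℂ)) • ∑ α, (lam α t : ℂ) • Pr α t (x t ρ)) t
  proj : ∀ α t y, Pr α t (∑ γ, (lam γ t : ℂ) • Pr γ t y) = (lam α t : ℂ) • Pr α t y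
  meas : StronglyMeasurable (Function.uncurry x)

/-- The phase `∫₀ᵗ λ`. -/
def phase (l : ℝ → ℝ) (t : ℝ) : ℝ := ∫ r in (0 : ℝ)..t, l r

theorem hasDerivAt_phase {l : ℝ → ℝ} (hl : Continuous l) (t : ℝ) :
    HasDerivAt (phase l) (l t) t :=
  intervalIntegral.integral_hasDerivAt_right (hl.intervalIntegrable 0 t)
    hl.aestronglyMeasurable.stronglyMeasurableAtFilter hl.continuousAt

theorem continuous_phase {l : ℝ → ℝ} (hl : Continuous l) : Continuous (phase l) :=
  continuous_iff_continuousAt.2 fun t => (hasDerivAt_phase hl t).continuousAt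

/-- The weighted radial Fourier integral `∫₀^∞ e^{iτρ} ρⁿ x(ρ) dρ`. -/
def radialFourier (n : ℕ) (x : ℝ → E) (τ : ℝ) : E :=
  ∫ ρ in Ioi (0 : ℝ), Complex.exp (Complex.I * τ * ρ) • ((ρ : ℂ) ^ n • x ρ)

namespace DiagonalFlow

variable {lam : ι → ℝ → ℝ} {Pr : ι → ℝ → E →L[ℂ] E} {β : ℝ → ℝ} {ℓ C : ℝ} {x : ℝ → ℝ → E}

theorem continuous_x (h : DiagonalFlow lam Pr β ℓ C x) (ρ : ℝ) : Continuous fun t => x t ρ :=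
  continuous_iff_continuousAt.2 fun t => (h.flow t ρ).continuousAt

theorem continuous_Pr (h : DiagonalFlow lam Pr β ℓ C x) (α : ι) : Continuous (Pr α) := by
  refine continuous_iff_continuousAt.2 fun t => ?_
  refine ((h.ac α (t - 1) (t + 1)).continuousOn).continuousAt ?_
  rw [uIcc_of_le (by linarith)]
  exact Icc_mem_nhds (by linarith) (by linarith)

theorem ae_hasDerivAt_Pr (h : DiagonalFlow lam Pr β ℓ C x) (α : ι) :
    ∀ᵐ t, HasDerivAt (Pr α) (deriv (Pr α) t) t := by
  have : FiniteDimensional ℝ (E →L[ℂ] E) := FiniteDimensional.complexToReal _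
  filter_upwards [ae_differentiableAt_of_absolutelyContinuous (h.ac α)] with t ht
  exact ht.hasDerivAt

theorem stronglyMeasurable_deriv_Pr (_h : DiagonalFlow lam Pr β ℓ C x) (α : ι) :
    StronglyMeasurable (deriv (Pr α)) := by
  have : FiniteDimensional ℝ (E →L[ℂ] E) := FiniteDimensional.complexToReal _
  have : CompleteSpace (E →L[ℂ] E) := FiniteDimensional.complete ℝ _
  exact stronglyMeasurable_deriv _

/-- By the eigenvalue relation `proj`, the component `Π_α x` oscillates exactly with the phase that
the exponential removes. What remains of the derivative is `Π_α'` applied to `x`, which is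
integrable in time. -/
theorem phase_identity (h : DiagonalFlow lam Pr β ℓ C x) (α : ι) (t ρ : ℝ) :
    IntervalIntegrable (fun r => Complex.exp (-(Complex.I * ρ * phase (lam α) r)) •
        deriv (Pr α) r (x r ρ)) volume 0 t ∧
    Complex.exp (-(Complex.I * ρ * phase (lam α) t)) • Pr α t (x t ρ) = Pr α 0 (x 0 ρ) +
      ∫ r in (0 : ℝ)..t, Complex.exp (-(Complex.I * ρ * phase (lam α) r)) •
        deriv (Pr α) r (x r ρ) := by
  have : CompleteSpace E := FiniteDimensional.complete ℂ _
  set e : ℝ → ℂ := fun t => Complex.exp (-(Complex.I * ρ * phase (lam α) t)) with he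
  have he' : ∀ t, HasDerivAt e (e t * (-(Complex.I * ρ * lam α t))) t := fun t =>
    (((hasDerivAt_phase (h.lam_cont α) t).ofReal_comp.const_mul (Complex.I * ρ)).neg).cexp
  set y : ℝ → E := fun t => e t • x t ρ with hy
  set x' : ℝ → E := fun t =>
    (Complex.I * (ρ : ℂ)) • ∑ α, (lam α t : ℂ) • Pr α t (x t ρ) with hx'
  have hy' : ∀ t, HasDerivAt y (e t • x' t + (e t * (-(Complex.I * ρ * lam α t))) • x t ρ) t :=
    fun t => (he' t).smul (h.flow t ρ)
  have hec : Continuous e := continuous_iff_continuousAt.2 fun t => (he' t).continuousAt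
  have hxc := h.continuous_x ρ
  have hx'c : Continuous x' := by
    refine (continuous_finsetSum _ fun α _ => ?_).const_smul _
    exact (Complex.continuous_ofReal.comp (h.lam_cont α)).smul
      ((h.continuous_Pr α).clm_apply hxc)
  have hyC : ContDiff ℝ 1 y := by
    rw [contDiff_one_iff_deriv]
    refine ⟨fun t => (hy' t).differentiableAt, ?_⟩
    rw [show deriv y = _ from funext fun t => (hy' t).deriv]
    exact (hec.smul hx'c).add ((hec.mul ((continuous_const.mul
      (Complex.continuous_ofReal.comp (h.lam_cont α))).neg)).smul hxc)
  have hyc : Continuous y := hyC.continuous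
  -- Product rule for increments: the operator is bounded by `C`, and `y` is bounded on the compact
  -- interval by `B`.
  have hac : AbsolutelyContinuousOnInterval (fun t => Pr α t (y t)) 0 t := by
    obtain ⟨B, hB⟩ := (isCompact_uIcc (a := (0 : ℝ)) (b := t)).exists_bound_of_continuousOn
      hyc.continuousOn
    refine absolutelyContinuousOnInterval_of_dist_le (C := max C B) one_pos
      (absolutelyContinuousOnInterval_of_contDiff hyC 0 t) (h.ac α 0 t) fun r _ s hs _ => ?_
    rw [dist_eq_norm, dist_eq_norm, dist_eq_norm]
    have e1 : Pr α r (y r) - Pr α s (y s) = Pr α r (y r - y s) + (Pr α r - Pr α s) (y s) := by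
      simp
    calc _ ≤ ‖Pr α r (y r - y s)‖ + ‖(Pr α r - Pr α s) (y s)‖ := e1 ▸ norm_add_le _ _
      _ ≤ C * ‖y r - y s‖ + ‖Pr α r - Pr α s‖ * B := by
        gcongr
        · exact (ContinuousLinearMap.le_opNorm _ _).trans (by gcongr; exact h.norm_le α r)
        · exact (ContinuousLinearMap.le_opNorm _ _).trans (by gcongr; exact hB s hs)
      _ ≤ max C B * ‖y r - y s‖ + ‖Pr α r - Pr α s‖ * max C B := by
        gcongr
        · exact le_max_left _ _
        · exact le_max_right _ _
      _ = _ := by ring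
  have hder : ∀ᵐ r, HasDerivAt (fun t => Pr α t (y t)) (e r • deriv (Pr α) r (x r ρ)) r := by
    filter_upwards [h.ae_hasDerivAt_Pr α] with r hr
    have h1 := ((ContinuousLinearMap.restrictScalarsL ℂ E E ℝ ℝ).hasFDerivAt.comp_hasDerivAt r
      hr).clm_apply (hy' r)
    convert! h1 using 1
    change e r • deriv (Pr α) r (x r ρ) = deriv (Pr α) r (e r • x r ρ) +
      Pr α r (e r • x' r + (e r * (-(Complex.I * ρ * lam α r))) • x r ρ)
    simp only [hx', map_smul, map_add, h.proj, smul_smul]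
    rw [← add_smul, left_eq_add]
    convert! zero_smul ℂ _
    ring
  have hInt : ∀ a b, IntervalIntegrable (fun r => e r • deriv (Pr α) r (x r ρ)) volume a b := by
    intro a b
    obtain ⟨B, hB⟩ := (isCompact_uIcc (a := a) (b := b)).exists_bound_of_continuousOn
      hyc.continuousOn
    refine (h.β_int.mul_const B).intervalIntegrable (a := a) (b := b) |>.mono_fun' ?_ ?_
    · have : StronglyMeasurable fun r => deriv (Pr α) r (x r ρ) :=
        isBoundedBilinearMap_apply.continuous.comp_stronglyMeasurable
          ((h.stronglyMeasurable_deriv_Pr α).prodMk hxc.stronglyMeasurable)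
      exact (hec.stronglyMeasurable.smul this).aestronglyMeasurable
    · filter_upwards [ae_restrict_of_ae (h.deriv_le α), ae_restrict_mem measurableSet_uIoc]
        with r hr hr2
      have : e r • deriv (Pr α) r (x r ρ) = deriv (Pr α) r (y r) := by simp [hy]
      simp only [this]
      refine (ContinuousLinearMap.le_opNorm _ _).trans ?_
      have := h.β_nonneg r
      gcongr
      exact hB r (uIoc_subset_uIcc hr2)
  refine ⟨hInt 0 t, ?_⟩
  have key := integral_eq_sub_of_absolutelyContinuous hac hder hInt
  rw [key]
  simp [hy, he, phase]

theorem norm_phase_smul (ρ s : ℝ) (y : E) :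
    ‖Complex.exp (-(Complex.I * ρ * s)) • y‖ = ‖y‖ := by
  rw [norm_smul, Complex.norm_exp]
  simp

theorem norm_le_sum_proj (h : DiagonalFlow lam Pr β ℓ C x) (t : ℝ) (y : E) :
    ‖y‖ ≤ ∑ α, ‖Pr α t y‖ := by
  have : y = ∑ α, Pr α t y := by
    rw [← sum_apply, h.sum_one]; simp
  conv_lhs => rw [this]
  exact norm_sum_le _ _

/-- The flow is bounded, uniformly in the frequency `ρ`. -/
theorem norm_x_le (h : DiagonalFlow lam Pr β ℓ C x) (t ρ : ℝ) :
    ‖x t ρ‖ ≤ 2 * (Fintype.card ι * C) * ‖x 0 ρ‖ := by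
  -- At a point `s` where `‖x‖` is maximal on `[-|t|, |t|]`, the coupling integral is at most `∫ β`
  -- times that maximum. After summation over the components, `small` lets half of the maximum
  -- absorb it.
  obtain ⟨s, hs, hmax⟩ := (isCompact_uIcc (a := -|t|) (b := |t|)).exists_isMaxOn nonempty_uIcc
    (h.continuous_x ρ).norm.continuousOn
  rw [uIcc_of_le (by linarith [abs_nonneg t])] at hs hmax
  refine (hmax (abs_le.1 le_rfl)).trans ?_
  change ‖x s ρ‖ ≤ _
  have h1 : ∀ α, ‖Pr α s (x s ρ)‖ ≤ C * ‖x 0 ρ‖ + (∫ r, β r) * ‖x s ρ‖ := by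
    intro α
    obtain ⟨-, hid⟩ := h.phase_identity α s ρ
    rw [← norm_phase_smul ρ (phase (lam α) s), hid]
    refine (norm_add_le _ _).trans (add_le_add ?_ ?_)
    · exact (ContinuousLinearMap.le_opNorm _ _).trans (by gcongr; exact h.norm_le α 0)
    · have hb : ∀ r ∈ uIoc 0 s, ‖x r ρ‖ ≤ ‖x s ρ‖ := by
        intro r hr
        refine hmax ?_
        have hr' := uIoc_subset_uIcc hr
        rw [mem_uIcc] at hr'
        constructor <;> rcases hr' with h | h <;> linarith [h.1, h.2, hs.1, hs.2, abs_nonneg t]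
      calc _ ≤ |∫ r in (0 : ℝ)..s, β r * ‖x s ρ‖| := by
            refine intervalIntegral.norm_integral_le_abs_of_norm_le ?_
              (h.β_int.mul_const _).intervalIntegrable
            filter_upwards [ae_restrict_of_ae (h.deriv_le α),
              ae_restrict_mem measurableSet_uIoc] with r hr hr2
            rw [norm_phase_smul]
            refine (ContinuousLinearMap.le_opNorm _ _).trans ?_
            have := h.β_nonneg r
            gcongr
            exact hb r hr2
        _ = |∫ r in (0 : ℝ)..s, β r| * ‖x s ρ‖ := by
            rw [intervalIntegral.integral_mul_const, abs_mul, abs_norm]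
        _ ≤ _ := by
            gcongr
            rw [← Real.norm_eq_abs]
            refine intervalIntegral.norm_integral_le_integral_norm_uIoc.trans ?_
            simp only [Real.norm_of_nonneg (h.β_nonneg _)]
            exact setIntegral_le_integral h.β_int (Eventually.of_forall h.β_nonneg)
  have h2 : ‖x s ρ‖ ≤ Fintype.card ι * (C * ‖x 0 ρ‖ + (∫ r, β r) * ‖x s ρ‖) := by
    refine (h.norm_le_sum_proj s _).trans ((Finset.sum_le_sum fun α _ => h1 α).trans_eq ?_)
    rw [Finset.sum_const, Finset.card_univ, nsmul_eq_mul]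
  have h3 := mul_le_mul_of_nonneg_right h.small (norm_nonneg (x s ρ))
  nlinarith [h3]

variable {n : ℕ}

theorem integrableOn_x (h : DiagonalFlow lam Pr β ℓ C x)
    (hx : IntegrableOn (fun ρ : ℝ => (ρ : ℂ) ^ n • x 0 ρ) (Ioi 0)) (t : ℝ) :
    IntegrableOn (fun ρ : ℝ => (ρ : ℂ) ^ n • x t ρ) (Ioi 0) := by
  refine (hx.norm.const_mul (2 * (Fintype.card ι * C))).mono' ?_ (Eventually.of_forall fun ρ => ?_)
  · have : StronglyMeasurable fun ρ => x t ρ := h.meas.comp_measurable measurable_prodMk_left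
    exact ((by fun_prop : Continuous fun ρ : ℝ => (ρ : ℂ) ^ n).stronglyMeasurable.smul
      this).aestronglyMeasurable
  · rw [norm_smul, norm_smul]
    calc _ ≤ ‖(ρ : ℂ) ^ n‖ * (2 * (Fintype.card ι * C) * ‖x 0 ρ‖) := by
          gcongr; exact h.norm_x_le t ρ
      _ = _ := by ring

theorem integrableOn_exp_smul {f : ℝ → E} (hf : IntegrableOn f (Ioi 0)) (τ : ℝ) :
    IntegrableOn (fun ρ : ℝ => Complex.exp (Complex.I * τ * ρ) • f ρ) (Ioi 0) := by
  refine hf.norm.mono' ?_ (Eventually.of_forall fun ρ => ?_)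
  · exact (by fun_prop : Continuous fun ρ : ℝ =>
      Complex.exp (Complex.I * τ * ρ)).aestronglyMeasurable.smul hf.aestronglyMeasurable
  · rw [norm_smul, Complex.norm_exp]; simp

/-- The radial Fourier integrals solve a transport system along the characteristics. -/
theorem transport_identity (h : DiagonalFlow lam Pr β ℓ C x)
    (hx : IntegrableOn (fun ρ : ℝ => (ρ : ℂ) ^ n • x 0 ρ) (Ioi 0)) (α : ι) (t τ : ℝ) :
    Pr α t (radialFourier n (x t) (τ - phase (lam α) t)) = Pr α 0 (radialFourier n (x 0) τ) +
      ∫ r in (0 : ℝ)..t, deriv (Pr α) r (radialFourier n (x r) (τ - phase (lam α) r)) := by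
  have : CompleteSpace E := FiniteDimensional.complete ℂ _
  set L := phase (lam α) with hL
  have hLc : Continuous L := continuous_phase (h.lam_cont α)
  have hcomm : ∀ (P : E →L[ℂ] E) (s r : ℝ), P (radialFourier n (x r) s) =
      ∫ ρ in Ioi (0 : ℝ), Complex.exp (Complex.I * s * ρ) • ((ρ : ℂ) ^ n • P (x r ρ)) := by
    intro P s r
    rw [radialFourier, ← ContinuousLinearMap.integral_comp_comm _
      (integrableOn_exp_smul (h.integrableOn_x hx r) s)]
    simp
  simp only [hcomm]
  -- Translating `τ` by the phase multiplies the integrand by the very exponential that occurs in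
  -- `phase_identity`.
  have hexp : ∀ (r ρ : ℝ) (y : E), Complex.exp (Complex.I * ((τ - L r : ℝ) : ℂ) * ρ) •
      ((ρ : ℂ) ^ n • y) = (Complex.exp (Complex.I * τ * ρ) * (ρ : ℂ) ^ n) •
        Complex.exp (-(Complex.I * ρ * L r)) • y := by
    intro r ρ y
    rw [smul_smul, smul_smul]
    congr 1
    rw [mul_right_comm (Complex.exp (Complex.I * τ * ρ)), ← Complex.exp_add]
    congr 2
    push_cast
    ring
  simp only [hexp]
  have hF : Integrable (fun p : ℝ × ℝ => (Complex.exp (Complex.I * τ * p.2) * (p.2 : ℂ) ^ n) •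
      Complex.exp (-(Complex.I * p.2 * L p.1)) • deriv (Pr α) p.1 (x p.1 p.2))
      ((volume.restrict (uIoc 0 t)).prod (volume.restrict (Ioi 0))) := by
    -- The uniform bound on the flow gives a majorant that is a product of a function of `r` and a
    -- function of `ρ`, so Fubini applies.
    refine ((h.β_int.restrict (s := uIoc 0 t)).mul_prod
      (hx.norm.const_mul (2 * (Fintype.card ι * C)))).mono' ?_ ?_
    · have h1 : StronglyMeasurable fun p : ℝ × ℝ => deriv (Pr α) p.1 (x p.1 p.2) :=
        isBoundedBilinearMap_apply.continuous.comp_stronglyMeasurable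
          (((h.stronglyMeasurable_deriv_Pr α).comp_measurable measurable_fst).prodMk h.meas)
      have h2 : Continuous fun p : ℝ × ℝ => Complex.exp (-(Complex.I * p.2 * L p.1)) := by
        fun_prop
      have h3 : Continuous fun p : ℝ × ℝ =>
        Complex.exp (Complex.I * τ * p.2) * (p.2 : ℂ) ^ n := by fun_prop
      exact (h3.stronglyMeasurable.smul (h2.stronglyMeasurable.smul h1)).aestronglyMeasurable
    · rw [Measure.prod_restrict]
      refine ae_restrict_of_ae ?_
      have := Measure.quasiMeasurePreserving_fst (μ := (volume : Measure ℝ))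
        (ν := (volume : Measure ℝ)) |>.ae (h.deriv_le α)
      filter_upwards [this] with p hp
      rw [norm_smul, norm_phase_smul, norm_mul, Complex.norm_exp, norm_smul]
      have hre : (Complex.I * (τ : ℂ) * (p.2 : ℂ)).re = 0 := by simp
      rw [hre, Real.exp_zero, one_mul]
      calc _ ≤ ‖(p.2 : ℂ) ^ n‖ * (β p.1 * (2 * (Fintype.card ι * C) * ‖x 0 p.2‖)) := by
            gcongr
            refine (ContinuousLinearMap.le_opNorm _ _).trans ?_
            have := h.β_nonneg p.1
            gcongr
            exact h.norm_x_le _ _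
        _ = _ := by ring
  have hswap : ∫ r in (0 : ℝ)..t, (∫ ρ in Ioi (0 : ℝ),
      (Complex.exp (Complex.I * τ * ρ) * (ρ : ℂ) ^ n) •
        Complex.exp (-(Complex.I * ρ * L r)) • deriv (Pr α) r (x r ρ)) =
      ∫ ρ in Ioi (0 : ℝ), ∫ r in (0 : ℝ)..t, (Complex.exp (Complex.I * τ * ρ) * (ρ : ℂ) ^ n) •
        Complex.exp (-(Complex.I * ρ * L r)) • deriv (Pr α) r (x r ρ) := by
    simp only [intervalIntegral.intervalIntegral_eq_integral_uIoc]
    rw [integral_integral_swap hF, integral_smul]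
  have hInt : Integrable (fun ρ : ℝ => ∫ r in (0 : ℝ)..t,
      (Complex.exp (Complex.I * τ * ρ) * (ρ : ℂ) ^ n) •
        Complex.exp (-(Complex.I * ρ * L r)) • deriv (Pr α) r (x r ρ))
      (volume.restrict (Ioi 0)) := by
    simp only [intervalIntegral.intervalIntegral_eq_integral_uIoc]
    exact hF.integral_prod_right.smul _
  rw [hswap, ← integral_add _ hInt]
  · refine integral_congr_ae (Eventually.of_forall fun ρ => ?_)
    have := (h.phase_identity α t ρ).2
    simp only [← hL] at this
    simp only [this, intervalIntegral.integral_smul, smul_add]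
    rw [mul_smul _ _ (Pr α 0 (x 0 ρ))]
  · have := integrableOn_exp_smul ((Pr α 0).integrable_comp hx) τ
    refine this.congr (Eventually.of_forall fun ρ => ?_)
    simp [smul_smul]

theorem enorm_proj_radialFourier_le (h : DiagonalFlow lam Pr β ℓ C x)
    (hx : IntegrableOn (fun ρ : ℝ => (ρ : ℂ) ^ n • x 0 ρ) (Ioi 0)) (α : ι) (t τ : ℝ) :
    ‖Pr α t (radialFourier n (x t) (τ - phase (lam α) t))‖ₑ ≤
      ENNReal.ofReal C * ‖radialFourier n (x 0) τ‖ₑ +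
      ∫⁻ r in uIoc 0 t, ENNReal.ofReal (β r) *
        ‖radialFourier n (x r) (τ - phase (lam α) r)‖ₑ := by
  have hop : ∀ (P : E →L[ℂ] E) (y : E) (c : ℝ), ‖P‖ ≤ c → ‖P y‖ₑ ≤ ENNReal.ofReal c * ‖y‖ₑ := by
    intro P y c hc
    rw [← ofReal_norm, ← ofReal_norm, ← ENNReal.ofReal_mul ((norm_nonneg _).trans hc)]
    exact ENNReal.ofReal_le_ofReal ((P.le_opNorm y).trans (by gcongr))
  rw [h.transport_identity hx]
  refine (enorm_add_le _ _).trans (add_le_add (hop _ _ _ (h.norm_le α 0)) ?_)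
  rw [intervalIntegral.intervalIntegral_eq_integral_uIoc]
  refine (?_ : _ ≤ ‖∫ r in uIoc 0 t, deriv (Pr α) r
    (radialFourier n (x r) (τ - phase (lam α) r))‖ₑ).trans ?_
  · rw [enorm_smul]
    split_ifs <;> simp
  · refine (enorm_integral_le_lintegral_enorm _).trans (lintegral_mono_ae ?_)
    filter_upwards [ae_restrict_of_ae (h.deriv_le α)] with r hr
    exact hop _ _ _ hr

theorem stronglyMeasurable_radialFourier (h : DiagonalFlow lam Pr β ℓ C x) :
    StronglyMeasurable fun p : ℝ × ℝ => radialFourier n (x p.1) p.2 := by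
  refine StronglyMeasurable.integral_prod_right (f := fun (p : ℝ × ℝ) (ρ : ℝ) =>
    Complex.exp (Complex.I * p.2 * ρ) • ((ρ : ℂ) ^ n • x p.1 ρ)) ?_
  have h1 : StronglyMeasurable fun q : (ℝ × ℝ) × ℝ => x q.1.1 q.2 :=
    h.meas.comp_measurable (by fun_prop : Measurable fun q : (ℝ × ℝ) × ℝ => (q.1.1, q.2))
  have h2 : Continuous fun q : (ℝ × ℝ) × ℝ => Complex.exp (Complex.I * q.1.2 * q.2) := by
    fun_prop
  have h3 : Continuous fun q : (ℝ × ℝ) × ℝ => (q.2 : ℂ) ^ n := by fun_prop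
  exact h2.stronglyMeasurable.smul (h3.stronglyMeasurable.smul h1)

theorem measurable_kernel (h : DiagonalFlow lam Pr β ℓ C x) (α : ι) {g : ℝ → ℝ}
    (hg : Measurable g) :
    AEMeasurable (Function.uncurry fun τ r => ENNReal.ofReal (β r) *
        ‖radialFourier n (x r) (g τ - phase (lam α) r)‖ₑ) (volume.prod volume) := by
  have hL := (continuous_phase (h.lam_cont α)).measurable
  refine AEMeasurable.mul (f := fun p : ℝ × ℝ => ENNReal.ofReal (β p.2))
    (g := fun p : ℝ × ℝ => ‖radialFourier n (x p.2) (g p.1 - phase (lam α) p.2)‖ₑ) ?_ ?_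
  · exact (h.β_int.aestronglyMeasurable.aemeasurable.comp_quasiMeasurePreserving
      Measure.quasiMeasurePreserving_snd).ennreal_ofReal
  · exact ((h.stronglyMeasurable_radialFourier (n := n)).comp_measurable
      (measurable_snd.prodMk ((hg.comp measurable_fst).sub
        (hL.comp measurable_snd)))).enorm.aemeasurable

theorem abs_phase_sub_le (h : DiagonalFlow lam Pr β ℓ C x) (α : ι) (t r : ℝ) :
    |phase (lam α) t - phase (lam α) r| ≤ ℓ * |t - r| := by
  have hi : ∀ a b, IntervalIntegrable (lam α) volume a b :=
    fun a b => (h.lam_cont α).intervalIntegrable a b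
  rw [phase, phase, intervalIntegral.integral_interval_sub_left (hi _ _) (hi _ _),
    ← Real.norm_eq_abs]
  exact intervalIntegral.norm_integral_le_of_norm_le_const fun s _ => h.lam_bound α s

theorem lintegral_β_le (h : DiagonalFlow lam Pr β ℓ C x) :
    (Fintype.card ι : ℝ≥0∞) * ∫⁻ t, ENNReal.ofReal (β t) ≤ 2⁻¹ := by
  rw [← ofReal_integral_eq_lintegral_ofReal h.β_int (Eventually.of_forall h.β_nonneg),
    ← ENNReal.ofReal_natCast, ← ENNReal.ofReal_mul (by positivity)]
  refine (ENNReal.ofReal_le_ofReal h.small).trans_eq ?_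
  rw [one_div, ENNReal.ofReal_inv_of_pos (by norm_num)]
  simp

theorem enorm_radialFourier_le_sum (h : DiagonalFlow lam Pr β ℓ C x) (t : ℝ) (y : E) :
    ‖y‖ₑ ≤ ∑ α, ‖Pr α t y‖ₑ := by
  simp only [← ofReal_norm]
  rw [← ENNReal.ofReal_sum_of_nonneg fun _ _ => norm_nonneg _]
  exact ENNReal.ofReal_le_ofReal (h.norm_le_sum_proj t y)

/-- Finite speed of propagation turns the transport system into a closed inequality on windows. -/
theorem lintegral_window_le (h : DiagonalFlow lam Pr β ℓ C x)
    (hx : IntegrableOn (fun ρ : ℝ => (ρ : ℂ) ^ n • x 0 ρ) (Ioi 0)) (a T : ℝ)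
    {X : ℝ≥0∞} (hX : ∀ r, |r| ≤ T →
      ∫⁻ τ in {τ | |τ| ≤ a + ℓ * (T - |r|)}, ‖radialFourier n (x r) τ‖ₑ ≤ X)
    (t : ℝ) (ht : |t| ≤ T) :
    ∫⁻ τ in {τ | |τ| ≤ a + ℓ * (T - |t|)}, ‖radialFourier n (x t) τ‖ₑ ≤
      Fintype.card ι * ENNReal.ofReal C * (∫⁻ τ, ‖radialFourier n (x 0) τ‖ₑ) + 2⁻¹ * X := by
  set W : ℝ → Set ℝ := fun r => {τ | |τ| ≤ a + ℓ * (T - |r|)} with hW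
  have hWm : ∀ r, MeasurableSet (W r) := fun r =>
    measurableSet_le (by fun_prop) measurable_const
  have hone : ∀ α, ∫⁻ τ in W t, ‖Pr α t (radialFourier n (x t) τ)‖ₑ ≤
      ENNReal.ofReal C * (∫⁻ τ, ‖radialFourier n (x 0) τ‖ₑ) +
        (∫⁻ r, ENNReal.ofReal (β r)) * X := by
    intro α
    have hpt : ∀ τ, ‖Pr α t (radialFourier n (x t) τ)‖ₑ ≤
        ENNReal.ofReal C * ‖radialFourier n (x 0) (τ + phase (lam α) t)‖ₑ +
        ∫⁻ r in uIoc 0 t, ENNReal.ofReal (β r) *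
          ‖radialFourier n (x r) ((τ + phase (lam α) t) - phase (lam α) r)‖ₑ := by
      intro τ
      simpa using h.enorm_proj_radialFourier_le hx α t (τ + phase (lam α) t)
    have hmeas0 : Measurable fun τ =>
        ENNReal.ofReal C * ‖radialFourier n (x 0) (τ + phase (lam α) t)‖ₑ :=
      (((h.stronglyMeasurable_radialFourier (n := n)).comp_measurable
        (measurable_const.prodMk (by fun_prop : Measurable fun τ => τ + phase (lam α) t))).enorm
        ).const_mul _
    refine (lintegral_mono hpt).trans ?_
    rw [lintegral_add_left hmeas0]
    refine add_le_add ?_ ?_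
    · refine (setLIntegral_le_lintegral _ _).trans ?_
      rw [lintegral_const_mul' _ _ ENNReal.ofReal_ne_top,
        lintegral_add_right_eq_self (fun τ => ‖radialFourier n (x 0) τ‖ₑ)]
    · have hk := h.measurable_kernel (n := n) α
        (by fun_prop : Measurable fun τ => τ + phase (lam α) t)
      rw [lintegral_lintegral_swap]
      · calc _ ≤ ∫⁻ r in uIoc 0 t, ENNReal.ofReal (β r) * X := by
              refine setLIntegral_mono' measurableSet_uIoc fun r hr => ?_
              rw [lintegral_const_mul' _ _ ENNReal.ofReal_ne_top]
              gcongr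
              -- Since `r` lies between `0` and `t`, the window at `r` is wider than the window at
              -- `t` by exactly `ℓ |t - r|` on each side.
              have hr' : |r| + |t - r| = |t| := by
                rcases le_total 0 t with h0 | h0
                · rw [uIoc_of_le h0] at hr
                  rw [abs_of_pos hr.1, abs_of_nonneg h0, abs_of_nonneg (by linarith [hr.2])]; ring
                · rw [uIoc_of_ge h0] at hr
                  rw [abs_of_nonpos hr.2, abs_of_nonpos h0,
                    abs_of_nonpos (by linarith [hr.1])]; ring
              have hc := h.abs_phase_sub_le α t r
              refine le_trans ?_ (hX r (by linarith [abs_nonneg (t - r)]))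
              rw [← lintegral_indicator (hWm t), ← lintegral_indicator (hWm r),
                ← lintegral_add_right_eq_self ((W r).indicator _)
                  (phase (lam α) t - phase (lam α) r)]
              refine lintegral_mono fun τ => ?_
              by_cases hτ : τ ∈ W t
              -- A characteristic moves by at most `ℓ |t - r|`, hence stays inside the wider window.
              · have hτ' : τ + (phase (lam α) t - phase (lam α) r) ∈ W r := by
                  simp only [hW, mem_ofPred_eq] at hτ ⊢
                  have := abs_add_le τ (phase (lam α) t - phase (lam α) r)
                  have e : ℓ * |t - r| = ℓ * (|t| - |r|) := by rw [← hr']; ring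
                  nlinarith
                rw [indicator_of_mem hτ, indicator_of_mem hτ', add_sub_assoc]
              · rw [indicator_of_notMem hτ]; exact zero_le
          _ ≤ ∫⁻ r, ENNReal.ofReal (β r) * X := setLIntegral_le_lintegral _ _
          _ = _ := by
              rw [lintegral_mul_const'' _ h.β_int.aestronglyMeasurable.aemeasurable.ennreal_ofReal]
      · rw [Measure.prod_restrict]
        exact hk.restrict
  calc _ ≤ ∫⁻ τ in W t, ∑ α, ‖Pr α t (radialFourier n (x t) τ)‖ₑ :=
        lintegral_mono fun τ => h.enorm_radialFourier_le_sum t _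
    _ = ∑ α, ∫⁻ τ in W t, ‖Pr α t (radialFourier n (x t) τ)‖ₑ := by
        refine lintegral_finsetSum _ fun α _ => ?_
        have : StronglyMeasurable fun τ => radialFourier n (x t) τ :=
          (h.stronglyMeasurable_radialFourier (n := n)).comp_measurable measurable_prodMk_left
        exact ((Pr α t).continuous.comp_stronglyMeasurable this).enorm
    _ ≤ ∑ α : ι, (ENNReal.ofReal C * (∫⁻ τ, ‖radialFourier n (x 0) τ‖ₑ) +
        (∫⁻ r, ENNReal.ofReal (β r)) * X) := Finset.sum_le_sum fun α _ => hone α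
    _ = Fintype.card ι * ENNReal.ofReal C * (∫⁻ τ, ‖radialFourier n (x 0) τ‖ₑ) +
        (Fintype.card ι * ∫⁻ r, ENNReal.ofReal (β r)) * X := by
        rw [Finset.sum_const, Finset.card_univ, nsmul_eq_mul]; ring
    _ ≤ _ := by gcongr; exact h.lintegral_β_le

/-- The uniform bound makes the mass of `radialFourier` on every bounded window finite, and without
finiteness nothing could be absorbed. -/
theorem enorm_radialFourier_le (h : DiagonalFlow lam Pr β ℓ C x)
    (hx : IntegrableOn (fun ρ : ℝ => (ρ : ℂ) ^ n • x 0 ρ) (Ioi 0)) :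
    ∃ B : ℝ≥0, ∀ t τ, ‖radialFourier n (x t) τ‖ₑ ≤ B := by
  refine ⟨(∫ ρ in Ioi (0 : ℝ), 2 * (Fintype.card ι * C) *
    ‖(ρ : ℂ) ^ n • x 0 ρ‖).toNNReal, fun t τ => ?_⟩
  rw [← ofReal_norm]
  refine ENNReal.ofReal_le_ofReal ?_
  refine norm_integral_le_of_norm_le (hx.norm.const_mul _) (Eventually.of_forall fun ρ => ?_)
  rw [norm_smul, Complex.norm_exp, norm_smul, norm_smul]
  have hre : (Complex.I * (τ : ℂ) * (ρ : ℂ)).re = 0 := by simp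
  rw [hre, Real.exp_zero, one_mul]
  calc _ ≤ ‖(ρ : ℂ) ^ n‖ * (2 * (Fintype.card ι * C) * ‖x 0 ρ‖) := by
        gcongr; exact h.norm_x_le t ρ
    _ = _ := by ring

/-- The mass on the whole line is not known to be finite beforehand, so absorption is done for the
supremum of the masses over windows that shrink as `|r|` grows and have half-width `a` at time `t`.
The bound does not depend on `a`, and `a` tends to infinity. -/
theorem lintegral_radialFourier_le (h : DiagonalFlow lam Pr β ℓ C x)
    (hx : IntegrableOn (fun ρ : ℝ => (ρ : ℂ) ^ n • x 0 ρ) (Ioi 0)) (hℓ : 0 ≤ ℓ) (t : ℝ) :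
    ∫⁻ τ, ‖radialFourier n (x t) τ‖ₑ ≤
      2 * (Fintype.card ι * ENNReal.ofReal C * ∫⁻ τ, ‖radialFourier n (x 0) τ‖ₑ) := by
  have hwin : ∀ a : ℕ, ∫⁻ τ in {τ : ℝ | |τ| ≤ a}, ‖radialFourier n (x t) τ‖ₑ ≤
      2 * (Fintype.card ι * ENNReal.ofReal C * ∫⁻ τ, ‖radialFourier n (x 0) τ‖ₑ) := by
    intro a
    set N : ℝ → ℝ≥0∞ := fun r => ∫⁻ τ in {τ : ℝ | |τ| ≤ a + ℓ * (|t| - |r|)},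
      ‖radialFourier n (x r) τ‖ₑ with hN
    set X : ℝ≥0∞ := ⨆ r, ⨆ _ : |r| ≤ |t|, N r with hXdef
    obtain ⟨B, hB⟩ := h.enorm_radialFourier_le hx
    have hXtop : X ≠ ∞ := by
      refine ne_top_of_le_ne_top (b := B * volume {τ : ℝ | |τ| ≤ a + ℓ * |t|})
        (ENNReal.mul_ne_top ENNReal.coe_ne_top ?_) ?_
      · have : {τ : ℝ | |τ| ≤ a + ℓ * |t|} = Icc (-(a + ℓ * |t|)) (a + ℓ * |t|) := by
          ext τ; simp [abs_le]
        rw [this, Real.volume_Icc]; exact ENNReal.ofReal_ne_top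
      · refine iSup₂_le fun r _ => ?_
        calc N r ≤ ∫⁻ τ in {τ : ℝ | |τ| ≤ a + ℓ * (|t| - |r|)}, (B : ℝ≥0∞) :=
              lintegral_mono fun τ => hB r τ
          _ = B * volume {τ : ℝ | |τ| ≤ a + ℓ * (|t| - |r|)} := by simp
          _ ≤ _ := by
              gcongr with τ
              nlinarith [abs_nonneg r]
    have hXle : X ≤ Fintype.card ι * ENNReal.ofReal C *
        (∫⁻ τ, ‖radialFourier n (x 0) τ‖ₑ) + 2⁻¹ * X :=
      iSup₂_le fun r hr => h.lintegral_window_le hx a |t|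
        (fun s hs => le_iSup₂ (f := fun r (_ : |r| ≤ |t|) => N r) s hs) r hr
    refine le_trans ?_ (ENNReal_le_two_mul_of_le_add_half hXtop hXle)
    refine le_trans ?_ (le_iSup₂ (f := fun r (_ : |r| ≤ |t|) => N r) t le_rfl)
    simp [hN]
  have hU : (univ : Set ℝ) = ⋃ a : ℕ, {τ : ℝ | |τ| ≤ a} := by
    ext τ
    simpa using exists_nat_ge |τ|
  rw [← setLIntegral_univ, hU, setLIntegral_iUnion_of_directed]
  · exact iSup_le hwin
  · refine Monotone.directed_le fun a b hab τ (hτ : |τ| ≤ a) => ?_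
    exact hτ.trans (by exact_mod_cast hab)

/-- Integrability in time of the components that travel at a speed bounded away from zero. -/
theorem lintegral_proj_radialFourier_zero_le (h : DiagonalFlow lam Pr β ℓ C x)
    (hx : IntegrableOn (fun ρ : ℝ => (ρ : ℂ) ^ n • x 0 ρ) (Ioi 0)) (hℓ : 0 ≤ ℓ) {d : ℝ}
    (hd : 0 < d) (α : ι) (hα : (∀ t, d ≤ lam α t) ∨ ∀ t, lam α t ≤ -d) :
    ∫⁻ t, ‖Pr α t (radialFourier n (x t) 0)‖ₑ ≤
      ENNReal.ofReal (2 * C / d) * ∫⁻ τ, ‖radialFourier n (x 0) τ‖ₑ := by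
  set Y := ∫⁻ τ, ‖radialFourier n (x 0) τ‖ₑ with hY
  have hC : 0 ≤ C := (norm_nonneg _).trans (h.norm_le α 0)
  have hpt : ∀ t, ‖Pr α t (radialFourier n (x t) 0)‖ₑ ≤
      ENNReal.ofReal C * ‖radialFourier n (x 0) (phase (lam α) t)‖ₑ +
      ∫⁻ r, ENNReal.ofReal (β r) *
        ‖radialFourier n (x r) (phase (lam α) t - phase (lam α) r)‖ₑ := by
    intro t
    have := h.enorm_proj_radialFourier_le hx α t (phase (lam α) t)
    rw [sub_self] at this
    exact this.trans (by gcongr; exact Measure.restrict_le_self)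
  have hLm := (continuous_phase (h.lam_cont α)).measurable
  have hder := hasDerivAt_phase (h.lam_cont α)
  refine (lintegral_mono hpt).trans ?_
  have hmeas0 : Measurable fun t =>
      ENNReal.ofReal C * ‖radialFourier n (x 0) (phase (lam α) t)‖ₑ :=
    (((h.stronglyMeasurable_radialFourier (n := n)).comp_measurable
      (measurable_const.prodMk hLm)).enorm).const_mul _
  rw [lintegral_add_left hmeas0,
    lintegral_lintegral_swap (h.measurable_kernel (n := n) α hLm),
    lintegral_const_mul' _ _ ENNReal.ofReal_ne_top]
  have h1 : ∫⁻ t, ‖radialFourier n (x 0) (phase (lam α) t)‖ₑ ≤ ENNReal.ofReal d⁻¹ * Y :=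
    lintegral_comp_le_of_le_deriv (f := fun τ => ‖radialFourier n (x 0) τ‖ₑ) hd hder hα
  -- After the exchange of integrals, `r` is fixed while `t` varies: the substitution by the phase
  -- leaves the full `τ`-integral at time `r`, which is bounded uniformly in `r`.
  have h2 : ∀ r, ∫⁻ t, ENNReal.ofReal (β r) *
      ‖radialFourier n (x r) (phase (lam α) t - phase (lam α) r)‖ₑ ≤
      ENNReal.ofReal (β r) * (ENNReal.ofReal d⁻¹ *
        (2 * (Fintype.card ι * ENNReal.ofReal C * Y))) := by
    intro r
    rw [lintegral_const_mul' _ _ ENNReal.ofReal_ne_top]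
    gcongr
    refine (lintegral_comp_le_of_le_deriv (f := fun τ => ‖radialFourier n (x r) τ‖ₑ) hd
      (fun t => (hder t).sub_const (phase (lam α) r)) hα).trans ?_
    gcongr
    exact h.lintegral_radialFourier_le hx hℓ r
  calc _ ≤ ENNReal.ofReal C * (ENNReal.ofReal d⁻¹ * Y) + ∫⁻ r, ENNReal.ofReal (β r) *
        (ENNReal.ofReal d⁻¹ * (2 * (Fintype.card ι * ENNReal.ofReal C * Y))) := by
        gcongr
        exact h2 _
    _ = ENNReal.ofReal C * (ENNReal.ofReal d⁻¹ * Y) +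
        (Fintype.card ι * ∫⁻ r, ENNReal.ofReal (β r)) *
        (ENNReal.ofReal d⁻¹ * (2 * (ENNReal.ofReal C * Y))) := by
        rw [lintegral_mul_const'' _ h.β_int.aestronglyMeasurable.aemeasurable.ennreal_ofReal]
        ring
    _ ≤ ENNReal.ofReal C * (ENNReal.ofReal d⁻¹ * Y) +
        2⁻¹ * (ENNReal.ofReal d⁻¹ * (2 * (ENNReal.ofReal C * Y))) := by
        gcongr
        exact h.lintegral_β_le
    -- The initial data contribute `1`, and the coupling contributes another `2⁻¹ * 2`; this is the
    -- factor `2` in `2 * C / d`.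
    _ = (2⁻¹ * 2 + 1) * (ENNReal.ofReal C * ENNReal.ofReal d⁻¹ * Y) := by ring
    _ = _ := by
        rw [ENNReal.inv_mul_cancel (by simp) (by simp), one_add_one_eq_two, ← mul_assoc,
          ← ENNReal.ofReal_mul hC, ← ENNReal.ofReal_ofNat, ← ENNReal.ofReal_mul (by norm_num)]
        congr 2
        ring

theorem measurable_enorm_proj_radialFourier (h : DiagonalFlow lam Pr β ℓ C x) (α : ι) :
    Measurable fun t => ‖(lam α t : ℂ) • Pr α t (radialFourier n (x t) 0)‖ₑ := by
  have h1 : StronglyMeasurable fun t => radialFourier n (x t) 0 :=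
    (h.stronglyMeasurable_radialFourier (n := n)).comp_measurable measurable_prodMk_right
  have h2 : StronglyMeasurable fun t => Pr α t (radialFourier n (x t) 0) :=
    isBoundedBilinearMap_apply.continuous.comp_stronglyMeasurable
      ((h.continuous_Pr α).stronglyMeasurable.prodMk h1)
  exact ((Complex.continuous_ofReal.comp (h.lam_cont α)).stronglyMeasurable.smul h2).enorm

end DiagonalFlow

/-! ### Spectral projections of matrices with separated real eigenvalues. -/

section Spectral
open Polynomial
open scoped Matrix.Norms.Frobenius

variable {m : ℕ}

/-- The topology of matrices, presented as the topology of the Frobenius norm. -/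
local instance matTopology (m : ℕ) : TopologicalSpace (Mat m) :=
  (Matrix.frobeniusNormedAddCommGroup (m := Fin m) (n := Fin m) (α := ℂ)
    ).toPseudoMetricSpace.toUniformSpace.toTopologicalSpace

/-- `φ` lists, in increasing order, the eigenvalues of `A`; they are real with gaps `≥ d`. -/
def IsGapSpectrum (d : ℝ) (A : Mat m) (φ : Fin m → ℝ) : Prop :=
  (∀ j k, j < k → φ j + d ≤ φ k) ∧ ∀ z : ℂ, A.charpoly.eval z = ∏ j, (z - φ j)

/-- Sorting removes the arbitrariness of the labelling; the sorted eigenvalues will be continuous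
along continuous curves. -/
theorem exists_isGapSpectrum {d : ℝ} {A : Mat m} {φ : Fin m → ℝ}
    (hA : A.charpoly = ∏ j, (X - C (φ j : ℂ))) (hφ : ∀ j k, j ≠ k → d ≤ |φ j - φ k|) :
    ∃ ψ, IsGapSpectrum d A ψ := by
  refine ⟨φ ∘ Tuple.sort φ, fun j k hjk => ?_, fun z => ?_⟩
  · have h1 := Tuple.monotone_sort φ hjk.le
    have h2 := hφ (Tuple.sort φ k) (Tuple.sort φ j) (by simpa using hjk.ne')
    rw [abs_of_nonneg (by simpa using h1)] at h2
    simp only [Function.comp] at h1 ⊢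
    linarith
  · rw [hA, eval_prod]
    simp only [eval_sub, eval_X, eval_C, Function.comp]
    exact (Equiv.prod_comp (Tuple.sort φ) fun j => z - (φ j : ℂ)).symm

theorem continuous_eval_charpoly : Continuous fun p : Mat m × ℂ => p.1.charpoly.eval p.2 := by
  change @Continuous _ _ (@instTopologicalSpaceProd _ _ instTopologicalSpaceMatrix _) _ _
  simp only [Matrix.eval_charpoly]
  refine Continuous.matrix_det (Continuous.sub ?_ continuous_fst)
  simp only [Matrix.scalar_apply]
  exact Continuous.matrix_diagonal (continuous_pi fun _ => continuous_snd)

namespace IsGapSpectrum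

variable {d : ℝ} {A A' : Mat m} {φ φ' : Fin m → ℝ}

theorem gap_le_abs_sub (h : IsGapSpectrum d A φ) {j k : Fin m} (hjk : j ≠ k) :
    d ≤ |φ j - φ k| := by
  rcases lt_or_gt_of_ne hjk with hlt | hlt
  · have := h.1 _ _ hlt
    rw [abs_sub_comm]
    exact (by linarith : d ≤ φ k - φ j).trans (le_abs_self _)
  · have := h.1 _ _ hlt
    exact (by linarith : d ≤ φ j - φ k).trans (le_abs_self _)

theorem abs_le (h : IsGapSpectrum d A φ) (j : Fin m) : |φ j| ≤ ‖A‖ * ‖(1 : Mat m)‖ := by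
  have hr : A.charpoly.IsRoot (φ j : ℂ) := by
    rw [IsRoot, h.2]
    exact Finset.prod_eq_zero (Finset.mem_univ j) (sub_self _)
  have := spectrum.norm_le_norm_mul_of_mem (Matrix.mem_spectrum_iff_isRoot_charpoly.2 hr)
  simpa using this

theorem charpoly_eq (h : IsGapSpectrum d A φ) : A.charpoly = ∏ j, (X - C (φ j : ℂ)) := by
  refine Polynomial.funext fun z => ?_
  rw [h.2, eval_prod]
  simp

end IsGapSpectrum

/-- Eigenvalues of bounded matrices lie in a compact box, and both the gaps and the factorised
characteristic polynomial survive passage to a convergent subsequence. Closedness later carries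
hyperbolicity from rational times to all times. -/
theorem isClosed_setOf_isGapSpectrum (d ℓ : ℝ) :
    IsClosed {A : Mat m | ‖A‖ ≤ ℓ ∧ ∃ φ, IsGapSpectrum d A φ} := by
  refine IsSeqClosed.isClosed fun A A₀ hA hlim => ?_
  have hn : ‖A₀‖ ≤ ℓ := le_of_tendsto' hlim.norm fun q => (hA q).1
  refine ⟨hn, ?_⟩
  choose φ hφ using fun q => (hA q).2
  set b := ℓ * ‖(1 : Mat m)‖
  have hb : ∀ q, φ q ∈ Icc (fun _ => -b) (fun _ => b) := fun q => by
    have : ∀ j, |φ q j| ≤ b := fun j => ((hφ q).abs_le j).trans (by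
      exact mul_le_mul_of_nonneg_right (hA q).1 (norm_nonneg _))
    exact ⟨fun j => (_root_.abs_le.1 (this j)).1, fun j => (_root_.abs_le.1 (this j)).2⟩
  obtain ⟨ψ, -, σ, hσ, hψ⟩ := isCompact_Icc.tendsto_subseq hb
  have hψj : ∀ j, Tendsto (fun q => φ (σ q) j) atTop (𝓝 (ψ j)) := fun j =>
    (tendsto_pi_nhds.1 hψ) j
  refine ⟨ψ, fun j k hjk => ?_, fun z => ?_⟩
  · exact le_of_tendsto_of_tendsto' ((hψj j).add_const d) (hψj k) fun q => (hφ (σ q)).1 j k hjk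
  · have h1 : Tendsto (fun q => (A (σ q)).charpoly.eval z) atTop (𝓝 (A₀.charpoly.eval z)) :=
      ((continuous_eval_charpoly.tendsto (A₀, z)).comp
        ((hlim.comp hσ.tendsto_atTop).prodMk_nhds tendsto_const_nhds))
    have h2 : Tendsto (fun q => ∏ j, (z - (φ (σ q) j : ℂ))) atTop (𝓝 (∏ j, (z - (ψ j : ℂ)))) :=
      tendsto_finsetProd _ fun j _ => tendsto_const_nhds.sub
        ((Complex.continuous_ofReal.tendsto _).comp (hψj j))
    refine tendsto_nhds_unique h1 (h2.congr fun q => ((hφ (σ q)).2 z).symm)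

theorem eq_id_of_strictMono_fin {π : Fin m → Fin m} (h : StrictMono π) (j : Fin m) : π j = j :=
  le_antisymm h.apply_le h.le_apply

/-- The characteristic polynomial of `a t` is small at an eigenvalue of `a t₀`, so one of its `m`
linear factors is small there. This selects a nearby eigenvalue for each index, and the selection
preserves the order, hence is the identity. -/
theorem continuous_of_isGapSpectrum {d : ℝ} (hd : 0 < d) {a : ℝ → Mat m} (ha : Continuous a)
    {φ : ℝ → Fin m → ℝ} (hφ : ∀ t, IsGapSpectrum d (a t) (φ t)) : Continuous φ := by
  refine continuous_pi fun i => continuous_iff_continuousAt.2 fun t₀ => ?_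
  rw [ContinuousAt, Metric.tendsto_nhds]
  intro ε hε
  -- The cap `d / 2` prevents the nearby eigenvalues of two different indices from coinciding or
  -- changing order.
  set ε' := min ε (d / 2)
  have hε' : 0 < ε' := by positivity
  have hev : ∀ j, ∀ᶠ t in 𝓝 t₀, ‖(a t).charpoly.eval (φ t₀ j : ℂ)‖ < ε' ^ m := by
    intro j
    have hc : Continuous fun t => ‖(a t).charpoly.eval (φ t₀ j : ℂ)‖ :=
      (continuous_eval_charpoly.comp (ha.prodMk continuous_const)).norm
    refine hc.continuousAt.eventually_lt continuousAt_const ?_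
    rw [(hφ t₀).2, Finset.prod_eq_zero (Finset.mem_univ j) (sub_self _), norm_zero]
    positivity
  filter_upwards [eventually_all.2 hev] with t ht
  have hex : ∀ j, ∃ k, |φ t₀ j - φ t k| < ε' := by
    intro j
    by_contra! hcon
    refine absurd (ht j) (not_lt.2 ?_)
    rw [(hφ t).2, norm_prod]
    calc ε' ^ m = ∏ _k : Fin m, ε' := by simp
      _ ≤ _ := by
        refine Finset.prod_le_prod (fun _ _ => hε'.le) fun k _ => (hcon k).trans_eq ?_
        rw [← Complex.ofReal_sub, Complex.norm_real, Real.norm_eq_abs]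
  choose π hπ using hex
  have hmono : StrictMono π := by
    intro j l hjl
    by_contra! hcon
    have h1 := (hφ t₀).1 j l hjl
    have h2 : φ t (π l) ≤ φ t (π j) := by
      rcases hcon.eq_or_lt with h | h
      · rw [h]
      · linarith [(hφ t).1 _ _ h]
    have h3 := abs_lt.1 (hπ j)
    have h4 := abs_lt.1 (hπ l)
    have : ε' ≤ d / 2 := min_le_right _ _
    linarith [h3.1, h4.2]
  have := hπ i
  rw [eq_id_of_strictMono_fin hmono, abs_sub_comm] at this
  exact this.trans_le (min_le_left _ _)

/-- The spectral projection of `A` for the eigenvalue `φ j`. -/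
def specProj (A : Mat m) (φ : Fin m → ℝ) (j : Fin m) : Mat m :=
  aeval A (Lagrange.basis Finset.univ (fun j => (φ j : ℂ)) j)

theorem commute_specProj (A : Mat m) (φ : Fin m → ℝ) (j : Fin m) :
    A * specProj A φ j = specProj A φ j * A := by
  have h := congrArg (aeval A) (mul_comm X (Lagrange.basis Finset.univ (fun j => (φ j : ℂ)) j))
  simpa [specProj] using h

namespace IsGapSpectrum

variable {d : ℝ} {A A' : Mat m} {φ φ' : Fin m → ℝ}

theorem injective (h : IsGapSpectrum d A φ) (hd : 0 < d) :
    Function.Injective fun j => (φ j : ℂ) := by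
  intro j k hjk
  by_contra hne
  have := h.gap_le_abs_sub hne
  rw [Complex.ofReal_injective hjk, sub_self, abs_zero] at this
  linarith

theorem sum_specProj (h : IsGapSpectrum d A φ) (hd : 0 < d) : ∑ j, specProj A φ j = 1 := by
  rcases Nat.eq_zero_or_pos m with rfl | hm
  · exact Subsingleton.elim _ _
  · have : Nonempty (Fin m) := ⟨⟨0, hm⟩⟩
    simp only [specProj]
    rw [← map_sum, Lagrange.sum_basis (h.injective hd).injOn Finset.univ_nonempty, map_one]

/-- The Lagrange polynomial times `X - φ j` is a constant multiple of the characteristic polynomial,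
which annihilates `A` by Cayley–Hamilton. -/
theorem mul_specProj (h : IsGapSpectrum d A φ) (j : Fin m) :
    A * specProj A φ j = (φ j : ℂ) • specProj A φ j := by
  have h1 : (X - C (φ j : ℂ)) * Lagrange.basis Finset.univ (fun j => (φ j : ℂ)) j =
      C (∏ k ∈ Finset.univ.erase j, ((φ j : ℂ) - φ k)⁻¹) * A.charpoly := by
    rw [h.charpoly_eq, Lagrange.basis]
    simp only [Lagrange.basisDivisor, Finset.prod_mul_distrib]
    rw [← Finset.mul_prod_erase Finset.univ (fun k => X - C (φ k : ℂ)) (Finset.mem_univ j),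
      map_prod]
    ring
  have h2 := congrArg (aeval A) h1
  rw [map_mul, map_mul, Matrix.aeval_self_charpoly, mul_zero, map_sub, aeval_X, aeval_C,
    sub_mul, sub_eq_zero] at h2
  rw [specProj, h2, Algebra.smul_def]

theorem specProj_mul (h : IsGapSpectrum d A φ) (j : Fin m) :
    specProj A φ j * A = (φ j : ℂ) • specProj A φ j := by
  rw [← commute_specProj, h.mul_specProj]

/-- The projection is a product of factors `(A - φₖ) / (φⱼ - φₖ)`, each controlled by the gap.
Taking the maximum with `1` allows the exponent `m` although only the indices other than `j` occur.
-/
theorem norm_specProj_le (h : IsGapSpectrum d A φ) (hd : 0 < d) {Λ : ℝ} (hA : ‖A‖ ≤ Λ)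
    (j : Fin m) : ‖specProj A φ j‖ ≤
      ‖(1 : Mat m)‖ * max 1 (d⁻¹ * (Λ + Λ * ‖(1 : Mat m)‖ * ‖(1 : Mat m)‖)) ^ m := by
  set B := max 1 (d⁻¹ * (Λ + Λ * ‖(1 : Mat m)‖ * ‖(1 : Mat m)‖)) with hB
  have hfac : ∀ k, k ≠ j → ‖aeval A (Lagrange.basisDivisor (φ j : ℂ) (φ k : ℂ))‖ ≤ B := by
    intro k hk
    have h1 : aeval A (Lagrange.basisDivisor (φ j : ℂ) (φ k : ℂ)) =
        ((φ j : ℂ) - φ k)⁻¹ • (A - (φ k : ℂ) • 1) := by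
      simp [Lagrange.basisDivisor, Algebra.smul_def]
    rw [h1, norm_smul]
    refine le_trans ?_ (le_max_right _ _)
    gcongr
    · rw [norm_inv, ← Complex.ofReal_sub, Complex.norm_real]
      exact inv_anti₀ hd (h.gap_le_abs_sub hk.symm)
    · refine (norm_sub_le _ _).trans (add_le_add hA ?_)
      rw [norm_smul, Complex.norm_real]
      gcongr
      exact (h.abs_le k).trans (by gcongr)
  have hprod : ∀ s : Finset (Fin m), j ∉ s →
      ‖aeval A (∏ k ∈ s, Lagrange.basisDivisor (φ j : ℂ) (φ k : ℂ))‖ ≤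
        ‖(1 : Mat m)‖ * B ^ s.card := by
    intro s
    induction s using Finset.induction_on with
    | empty => simp
    | insert k s hks ih =>
      intro hj
      rw [Finset.prod_insert hks, map_mul, Finset.card_insert_of_notMem hks, pow_succ]
      have hk : k ≠ j := fun e => hj (by simp [e])
      have := ih fun e => hj (by simp [e])
      calc _ ≤ _ := norm_mul_le _ _
        _ ≤ B * (‖(1 : Mat m)‖ * B ^ s.card) := by
          gcongr
          exact hfac k hk
        _ = _ := by ring
  refine (hprod (Finset.univ.erase j) (by simp)).trans ?_
  gcongr
  · exact le_max_left _ _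
  · exact (Finset.card_le_univ _).trans (by simp)

/-- Evaluating `Pⱼ (A - A') P'ₖ` by both eigenvalue relations gives `(φⱼ - φ'ₖ) Pⱼ P'ₖ`. The scalar
is at least `d / 2` in modulus, as the eigenvalues have moved by at most `d / 2`. -/
theorem norm_specProj_mul_le (h : IsGapSpectrum d A φ) (h' : IsGapSpectrum d A' φ') (hd : 0 < d)
    {B : ℝ} (hB : ∀ j, ‖specProj A φ j‖ ≤ B) (hB' : ∀ j, ‖specProj A' φ' j‖ ≤ B)
    (hφ : ∀ j, |φ j - φ' j| ≤ d / 2) {j k : Fin m} (hjk : j ≠ k) :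
    ‖specProj A φ j * specProj A' φ' k‖ ≤ 2 / d * B ^ 2 * ‖A - A'‖ := by
  have hB0 : 0 ≤ B := (norm_nonneg _).trans (hB j)
  have e : specProj A φ j * (A - A') * specProj A' φ' k =
      ((φ j - φ' k : ℝ) : ℂ) • (specProj A φ j * specProj A' φ' k) := by
    rw [mul_sub, sub_mul, h.specProj_mul, mul_assoc _ A', h'.mul_specProj]
    push_cast
    rw [sub_smul, smul_mul_assoc, mul_smul_comm]
  have hgap : d / 2 ≤ |φ j - φ' k| := by
    have h1 := h.gap_le_abs_sub hjk
    have h2 := hφ k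
    have h3 := abs_sub_le (φ j) (φ' k) (φ k)
    rw [abs_sub_comm (φ' k)] at h3
    linarith
  have hn := congrArg norm e
  rw [norm_smul, Complex.norm_real, Real.norm_eq_abs] at hn
  have h4 : ‖specProj A φ j * (A - A') * specProj A' φ' k‖ ≤ B ^ 2 * ‖A - A'‖ := by
    calc _ ≤ ‖specProj A φ j‖ * ‖A - A'‖ * ‖specProj A' φ' k‖ :=
          (norm_mul_le _ _).trans (by gcongr; exact norm_mul_le _ _)
      _ ≤ B * ‖A - A'‖ * B := by
          gcongr
          · exact hB j
          · exact hB' k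
      _ = _ := by ring
  have h5 : d / 2 * ‖specProj A φ j * specProj A' φ' k‖ ≤ B ^ 2 * ‖A - A'‖ := by
    refine le_trans ?_ h4
    rw [hn]
    gcongr
  calc _ = 2 / d * (d / 2 * ‖specProj A φ j * specProj A' φ' k‖) := by field_simp
    _ ≤ 2 / d * (B ^ 2 * ‖A - A'‖) := by gcongr
    _ = _ := by ring

/-- Inserting both resolutions of the identity writes the difference as the sum over `k` of `Pⱼ P'ₖ
- Pₖ P'ⱼ`. The term `k = j` cancels and all others are off-diagonal products. -/
theorem norm_specProj_sub_le (h : IsGapSpectrum d A φ) (h' : IsGapSpectrum d A' φ') (hd : 0 < d)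
    {B : ℝ} (hB : ∀ j, ‖specProj A φ j‖ ≤ B) (hB' : ∀ j, ‖specProj A' φ' j‖ ≤ B)
    (hφ : ∀ j, |φ j - φ' j| ≤ d / 2) (j : Fin m) :
    ‖specProj A φ j - specProj A' φ' j‖ ≤ m * (4 / d * B ^ 2) * ‖A - A'‖ := by
  have e : specProj A φ j - specProj A' φ' j =
      ∑ k, (specProj A φ j * specProj A' φ' k - specProj A φ k * specProj A' φ' j) := by
    rw [Finset.sum_sub_distrib, ← Finset.mul_sum, ← Finset.sum_mul, h.sum_specProj hd,
      h'.sum_specProj hd, mul_one, one_mul]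
  have hterm : ∀ k, ‖specProj A φ j * specProj A' φ' k - specProj A φ k * specProj A' φ' j‖ ≤
      4 / d * B ^ 2 * ‖A - A'‖ := by
    intro k
    by_cases hk : j = k
    · subst hk
      rw [sub_self, norm_zero]
      positivity
    · refine (norm_sub_le _ _).trans ((add_le_add (h.norm_specProj_mul_le h' hd hB hB' hφ hk)
        (h.norm_specProj_mul_le h' hd hB hB' hφ (Ne.symm hk))).trans_eq ?_)
      ring
  rw [e]
  refine (norm_sum_le _ _).trans ((Finset.sum_le_sum fun k _ => hterm k).trans_eq ?_)
  rw [Finset.sum_const, Finset.card_univ, Fintype.card_fin, nsmul_eq_mul]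
  ring

end IsGapSpectrum

/-- The operator `X ↦ P_j X P_k^*` on matrices. -/
def biProj (A : Mat m) (φ : Fin m → ℝ) (α : Fin m × Fin m) : Mat m →L[ℂ] Mat m :=
  ContinuousLinearMap.mulLeftRight ℂ (Mat m) (specProj A φ α.1) (star (specProj A φ α.2))

theorem biProj_apply (A : Mat m) (φ : Fin m → ℝ) (α : Fin m × Fin m) (Y : Mat m) :
    biProj A φ α Y = specProj A φ α.1 * Y * star (specProj A φ α.2) := rfl

theorem norm_biProj_le {A : Mat m} {φ : Fin m → ℝ} {B : ℝ} (hB : ∀ j, ‖specProj A φ j‖ ≤ B)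
    (α : Fin m × Fin m) : ‖biProj A φ α‖ ≤ B ^ 2 := by
  refine (ContinuousLinearMap.opNorm_mulLeftRight_apply_apply_le ℂ (Mat m) _ _).trans ?_
  rw [norm_star, sq]
  have := (norm_nonneg _).trans (hB α.1)
  gcongr
  · exact hB _
  · exact hB _

namespace IsGapSpectrum

variable {d : ℝ} {A A' : Mat m} {φ φ' : Fin m → ℝ}

theorem sum_biProj (h : IsGapSpectrum d A φ) (hd : 0 < d) : ∑ α, biProj A φ α = 1 := by
  ext1 Y
  rw [sum_apply]
  simp only [biProj_apply, Fintype.sum_prod_type, ← Finset.mul_sum]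
  rw [← star_sum, h.sum_specProj hd, ← Finset.sum_mul, ← Finset.sum_mul, h.sum_specProj hd]
  simp

/-- `Pₖ^*` is an eigenprojection of `A^*` for the same number, because the eigenvalues are real. The
eigenvalues of the commutator are therefore the differences: zero on the diagonal and at least `d`
in modulus elsewhere. -/
theorem biProj_commutator (h : IsGapSpectrum d A φ) (α : Fin m × Fin m) (Y : Mat m) :
    biProj A φ α (A * Y - Y * star A) = ((φ α.1 - φ α.2 : ℝ) : ℂ) • biProj A φ α Y := by
  have h2 : star A * star (specProj A φ α.2) = (φ α.2 : ℂ) • star (specProj A φ α.2) := by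
    rw [← star_mul, h.specProj_mul, star_smul]
    simp
  rw [map_sub]
  simp only [biProj_apply]
  rw [← mul_assoc, h.specProj_mul, ← mul_assoc, mul_assoc _ (star A), h2]
  push_cast
  rw [sub_smul, smul_mul_assoc, smul_mul_assoc, mul_smul_comm]

theorem sum_smul_biProj (h : IsGapSpectrum d A φ) (hd : 0 < d) (Y : Mat m) :
    ∑ α, ((φ α.1 - φ α.2 : ℝ) : ℂ) • biProj A φ α Y = A * Y - Y * star A := by
  simp only [← h.biProj_commutator]
  rw [← sum_apply, h.sum_biProj hd]
  rfl

theorem norm_biProj_sub_le (h : IsGapSpectrum d A φ) (h' : IsGapSpectrum d A' φ') (hd : 0 < d)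
    {B : ℝ} (hB : ∀ j, ‖specProj A φ j‖ ≤ B) (hB' : ∀ j, ‖specProj A' φ' j‖ ≤ B)
    (hφ : ∀ j, |φ j - φ' j| ≤ d / 2) (α : Fin m × Fin m) :
    ‖biProj A φ α - biProj A' φ' α‖ ≤ m * (8 / d * B ^ 3) * ‖A - A'‖ := by
  have hB0 : 0 ≤ B := (norm_nonneg _).trans (hB α.1)
  have e : biProj A φ α - biProj A' φ' α =
      ContinuousLinearMap.mulLeftRight ℂ (Mat m) (specProj A φ α.1 - specProj A' φ' α.1)
        (star (specProj A φ α.2)) +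
      ContinuousLinearMap.mulLeftRight ℂ (Mat m) (specProj A' φ' α.1)
        (star (specProj A φ α.2 - specProj A' φ' α.2)) := by
    rw [star_sub]
    simp only [biProj, map_sub, sub_apply]
    abel
  rw [e]
  refine (norm_add_le _ _).trans ((add_le_add
    (ContinuousLinearMap.opNorm_mulLeftRight_apply_apply_le ℂ (Mat m) _ _)
    (ContinuousLinearMap.opNorm_mulLeftRight_apply_apply_le ℂ (Mat m) _ _)).trans ?_)
  rw [norm_star, norm_star]
  have h1 := h.norm_specProj_sub_le h' hd hB hB' hφ
  calc _ ≤ m * (4 / d * B ^ 2) * ‖A - A'‖ * B + B * (m * (4 / d * B ^ 2) * ‖A - A'‖) := by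
        gcongr
        · exact h1 _
        · exact hB _
        · exact hB' _
        · exact h1 _
    _ = _ := by ring

end IsGapSpectrum

end Spectral

/-! ### Estimates along a single ray. -/

section Ray
open scoped Matrix.Norms.Frobenius
attribute [local instance] matTopology

variable {m : ℕ}

/-- A bound for the spectral projections of matrices of norm `≤ Λ` with gap `d`. -/
def projBound (m : ℕ) (d Λ : ℝ) : ℝ :=
  ‖(1 : Mat m)‖ * max 1 (d⁻¹ * (Λ + Λ * ‖(1 : Mat m)‖ * ‖(1 : Mat m)‖)) ^ m

/-- A Lipschitz constant for `A ↦ (X ↦ P_j X P_k^*)`. -/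
def projLip (m : ℕ) (d Λ : ℝ) : ℝ := m * (8 / d * projBound m d Λ ^ 3)

theorem projBound_nonneg (m : ℕ) (d Λ : ℝ) : 0 ≤ projBound m d Λ := by
  unfold projBound
  have : (0 : ℝ) ≤ max 1 (d⁻¹ * (Λ + Λ * ‖(1 : Mat m)‖ * ‖(1 : Mat m)‖)) :=
    zero_le_one.trans (le_max_left _ _)
  positivity

theorem projLip_nonneg (m : ℕ) {d : ℝ} (hd : 0 < d) (Λ : ℝ) : 0 ≤ projLip m d Λ := by
  unfold projLip
  have := projBound_nonneg m d Λ
  positivity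

/-- Lipschitz dependence of the projections on the matrix transfers absolute continuity from `a` to
the `Π_α` and bounds their derivatives by a multiple of `‖b t‖`. A speed is a difference of two
eigenvalues, whence the factor `2` in its bound. -/
theorem diagonalFlow_of_isGapSpectrum {d Λ : ℝ} (hd : 0 < d) {a b : ℝ → Mat m}
    (hab : ∀ s t, a t - a s = ∫ r in s..t, b r) (hb : Integrable b) (hΛ : ∀ t, ‖a t‖ ≤ Λ)
    {φ : ℝ → Fin m → ℝ} (hφ : ∀ t, IsGapSpectrum d (a t) (φ t))
    (hsmall : (m * m : ℕ) * (projLip m d Λ * ∫ t, ‖b t‖) ≤ 1 / 2)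
    {x : ℝ → ℝ → Mat m} (hx : StronglyMeasurable (Function.uncurry x))
    (hflow : ∀ t ρ, HasDerivAt (fun t => x t ρ)
      ((Complex.I * (ρ : ℂ)) • (a t * x t ρ - x t ρ * star (a t))) t) :
    DiagonalFlow (fun (α : Fin m × Fin m) t => φ t α.1 - φ t α.2)
      (fun α t => biProj (a t) (φ t) α) (fun t => projLip m d Λ * ‖b t‖)
      (2 * (Λ * ‖(1 : Mat m)‖)) (projBound m d Λ ^ 2) x := by
  have hi : ∀ s t, IntervalIntegrable b volume s t := fun _ _ => hb.intervalIntegrable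
  have hac : ∀ s t, AbsolutelyContinuousOnInterval a s t := fun s t => by
    have h0 := absolutelyContinuousOnInterval_primitive hi 0 s t
    refine absolutelyContinuousOnInterval_of_dist_le (C := 1) one_pos h0 h0 fun u _ v _ _ => ?_
    have e : dist (a u) (a v) = dist (∫ r in (0 : ℝ)..u, b r) (∫ r in (0 : ℝ)..v, b r) := by
      rw [← hab, ← hab, dist_sub_right]
    rw [e]
    linarith [dist_nonneg (x := ∫ r in (0 : ℝ)..u, b r) (y := ∫ r in (0 : ℝ)..v, b r)]
  have hac' : Continuous a := by
    refine continuous_iff_continuousAt.2 fun t => ?_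
    refine ((hac (t - 1) (t + 1)).continuousOn).continuousAt ?_
    rw [uIcc_of_le (by linarith)]
    exact Icc_mem_nhds (by linarith) (by linarith)
  have hφc : Continuous φ := continuous_of_isGapSpectrum hd hac' hφ
  have hader : ∀ᵐ t, HasDerivAt a (b t) t := by
    filter_upwards [_root_.LocallyIntegrable.ae_hasDerivAt_integral hb.locallyIntegrable] with t ht
    have h1 := (ht 0).const_add (a 0)
    refine h1.congr_of_eventuallyEq (Eventually.of_forall fun s => ?_)
    change a s = a 0 + ∫ r in (0 : ℝ)..s, b r
    rw [← hab, add_sub_cancel]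
  have hB : ∀ t j, ‖specProj (a t) (φ t) j‖ ≤ projBound m d Λ := fun t j =>
    (hφ t).norm_specProj_le hd (hΛ t) j
  have hlip : ∀ s t, dist (φ s) (φ t) ≤ d / 2 → ∀ α,
      ‖biProj (a s) (φ s) α - biProj (a t) (φ t) α‖ ≤ projLip m d Λ * ‖a s - a t‖ :=
    fun s t hst α => (hφ s).norm_biProj_sub_le (hφ t) hd (hB s) (hB t)
      (fun j => (dist_le_pi_dist (φ s) (φ t) j).trans hst) α
  have hacP : ∀ α s t, AbsolutelyContinuousOnInterval (fun t => biProj (a t) (φ t) α) s t := by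
    intro α s t
    -- The Lipschitz bound needs eigenvalues that differ by at most `d / 2`; uniform continuity
    -- guarantees this for times closer than `η`.
    obtain ⟨η, hη, hu⟩ := Metric.uniformContinuousOn_iff.1
      ((isCompact_uIcc (a := s) (b := t)).uniformContinuousOn_of_continuous hφc.continuousOn)
      (d / 2) (by positivity)
    refine absolutelyContinuousOnInterval_of_dist_le (C := projLip m d Λ) hη (hac s t) (hac s t)
      fun u hu' v hv' huv => ?_
    have h1 := hlip u v (hu u hu' v hv' huv).le α
    have h2 := projLip_nonneg m hd Λ
    rw [dist_eq_norm, dist_eq_norm]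
    nlinarith [norm_nonneg (a u - a v)]
  have hsum : ∀ t y, ∑ γ : Fin m × Fin m, ((φ t γ.1 - φ t γ.2 : ℝ) : ℂ) • biProj (a t) (φ t) γ y =
      a t * y - y * star (a t) := fun t y => (hφ t).sum_smul_biProj hd y
  refine
    { lam_cont := fun α => ((continuous_apply α.1).comp hφc).sub ((continuous_apply α.2).comp hφc)
      lam_bound := fun α t => ?_
      sum_one := fun t => (hφ t).sum_biProj hd
      norm_le := fun α t => norm_biProj_le (hB t) α
      ac := hacP
      deriv_le := fun α => ?_
      β_nonneg := fun t => mul_nonneg (projLip_nonneg m hd Λ) (norm_nonneg _)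
      β_int := hb.norm.const_mul _
      small := ?_
      flow := fun t ρ => ?_
      proj := fun α t y => ?_
      meas := hx }
  · have h1 : ∀ j, |φ t j| ≤ Λ * ‖(1 : Mat m)‖ := fun j =>
      ((hφ t).abs_le j).trans (mul_le_mul_of_nonneg_right (hΛ t) (norm_nonneg _))
    have h2 := abs_sub (φ t α.1) (φ t α.2)
    linarith [h1 α.1, h1 α.2]
  · have : FiniteDimensional ℝ (Mat m →L[ℂ] Mat m) := FiniteDimensional.complexToReal _
    filter_upwards [ae_differentiableAt_of_absolutelyContinuous (hacP α), hader] with t ht hat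
    refine norm_deriv_le_of_eventually_norm_sub_le ht.hasDerivAt hat ?_
    have : ∀ᶠ s in 𝓝 t, dist (φ s) (φ t) < d / 2 :=
      Metric.tendsto_nhds.1 (hφc.tendsto t) (d / 2) (by positivity)
    filter_upwards [this] with s hs
    exact hlip s t hs.le α
  · rw [integral_const_mul]
    simpa using hsmall
  · rw [hsum]; exact hflow t ρ
  · rw [hsum]; exact (hφ t).biProj_commutator α y

/-- Estimates along a single ray: the flow is bounded and its commutator with the symbol, integrated
over the ray, is integrable in time. -/
theorem exists_ray_bounds (m : ℕ) {d Λ : ℝ} (hd : 0 < d) (hΛ0 : 0 ≤ Λ) :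
    ∃ K₀ M : ℝ, 0 < K₀ ∧ 0 < M ∧ ∀ (a b : ℝ → Mat m), (∀ s t, a t - a s = ∫ r in s..t, b r) →
      Integrable b → (∀ t, ‖a t‖ ≤ Λ) → (∀ t, ∃ φ, IsGapSpectrum d (a t) φ) →
      ∫ t, ‖b t‖ ≤ K₀ → ∀ x : ℝ → ℝ → Mat m, StronglyMeasurable (Function.uncurry x) →
      (∀ t ρ, HasDerivAt (fun t => x t ρ)
        ((Complex.I * (ρ : ℂ)) • (a t * x t ρ - x t ρ * star (a t))) t) →
      (∀ t ρ, ‖x t ρ‖ ≤ M * ‖x 0 ρ‖) ∧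
      ∀ n : ℕ, IntegrableOn (fun ρ : ℝ => (ρ : ℂ) ^ n • x 0 ρ) (Ioi 0) →
        ∫⁻ t, ‖a t * radialFourier n (x t) 0 - radialFourier n (x t) 0 * star (a t)‖ₑ ≤
          ENNReal.ofReal M * ∫⁻ τ, ‖radialFourier n (x 0) τ‖ₑ := by
  set D := projLip m d Λ
  have hD : 0 ≤ D := projLip_nonneg m hd Λ
  set P := projBound m d Λ
  have hP : 0 ≤ P := projBound_nonneg m d Λ
  set ℓ := 2 * (Λ * ‖(1 : Mat m)‖) with hℓdef
  have hℓ : 0 ≤ ℓ := by positivity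
  set M₁ := 2 * ((m * m : ℕ) * P ^ 2)
  have hM₁ : 0 ≤ M₁ := by positivity
  set M₂ := (m * m : ℕ) * (ℓ * (2 * P ^ 2 / d))
  have hM₂ : 0 ≤ M₂ := by positivity
  -- The first witness makes `m² D ∫ ‖b‖` at most `1 / 2`, the added `1` covering `D = 0`. `M₁`
  -- bounds the flow, and `M₂` sums the `m²` components, each with speed at most `ℓ` and crossing
  -- constant `2 P² / d`.
  refine ⟨(2 * ((m * m : ℕ) * D + 1))⁻¹, M₁ + M₂ + 1, by positivity, by positivity, ?_⟩
  intro a b hab hb hΛ hφ' hK x hx hflow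
  choose φ hφ using hφ'
  have hsmall : (m * m : ℕ) * (D * ∫ t, ‖b t‖) ≤ 1 / 2 := by
    calc (m * m : ℕ) * (D * ∫ t, ‖b t‖) ≤ (m * m : ℕ) * (D * (2 * ((m * m : ℕ) * D + 1))⁻¹) := by
          gcongr
      _ = ((m * m : ℕ) * D) / ((m * m : ℕ) * D + 1) / 2 := by
          field_simp
      _ ≤ 1 / 2 := by
          gcongr
          exact div_le_one_of_le₀ (by linarith) (by positivity)
  have h := diagonalFlow_of_isGapSpectrum hd hab hb hΛ hφ hsmall hx hflow
  refine ⟨fun t ρ => ?_, fun n hn => ?_⟩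
  · refine (h.norm_x_le t ρ).trans ?_
    gcongr
    simp only [Fintype.card_prod, Fintype.card_fin]
    change M₁ ≤ _
    linarith
  · have hpt : ∀ t, ‖a t * radialFourier n (x t) 0 - radialFourier n (x t) 0 * star (a t)‖ₑ ≤
        ∑ α : Fin m × Fin m, ‖((φ t α.1 - φ t α.2 : ℝ) : ℂ) •
          biProj (a t) (φ t) α (radialFourier n (x t) 0)‖ₑ := by
      intro t
      rw [← (hφ t).sum_smul_biProj hd]
      exact enorm_sum_le _ _
    have hone : ∀ α : Fin m × Fin m, ∫⁻ t, ‖((φ t α.1 - φ t α.2 : ℝ) : ℂ) •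
          biProj (a t) (φ t) α (radialFourier n (x t) 0)‖ₑ ≤
        ENNReal.ofReal (ℓ * (2 * P ^ 2 / d)) * ∫⁻ τ, ‖radialFourier n (x 0) τ‖ₑ := by
      intro α
      by_cases hα : α.1 = α.2
      · simp [hα]
      -- The eigenvalues are sorted at every time, so the sign of the difference depends only on the
      -- indices.
      have hsep : (∀ t, d ≤ φ t α.1 - φ t α.2) ∨ ∀ t, φ t α.1 - φ t α.2 ≤ -d := by
        rcases lt_or_gt_of_ne hα with hlt | hlt
        · exact Or.inr fun t => by linarith [(hφ t).1 _ _ hlt]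
        · exact Or.inl fun t => by linarith [(hφ t).1 _ _ hlt]
      have h1 := h.lintegral_proj_radialFourier_zero_le hn hℓ hd α hsep
      calc _ ≤ ∫⁻ t, ENNReal.ofReal ℓ * ‖biProj (a t) (φ t) α (radialFourier n (x t) 0)‖ₑ := by
            refine lintegral_mono fun t => ?_
            rw [enorm_smul]
            gcongr
            rw [← ofReal_norm, Complex.norm_real]
            exact ENNReal.ofReal_le_ofReal (h.lam_bound α t)
        _ ≤ ENNReal.ofReal ℓ * (ENNReal.ofReal (2 * P ^ 2 / d) *
              ∫⁻ τ, ‖radialFourier n (x 0) τ‖ₑ) := by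
            rw [lintegral_const_mul' _ _ ENNReal.ofReal_ne_top]
            gcongr
        _ = _ := by rw [← mul_assoc, ← ENNReal.ofReal_mul hℓ]
    calc _ ≤ ∫⁻ t, ∑ α : Fin m × Fin m, ‖((φ t α.1 - φ t α.2 : ℝ) : ℂ) •
          biProj (a t) (φ t) α (radialFourier n (x t) 0)‖ₑ := lintegral_mono hpt
      _ = ∑ α : Fin m × Fin m, ∫⁻ t, ‖((φ t α.1 - φ t α.2 : ℝ) : ℂ) •
          biProj (a t) (φ t) α (radialFourier n (x t) 0)‖ₑ := by
          exact lintegral_finsetSum _ fun α _ => h.measurable_enorm_proj_radialFourier α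
      _ ≤ ∑ _α : Fin m × Fin m, ENNReal.ofReal (ℓ * (2 * P ^ 2 / d)) *
            ∫⁻ τ, ‖radialFourier n (x 0) τ‖ₑ := Finset.sum_le_sum fun α _ => hone α
      _ = ENNReal.ofReal M₂ * ∫⁻ τ, ‖radialFourier n (x 0) τ‖ₑ := by
          rw [Finset.sum_const, Finset.card_univ, Fintype.card_prod, Fintype.card_fin,
            nsmul_eq_mul, ← mul_assoc, ← ENNReal.ofReal_natCast, ← ENNReal.ofReal_mul (by positivity)]
      _ ≤ _ := by
          gcongr
          linarith

end Ray

/-! ### Polar coordinates and null sets of directions. -/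

section Polar

/-- The measure `ρⁿ⁻¹ dρ` on `(0, ∞)`. -/
def radialMeasure (n : ℕ) : Measure ℝ :=
  (volume.restrict (Ioi (0 : ℝ))).withDensity fun ρ => ENNReal.ofReal (ρ ^ (n - 1))

instance (n : ℕ) : SFinite (radialMeasure n) := by unfold radialMeasure; infer_instance

instance (n : ℕ) : IsFiniteMeasure (surf n) := by unfold surf; infer_instance

theorem measurePreserving_coe_volumeIoiPow (n : ℕ) :
    MeasurePreserving (Subtype.val : Ioi (0 : ℝ) → ℝ) (Measure.volumeIoiPow (n - 1))
      (radialMeasure n) := by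
  refine ⟨measurable_subtype_coe, ?_⟩
  ext s hs
  rw [Measure.map_apply measurable_subtype_coe hs, Measure.volumeIoiPow, radialMeasure,
    withDensity_apply _ (measurable_subtype_coe hs), withDensity_apply _ hs,
    setLIntegral_subtype measurableSet_Ioi _ fun a : ℝ => ENNReal.ofReal (a ^ (n - 1)),
    Measure.restrict_restrict hs, Subtype.image_preimage_coe, inter_comm]

theorem measurePreserving_polar {n : ℕ} (hn : 1 ≤ n) :
    MeasurePreserving (fun p : Sphere n × ℝ => p.2 • (p.1 : Space n))
      ((surf n).prod (radialMeasure n)) volume := by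
  have : Nonempty (Fin n) := ⟨⟨0, hn⟩⟩
  have hmeas : Measurable fun p : Sphere n × ℝ => p.2 • (p.1 : Space n) := by fun_prop
  refine ⟨hmeas, ?_⟩
  have h1 := (volume : Measure (Space n)).measurePreserving_homeomorphUnitSphereProd
  rw [finrank_euclideanSpace_fin] at h1
  have h2 := h1.symm (homeomorphUnitSphereProd (Space n)).toMeasurableEquiv
  have h3 : MeasurePreserving (Subtype.val : ({0}ᶜ : Set (Space n)) → Space n)
      (Measure.comap Subtype.val volume) volume := by
    have := measurePreserving_subtype_coe (μa := (volume : Measure (Space n)))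
      (measurableSet_singleton (0 : Space n)).compl
    rwa [restrict_compl_singleton] at this
  have h4 := h3.comp h2
  have h5 : MeasurePreserving (Prod.map id Subtype.val : Sphere n × Ioi (0 : ℝ) → Sphere n × ℝ)
      ((surf n).prod (Measure.volumeIoiPow (n - 1))) ((surf n).prod (radialMeasure n)) :=
    MeasureTheory.MeasurePreserving.prod (MeasurePreserving.id (surf n))
      (measurePreserving_coe_volumeIoiPow n)
  rw [← h5.map_eq, Measure.map_map hmeas h5.measurable]
  exact h4.map_eq

theorem ae_radialMeasure {n : ℕ} {Q : ℝ → Prop} :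
    (∀ᵐ ρ ∂(radialMeasure n), Q ρ) ↔ ∀ᵐ ρ ∂(volume.restrict (Ioi (0 : ℝ))), Q ρ := by
  rw [radialMeasure, ae_withDensity_iff (by fun_prop)]
  refine eventually_congr ?_
  filter_upwards [ae_restrict_mem measurableSet_Ioi] with ρ hρ
  have : 0 < ρ ^ (n - 1) := pow_pos hρ _
  simp [this]

/-- The direction `ξ / |ξ|` (an arbitrary unit vector when `ξ = 0`). -/
def direction {n : ℕ} (e : Sphere n) (ξ : Space n) : Sphere n :=
  ⟨if ξ = 0 then (e : Space n) else ‖ξ‖⁻¹ • ξ, by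
    split_ifs with h
    · exact e.2
    · simp [norm_smul, h]⟩

theorem measurable_direction {n : ℕ} (e : Sphere n) : Measurable (direction e) := by
  refine Measurable.subtype_mk ?_
  exact Measurable.ite (measurableSet_singleton _) measurable_const (by fun_prop)

theorem norm_smul_direction {n : ℕ} (e : Sphere n) (ξ : Space n) :
    ‖ξ‖ • (direction e ξ : Space n) = ξ := by
  by_cases h : ξ = 0
  · simp [h]
  · simp [direction, h, smul_smul]

theorem direction_smul {n : ℕ} (e : Sphere n) {ρ : ℝ} (hρ : 0 < ρ) (ω : Sphere n) :
    direction e (ρ • (ω : Space n)) = ω := by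
  have h1 : ‖(ω : Space n)‖ = 1 := by simp
  have h0 : ρ • (ω : Space n) ≠ 0 := by
    rw [← norm_pos_iff, norm_smul, h1]; simpa using hρ.ne'
  ext1
  simp [direction, h0, norm_smul, h1, smul_smul, abs_of_pos hρ, hρ.ne']

theorem norm_smul_sphere {n : ℕ} {ρ : ℝ} (hρ : 0 < ρ) (ω : Sphere n) :
    ‖ρ • (ω : Space n)‖ = ρ := by
  simp [norm_smul, abs_of_pos hρ]

/-- The cone over a null set of directions is null, by Tonelli in polar coordinates. Statements
about almost every `ω` thereby become statements about almost every `ξ`. -/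
theorem quasiMeasurePreserving_direction {n : ℕ} (hn : 1 ≤ n) (e : Sphere n) :
    Measure.QuasiMeasurePreserving (direction e) volume (surf n) := by
  refine ⟨measurable_direction e, ?_⟩
  refine Measure.AbsolutelyContinuous.mk fun s hs h0 => ?_
  have hT := measurePreserving_polar hn
  rw [Measure.map_apply (measurable_direction e) hs,
    ← hT.measure_preimage (measurable_direction e hs).nullMeasurableSet]
  have h1 : ∀ᵐ p ∂((surf n).prod (radialMeasure n)), p.1 ∉ s := by
    have : ∀ᵐ ω ∂(surf n), ω ∉ s := by rw [ae_iff]; simpa using h0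
    exact Measure.quasiMeasurePreserving_fst.ae this
  have h2 : ∀ᵐ p ∂((surf n).prod (radialMeasure n)), 0 < p.2 := by
    refine Measure.quasiMeasurePreserving_snd.ae (p := fun ρ : ℝ => 0 < ρ) ?_
    exact ae_radialMeasure.2 (ae_restrict_mem measurableSet_Ioi)
  rw [← compl_compl (_ ⁻¹' _), ← mem_ae_iff]
  filter_upwards [h1, h2] with p hp1 hp2 h3
  rw [mem_preimage, mem_preimage, direction_smul e hp2] at h3
  exact hp1 h3

theorem nonempty_sphere {n : ℕ} (hn : 1 ≤ n) : Nonempty (Sphere n) :=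
  ⟨⟨EuclideanSpace.single ⟨0, hn⟩ 1, by simp⟩⟩

theorem integrable_radialMeasure {n : ℕ} {E : Type*} [NormedAddCommGroup E] [NormedSpace ℝ E]
    {f : ℝ → E} : Integrable f (radialMeasure n) ↔
      IntegrableOn (fun ρ => ρ ^ (n - 1) • f ρ) (Ioi (0 : ℝ)) := by
  rw [radialMeasure, integrable_withDensity_iff_integrable_smul₀' (by fun_prop) (by simp)]
  refine integrable_congr ?_
  filter_upwards [ae_restrict_mem measurableSet_Ioi] with ρ hρ
  rw [ENNReal.toReal_ofReal (pow_nonneg (le_of_lt hρ) _)]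

theorem integral_radialMeasure {n : ℕ} {E : Type*} [NormedAddCommGroup E] [NormedSpace ℝ E]
    (f : ℝ → E) : ∫ ρ, f ρ ∂(radialMeasure n) = ∫ ρ in Ioi (0 : ℝ), ρ ^ (n - 1) • f ρ := by
  rw [radialMeasure, integral_withDensity_eq_integral_toReal_smul₀ (by fun_prop) (by simp)]
  refine integral_congr_ae ?_
  filter_upwards [ae_restrict_mem measurableSet_Ioi] with ρ hρ
  rw [ENNReal.toReal_ofReal (pow_nonneg (le_of_lt hρ) _)]

end Polar

/-! ### Frobenius norm, measurability and integrals in terms of matrix entries. -/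

section Entries
open scoped Matrix.Norms.Frobenius
attribute [local instance] matTopology

variable {m : ℕ}

/-- The entry `A ↦ A i j` as a continuous linear map. -/
def entryCLM (i j : Fin m) : Mat m →L[ℂ] ℂ :=
  LinearMap.toContinuousLinearMap (Matrix.entryLinearMap ℂ ℂ i j)

@[simp] theorem entryCLM_apply (i j : Fin m) (A : Mat m) : entryCLM i j A = A i j := rfl

/-- The matrix with a single nonzero entry, as a continuous linear function of this entry. -/
def singleCLM (i j : Fin m) : ℂ →L[ℂ] Mat m :=
  LinearMap.toContinuousLinearMap (Matrix.singleLinearMap ℂ i j)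

theorem eq_sum_singleCLM (A : Mat m) : A = ∑ i, ∑ j, singleCLM i j (A i j) :=
  Matrix.matrix_eq_sum_single A

theorem norm_entry_le (A : Mat m) (i j : Fin m) : ‖A i j‖ ≤ ‖A‖ := by
  rw [Matrix.frobenius_norm_def, ← Real.sqrt_eq_rpow]
  refine Real.le_sqrt_of_sq_le ?_
  simp only [Real.rpow_two]
  calc ‖A i j‖ ^ 2 ≤ ∑ j, ‖A i j‖ ^ 2 :=
        Finset.single_le_sum (f := fun j => ‖A i j‖ ^ 2) (fun _ _ => by positivity)
          (Finset.mem_univ j)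
    _ ≤ _ := Finset.single_le_sum (f := fun i => ∑ j, ‖A i j‖ ^ 2) (fun _ _ => by positivity)
          (Finset.mem_univ i)

theorem norm_singleCLM (i j : Fin m) (z : ℂ) : ‖singleCLM i j z‖ = ‖z‖ := by
  change ‖Matrix.single i j z‖ = _
  rw [Matrix.frobenius_norm_def, ← Real.sqrt_eq_rpow]
  have : ∑ k, ∑ l, ‖Matrix.single i j z k l‖ ^ (2 : ℝ) = ‖z‖ ^ 2 := by
    rw [Finset.sum_eq_single i, Finset.sum_eq_single j]
    · simp
    · intro l _ hl
      simp [Matrix.single, hl.symm]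
    · simp
    · intro k _ hk
      simp [Matrix.single, hk.symm]
    · simp
  rw [this, Real.sqrt_sq (norm_nonneg _)]

theorem norm_le_sum_entries (A : Mat m) : ‖A‖ ≤ ∑ i, ∑ j, ‖A i j‖ := by
  conv_lhs => rw [eq_sum_singleCLM A]
  refine (norm_sum_le _ _).trans (Finset.sum_le_sum fun i _ => (norm_sum_le _ _).trans ?_)
  simp [norm_singleCLM]

theorem norm_le_of_entries_le {A : Mat m} {c : ℝ} (h : ∀ i j, ‖A i j‖ ≤ c) :
    ‖A‖ ≤ m ^ 2 * c := by
  refine (norm_le_sum_entries A).trans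
    ((Finset.sum_le_sum fun i _ => Finset.sum_le_sum fun j _ => h i j).trans_eq ?_)
  simp [sq, mul_assoc]

theorem stronglyMeasurable_of_entries {X : Type*} [MeasurableSpace X] {f : X → Mat m}
    (h : ∀ i j, StronglyMeasurable fun x => f x i j) : StronglyMeasurable f := by
  have : f = fun x => ∑ i, ∑ j, singleCLM i j (f x i j) := funext fun x => eq_sum_singleCLM _
  rw [this]
  exact Finset.stronglyMeasurable_fun_sum _ fun i _ => Finset.stronglyMeasurable_fun_sum _ fun j _ =>
    (singleCLM i j).continuous.comp_stronglyMeasurable (h i j)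

theorem _root_.MeasureTheory.StronglyMeasurable.entry {X : Type*} [MeasurableSpace X] {f : X → Mat m}
    (h : StronglyMeasurable f) (i j : Fin m) : StronglyMeasurable fun x => f x i j :=
  (entryCLM i j).continuous.comp_stronglyMeasurable h

theorem integrable_of_entries {X : Type*} [MeasurableSpace X] {μ : Measure X} {f : X → Mat m}
    (h : ∀ i j, Integrable (fun x => f x i j) μ) : Integrable f μ := by
  have : f = fun x => ∑ i, ∑ j, singleCLM i j (f x i j) := funext fun x => eq_sum_singleCLM _
  rw [this]
  exact integrable_finsetSum _ fun i _ => integrable_finsetSum _ fun j _ =>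
    (singleCLM i j).integrable_comp (h i j)

theorem integral_entry {X : Type*} [MeasurableSpace X] {μ : Measure X} {f : X → Mat m}
    (h : Integrable f μ) (i j : Fin m) : (∫ x, f x ∂μ) i j = ∫ x, f x i j ∂μ :=
  ((entryCLM i j).integral_comp_comm h).symm

theorem enorm_le_sum_entries (A : Mat m) : ‖A‖ₑ ≤ ∑ i, ∑ j, ‖A i j‖ₑ := by
  simp only [← ofReal_norm]
  refine (ENNReal.ofReal_le_ofReal (norm_le_sum_entries A)).trans_eq ?_
  rw [ENNReal.ofReal_sum_of_nonneg fun _ _ => by positivity]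
  exact Finset.sum_congr rfl fun i _ => ENNReal.ofReal_sum_of_nonneg fun _ _ => by positivity

end Entries

/-! ### A good representative of the symbol. -/

section Representative
open scoped Matrix.Norms.Frobenius
attribute [local instance] matTopology

/-- The null set in the hypothesis may depend on `t`. Integrating over an arbitrary set of
parameters and exchanging the integrals avoids this dependence. No measurability of `g` is required,
which matters for `t ↦ linftyNorm (B t)`. -/
theorem ae_lintegral_le_of_ae_le {X : Type*} [MeasurableSpace X] {ν : Measure X}
    [IsFiniteMeasure ν] {f : ℝ × X → ℝ≥0∞} (hf : Measurable f) {g : ℝ → ℝ≥0∞}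
    (h : ∀ᵐ t, ∀ᵐ x ∂ν, f (t, x) ≤ g t) {C : ℝ≥0∞} (hg : ∫⁻ t, g t ≤ C) :
    ∀ᵐ x ∂ν, ∫⁻ t, f (t, x) ≤ C := by
  refine ae_le_of_forall_setLIntegral_le_of_sigmaFinite hf.lintegral_prod_left' fun W hW _ => ?_
  rw [lintegral_lintegral_swap (f := fun x t => f (t, x)) (hf.comp measurable_swap).aemeasurable,
    setLIntegral_const]
  calc ∫⁻ t, ∫⁻ x in W, f (t, x) ∂ν ≤ ∫⁻ t, g t * ν W := by
        refine lintegral_mono_ae ?_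
        filter_upwards [h] with t ht
        rw [← setLIntegral_const]
        exact lintegral_mono_ae (ae_restrict_of_ae ht)
    _ = (∫⁻ t, g t) * ν W := lintegral_mul_const' _ _ (measure_ne_top _ _)
    _ ≤ C * ν W := by gcongr

theorem ae_enorm_le_linftyNorm {n m : ℕ} (B : Sphere n → Mat m) :
    ∀ᵐ ω ∂(surf n), ∀ i j, ‖B ω i j‖ₑ ≤ linftyNorm B := by
  refine ae_all_iff.2 fun i => ae_all_iff.2 fun j => ?_
  filter_upwards [enorm_ae_le_eLpNormEssSup (fun ω => B ω i j) (surf n)] with ω hω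
  refine hω.trans ?_
  rw [← eLpNorm_exponent_top]
  exact le_iSup_of_le i (le_iSup_of_le j le_rfl)

theorem linftyNorm_le_of_ae {n m : ℕ} {B : Sphere n → Mat m} {C : ℝ≥0∞}
    (h : ∀ᵐ ω ∂(surf n), ∀ i j, ‖B ω i j‖ₑ ≤ C) : linftyNorm B ≤ C := by
  refine iSup_le fun i => iSup_le fun j => ?_
  rw [eLpNorm_exponent_top]
  exact eLpNormEssSup_le_of_ae_enorm_bound (h.mono fun ω hω => hω i j)

/-- A symbol of the class `𝒦(Λ, K)` has a representative whose restrictions to almost all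
directions are curves of matrices of bounded variation. -/
theorem exists_representative {n m : ℕ} {Λ K d : ℝ} (hΛ : 0 ≤ Λ) (hK : 0 ≤ K)
    {A : ℝ → Space n → Mat m} (hA : ClassK Λ K A) (hd : StrictlyHyperbolic d A) :
    ∃ a b : ℝ → Sphere n → Mat m, StronglyMeasurable (Function.uncurry a) ∧
      (∀ ω s t, a t ω - a s ω = ∫ r in s..t, b r ω) ∧ (∀ ω, Integrable fun r => b r ω) ∧
      (∀ ω t, ‖a t ω‖ ≤ m ^ 2 * Λ) ∧ (∀ t, ∀ᵐ ω ∂(surf n), a t ω = restr A t ω) ∧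
      ∀ᵐ ω ∂(surf n), (∀ t, ∃ φ, IsGapSpectrum d (a t ω) φ) ∧ ∫ r, ‖b r ω‖ ≤ m ^ 2 * K := by
  obtain ⟨B, ⟨hBm, hB⟩, hBK⟩ := hA.variation
  set b' : Fin m → Fin m → ℝ × Sphere n → ℂ := fun i j => (hBm i j).mk _ with hb'
  have hb'm : ∀ i j, StronglyMeasurable (b' i j) := fun i j => (hBm i j).stronglyMeasurable_mk
  set a0 : Fin m → Fin m → Sphere n → ℂ := fun i j => (hA.measurable 0 i j).mk _ with ha0
  have ha0m : ∀ i j, StronglyMeasurable (a0 i j) :=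
    fun i j => (hA.measurable 0 i j).stronglyMeasurable_mk
  have hbB : ∀ᵐ p ∂((volume : Measure ℝ).prod (surf n)), ∀ i j, B p.1 p.2 i j = b' i j p :=
    ae_all_iff.2 fun i => ae_all_iff.2 fun j => (hBm i j).ae_eq_mk
  have hbB1 : ∀ᵐ τ : ℝ, ∀ᵐ ω ∂(surf n), ∀ i j, B τ ω i j = b' i j (τ, ω) :=
    Measure.ae_ae_of_ae_prod hbB
  have hbB2 : ∀ᵐ ω ∂(surf n), ∀ᵐ τ : ℝ, ∀ i j, B τ ω i j = b' i j (τ, ω) := by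
    have h := (Measure.measurePreserving_swap (μ := surf n)
      (ν := (volume : Measure ℝ))).quasiMeasurePreserving.ae
        (p := fun p : ℝ × Sphere n => ∀ i j, B p.1 p.2 i j = b' i j p) hbB
    exact Measure.ae_ae_of_ae_prod h
  have h1 : ∀ᵐ ω ∂(surf n), ∀ i j, ∫⁻ τ, ‖b' i j (τ, ω)‖ₑ ≤ ENNReal.ofReal K := by
    refine ae_all_iff.2 fun i => ae_all_iff.2 fun j => ?_
    refine ae_lintegral_le_of_ae_le (f := fun p => ‖b' i j p‖ₑ) (hb'm i j).enorm
      (g := fun t => linftyNorm (B t)) ?_ hBK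
    filter_upwards [hbB1] with τ hτ
    filter_upwards [hτ, ae_enorm_le_linftyNorm (B τ)] with ω h3 h4
    rw [← h3]
    exact h4 i j
  have h2 : ∀ t, ∀ᵐ ω ∂(surf n), ∀ i j, restr A t ω i j = a0 i j ω + ∫ τ in (0 : ℝ)..t, b' i j (τ, ω) := by
    intro t
    have h0 : ∀ᵐ ω ∂(surf n), ∀ i j, restr A 0 ω i j = a0 i j ω :=
      ae_all_iff.2 fun i => ae_all_iff.2 fun j => (hA.measurable 0 i j).ae_eq_mk
    filter_upwards [h0, hB 0 t, hbB2] with ω h0 h3 h4 i j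
    rw [← h0, ← intervalIntegral.integral_congr_ae (h4.mono fun τ h _ => h i j), ← (h3 i j).2]
    ring
  have h3 : ∀ t, ∀ᵐ ω ∂(surf n), ∀ i j, ‖restr A t ω i j‖ ≤ Λ := by
    intro t
    filter_upwards [ae_enorm_le_linftyNorm (restr A t)] with ω hω i j
    have := (hω i j).trans (hA.bounded t)
    rw [← ofReal_norm] at this
    exact (ENNReal.ofReal_le_ofReal_iff hΛ).1 this
  -- Only rational times are used, so a single null set of directions serves them all.
  have hP : ∀ᵐ ω ∂(surf n), (∀ i j, ∫⁻ τ, ‖b' i j (τ, ω)‖ₑ ≤ ENNReal.ofReal K) ∧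
      (∀ q : ℚ, ∀ i j, restr A q ω i j = a0 i j ω + ∫ τ in (0 : ℝ)..q, b' i j (τ, ω)) ∧
      ∀ q : ℚ, ∀ i j, ‖restr A q ω i j‖ ≤ Λ :=
    h1.and ((ae_all_iff.2 fun q : ℚ => h2 q).and (ae_all_iff.2 fun q : ℚ => h3 q))
  obtain ⟨N, hN, hNm, hN0⟩ := exists_measurable_superset_of_null hP
  have hG : ∀ᵐ ω ∂(surf n), ω ∉ N := by rw [ae_iff]; simpa using hN0
  have hGP := fun ω (hω : ω ∉ N) => Classical.not_not.1 fun h => hω (hN h)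
  classical
  -- Setting everything to zero on a measurable null set makes the primitive identity, integrability
  -- and norm bound true for every direction, and keeps joint measurability.
  set b : ℝ → Sphere n → Mat m := fun t ω => if ω ∈ N then 0 else Matrix.of fun i j => b' i j (t, ω)
    with hb
  set a : ℝ → Sphere n → Mat m := fun t ω => if ω ∈ N then 0 else
    Matrix.of fun i j => a0 i j ω + ∫ τ in (0 : ℝ)..t, b' i j (τ, ω) with ha
  have hb'i : ∀ ω, ω ∉ N → ∀ i j, Integrable fun τ => b' i j (τ, ω) := fun ω hω i j =>
    ⟨((hb'm i j).comp_measurable measurable_prodMk_right).aestronglyMeasurable,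
      lt_of_le_of_lt ((hGP ω hω).1 i j) ENNReal.ofReal_lt_top⟩
  have hbi : ∀ ω, Integrable fun r => b r ω := by
    intro ω
    by_cases hω : ω ∈ N
    · simp only [hb, hω, if_true]; exact integrable_zero _ _ _
    · simp only [hb, hω, if_false]
      exact integrable_of_entries fun i j => hb'i ω hω i j
  have hab : ∀ ω s t, a t ω - a s ω = ∫ r in s..t, b r ω := by
    intro ω s t
    by_cases hω : ω ∈ N
    · simp [ha, hb, hω]
    · have hInt : IntervalIntegrable (fun r => b r ω) volume s t := (hbi ω).intervalIntegrable
      ext i j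
      have e : (∫ r in s..t, b r ω) i j = ∫ r in s..t, b' i j (r, ω) := by
        have := (entryCLM i j).intervalIntegral_comp_comm hInt
        simp only [entryCLM_apply] at this
        rw [← this]
        simp [hb, hω]
      rw [e, ← intervalIntegral.integral_interval_sub_left
        (hb'i ω hω i j).intervalIntegrable (hb'i ω hω i j).intervalIntegrable (a := 0)]
      simp [ha, hω]
  have hac : ∀ ω, Continuous fun t => a t ω := by
    intro ω
    have h := (intervalIntegral.continuous_primitive
      (fun s t => (hbi ω).intervalIntegrable (a := s) (b := t)) 0).const_add (a 0 ω)
    refine h.congr fun t => ?_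
    rw [← hab, add_sub_cancel]
  have haq : ∀ ω, ω ∉ N → ∀ q : ℚ, a q ω = restr A q ω := by
    intro ω hω q
    ext i j
    rw [(hGP ω hω).2.1 q i j]
    simp [ha, hω]
  -- The norm bound and the gap hold at rational times and define a closed set of matrices;
  -- continuity in time does the rest.
  have hcl : ∀ ω, ω ∉ N → ∀ t, ‖a t ω‖ ≤ m ^ 2 * Λ ∧ ∃ φ, IsGapSpectrum d (a t ω) φ := by
    intro ω hω
    have hc := (isClosed_setOf_isGapSpectrum (m := m) d (m ^ 2 * Λ)).preimage (hac ω)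
    have hr : ∀ q : ℚ, (q : ℝ) ∈ (fun t => a t ω) ⁻¹'
        {A : Mat m | ‖A‖ ≤ m ^ 2 * Λ ∧ ∃ φ, IsGapSpectrum d A φ} := by
      intro q
      obtain ⟨φ, hφ1, hφ2⟩ := hd
      have hn1 : ‖(ω : Space n)‖ = 1 := by simp
      have hn0 : (ω : Space n) ≠ 0 := by rw [← norm_pos_iff, hn1]; norm_num
      simp only [mem_preimage, haq ω hω]
      exact ⟨norm_le_of_entries_le fun i j => (hGP ω hω).2.2 q i j,
        exists_isGapSpectrum (hφ1 q _ hn0) (hφ2 q _ hn1)⟩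
    have hden := (Rat.denseRange_cast (𝕜 := ℝ)).closure_range
    intro t
    have : t ∈ closure (range ((↑) : ℚ → ℝ)) := by rw [hden]; trivial
    exact hc.closure_subset_iff.2 (range_subset_iff.2 hr) this
  refine ⟨a, b, ?_, hab, hbi, ?_, ?_, ?_⟩
  · refine stronglyMeasurable_uncurry_of_continuous_of_stronglyMeasurable hac fun t => ?_
    refine StronglyMeasurable.ite hNm stronglyMeasurable_const
      (stronglyMeasurable_of_entries fun i j => (ha0m i j).add ?_)
    exact stronglyMeasurable_intervalIntegral (f := fun r ω => b' i j (r, ω)) (hb'm i j) 0 t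
  · intro ω t
    by_cases hω : ω ∈ N
    · simp only [ha, hω, if_true, norm_zero]; positivity
    · exact (hcl ω hω t).1
  · intro t
    filter_upwards [hG, h2 t] with ω hω h
    ext i j
    rw [h i j]
    simp [ha, hω]
  · filter_upwards [hG] with ω hω
    refine ⟨fun t => (hcl ω hω t).2, ?_⟩
    have hle : ∀ i j, ∫ r, ‖b' i j (r, ω)‖ ≤ K := fun i j => by
      rw [integral_norm_eq_lintegral_enorm (hb'i ω hω i j).aestronglyMeasurable]
      exact ENNReal.toReal_le_of_le_ofReal hK ((hGP ω hω).1 i j)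
    calc ∫ r, ‖b r ω‖ ≤ ∫ r, ∑ i, ∑ j, ‖b' i j (r, ω)‖ := by
          refine integral_mono (hbi ω).norm (integrable_finsetSum _ fun i _ =>
            integrable_finsetSum _ fun j _ => (hb'i ω hω i j).norm) fun r => ?_
          refine (norm_le_sum_entries _).trans_eq ?_
          simp [hb, hω]
      _ = ∑ i, ∑ j, ∫ r, ‖b' i j (r, ω)‖ := by
          rw [integral_finsetSum _ fun i _ => integrable_finsetSum _ fun j _ => (hb'i ω hω i j).norm]
          exact Finset.sum_congr rfl fun i _ =>
            integral_finsetSum _ fun j _ => (hb'i ω hω i j).norm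
      _ ≤ ∑ _i : Fin m, ∑ _j : Fin m, K :=
          Finset.sum_le_sum fun i _ => Finset.sum_le_sum fun j _ => hle i j
      _ = m ^ 2 * K := by simp [sq, mul_assoc]

end Representative

/-! ### Parseval's identity for quadratic forms and the rescaled Fourier transform. -/

section Fourier
open scoped InnerProductSpace

variable {n m : ℕ}

theorem continuous_integral_inner_comp (T : EuclideanSpace ℂ (Fin m) →L[ℂ] EuclideanSpace ℂ (Fin m)) :
    Continuous fun u : L2 n m => ∫ x, ⟪u x, T (u x)⟫_ℂ := by
  have h : (fun u : L2 n m => ∫ x, ⟪u x, T (u x)⟫_ℂ) =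
      fun u : L2 n m => ⟪u, T.compLpL 2 volume u⟫_ℂ := by
    funext u
    rw [L2.inner_def]
    refine integral_congr_ae ?_
    filter_upwards [T.coeFn_compLpL (p := 2) (μ := volume) u] with x hx
    rw [hx]
  rw [h]
  fun_prop

/-- Parseval's identity for a sesquilinear form acting on the values. -/
theorem integral_inner_comp_fourier (T : EuclideanSpace ℂ (Fin m) →L[ℂ] EuclideanSpace ℂ (Fin m))
    (u : L2 n m) :
    ∫ ξ, ⟪(𝓕 u : L2 n m) ξ, T ((𝓕 u : L2 n m) ξ)⟫_ℂ = ∫ x, ⟪u x, T (u x)⟫_ℂ := by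
  have hc := continuous_integral_inner_comp (n := n) T
  have hF : Continuous fun u : L2 n m => (𝓕 u : L2 n m) := by fun_prop
  -- Both sides are continuous on `L²`, so it is enough to compare them on Schwartz functions.
  refine congrFun ((SchwartzMap.denseRange_toLpCLM (E := Space n)
    (F := EuclideanSpace ℂ (Fin m)) (p := 2) (μ := volume) (by simp)).equalizer
    (hc.comp hF) hc (funext fun f => ?_)) u
  simp only [Function.comp, SchwartzMap.toLpCLM_apply]
  rw [SchwartzMap.toLp_fourier_eq]
  have e : ∀ g : 𝓢(Space n, EuclideanSpace ℂ (Fin m)),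
      ∫ x, ⟪(g.toLp 2 : L2 n m) x, T ((g.toLp 2 : L2 n m) x)⟫_ℂ =
        ∫ x, ((innerSL ℂ).comp (ContinuousLinearMap.adjoint T)) (g x) (g x) := by
    intro g
    refine integral_congr_ae ?_
    filter_upwards [g.coeFn_toLp 2 volume] with x hx
    rw [hx]
    simp [ContinuousLinearMap.adjoint_inner_left]
  rw [e, e]
  exact SchwartzMap.integral_sesq_fourier_fourier f f _

theorem integral_comp_scale {G : Type*} [NormedAddCommGroup G] [NormedSpace ℝ G]
    (f : Space n → G) :
    ∫ ξ, f ξ = ((2 * Real.pi) ^ n)⁻¹ • ∫ ξ : Space n, f ((2 * Real.pi)⁻¹ • ξ) := by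
  rw [Measure.integral_comp_smul, finrank_euclideanSpace_fin, smul_smul]
  have : (0 : ℝ) < (2 * Real.pi) ^ n := by positivity
  rw [inv_pow, inv_inv, abs_of_pos this, inv_mul_cancel₀ this.ne', one_smul]

theorem stronglyMeasurable_fhat (u : L2 n m) : StronglyMeasurable (fhat u) :=
  (Lp.stronglyMeasurable _).comp_measurable (by fun_prop)

theorem memLp_fhat (u : L2 n m) : MemLp (fhat u) 2 volume := by
  have h0 : (2 * Real.pi)⁻¹ ≠ 0 := by positivity
  have hmap : Measure.map (fun ξ : Space n => (2 * Real.pi)⁻¹ • ξ) volume =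
      ENNReal.ofReal |((2 * Real.pi)⁻¹ ^ n)⁻¹| • volume := by
    rw [Measure.map_addHaar_smul _ h0, finrank_euclideanSpace_fin]
  have h : MemLp (𝓕 u : L2 n m) 2
      (Measure.map (fun ξ : Space n => (2 * Real.pi)⁻¹ • ξ) volume) := by
    rw [hmap]
    exact (Lp.memLp _).smul_measure ENNReal.ofReal_ne_top
  exact h.comp_of_map (by fun_prop)

theorem integral_inner_comp_fhat (T : EuclideanSpace ℂ (Fin m) →L[ℂ] EuclideanSpace ℂ (Fin m))
    (u : L2 n m) :
    ∫ x, ⟪u x, T (u x)⟫_ℂ = ((2 * Real.pi) ^ n)⁻¹ • ∫ ξ, ⟪fhat u ξ, T (fhat u ξ)⟫_ℂ := by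
  rw [← integral_inner_comp_fourier, integral_comp_scale]
  rfl

theorem quadForm_eq (S : Mat m) (u : L2 n m) :
    quadForm S u = ((2 * Real.pi) ^ n)⁻¹ * (∫ ξ, ∑ b : Fin m, ∑ l : Fin m,
      S b l * fhat u ξ l * (starRingEnd ℂ) (fhat u ξ b)).re := by
  have e : ∀ w : EuclideanSpace ℂ (Fin m), ∑ b : Fin m, ∑ l : Fin m,
      S b l * w l * (starRingEnd ℂ) (w b) = ⟪w, Matrix.toEuclideanCLM (𝕜 := ℂ) S w⟫_ℂ := by
    intro w
    rw [PiLp.inner_apply]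
    refine Finset.sum_congr rfl fun b _ => ?_
    simp [Matrix.ofLp_toEuclideanCLM, Matrix.mulVec, dotProduct, Finset.sum_mul]
  simp only [quadForm, e]
  rw [integral_inner_comp_fhat, Complex.real_smul, Complex.re_ofReal_mul]

theorem integral_norm_sq_fhat (u : L2 n m) :
    ∫ ξ, ‖fhat u ξ‖ ^ 2 = (2 * Real.pi) ^ n * ‖u‖ ^ 2 := by
  have h := integral_inner_comp_fhat (1 : EuclideanSpace ℂ (Fin m) →L[ℂ] EuclideanSpace ℂ (Fin m)) u
  simp only [one_apply_eq_self, inner_self_eq_norm_sq_to_K] at h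
  have h2 : ⟪u, u⟫_ℂ = ∫ x, ⟪u x, u x⟫_ℂ := L2.inner_def u u
  simp only [inner_self_eq_norm_sq_to_K] at h2
  rw [← h2] at h
  have h3 : ∀ f : Space n → EuclideanSpace ℂ (Fin m),
      ∫ ξ, ((RCLike.ofReal ‖f ξ‖ : ℂ)) ^ 2 = ((∫ ξ, ‖f ξ‖ ^ 2 : ℝ) : ℂ) := by
    intro f
    rw [← integral_complex_ofReal]
    simp
  rw [h3, Complex.real_smul] at h
  have h4 : ‖u‖ ^ 2 = ((2 * Real.pi) ^ n)⁻¹ * ∫ ξ, ‖fhat u ξ‖ ^ 2 := by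
    have h5 : ((‖u‖ ^ 2 : ℝ) : ℂ) =
        ((((2 * Real.pi) ^ n)⁻¹ * ∫ ξ, ‖fhat u ξ‖ ^ 2 : ℝ) : ℂ) := by
      rw [Complex.ofReal_mul, Complex.ofReal_pow]
      exact h
    exact Complex.ofReal_injective h5
  rw [h4, mul_inv_cancel_left₀ (by positivity)]

end Fourier

/-! ### The real-valued `L²` norm. -/

section L2norm

variable {X : Type*} [MeasurableSpace X] {μ : Measure X}

/-- The `L²` norm as a real number. -/
def l2 (μ : Measure X) (f : X → ℂ) : ℝ := (eLpNorm f 2 μ).toReal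

theorem l2_nonneg (f : X → ℂ) : 0 ≤ l2 μ f := ENNReal.toReal_nonneg

theorem norm_integral_mul_le {f g : X → ℂ} (hf : MemLp f 2 μ) (hg : MemLp g 2 μ) :
    ‖∫ x, f x * g x ∂μ‖ ≤ l2 μ f * l2 μ g := by
  have h1 : eLpNorm (fun x => f x * g x) 1 μ ≤ eLpNorm f 2 μ * eLpNorm g 2 μ :=
    eLpNorm_smul_le_mul_eLpNorm (f := g) (φ := f) hg.1 hf.1
  have h2 := (enorm_integral_le_lintegral_enorm (μ := μ) fun x => f x * g x).trans
    ((eLpNorm_one_eq_lintegral_enorm (f := fun x => f x * g x) (μ := μ)).symm.le.trans h1)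
  have h3 := ENNReal.toReal_mono (ENNReal.mul_ne_top hf.2.ne hg.2.ne) h2
  rwa [toReal_enorm, ENNReal.toReal_mul] at h3

theorem integrable_mul_of_memLp {f g : X → ℂ} (hf : MemLp f 2 μ) (hg : MemLp g 2 μ) :
    Integrable (fun x => f x * g x) μ :=
  hf.integrable_mul hg

theorem l2_le_mul_l2 {f g : X → ℂ} {c : ℝ} (hc : 0 ≤ c) (hg : MemLp g 2 μ)
    (h : ∀ᵐ x ∂μ, ‖f x‖ ≤ c * ‖g x‖) : l2 μ f ≤ c * l2 μ g := by
  have h1 := eLpNorm_le_mul_eLpNorm_of_ae_le_mul h 2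
  have h3 := ENNReal.toReal_mono (ENNReal.mul_ne_top ENNReal.ofReal_ne_top hg.2.ne) h1
  rwa [ENNReal.toReal_mul, ENNReal.toReal_ofReal hc] at h3

theorem integral_conj_mul_self {f : X → ℂ} (hf : MemLp f 2 μ) :
    ∫ x, (starRingEnd ℂ) (f x) * f x ∂μ = ((l2 μ f ^ 2 : ℝ) : ℂ) := by
  have h1 : ∀ x, (starRingEnd ℂ) (f x) * f x = ((‖f x‖ ^ 2 : ℝ) : ℂ) := fun x => by
    rw [mul_comm, Complex.mul_conj, Complex.normSq_eq_norm_sq]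
  simp only [h1]
  rw [integral_complex_ofReal]
  congr 1
  have h2 := hf.eLpNorm_eq_integral_rpow_norm (by simp) (by simp)
  rw [l2, h2]
  have h0 : 0 ≤ ∫ x, ‖f x‖ ^ 2 ∂μ := integral_nonneg fun _ => by positivity
  simp only [ENNReal.toReal_ofNat, Real.rpow_two]
  rw [ENNReal.toReal_ofReal (by positivity), ← one_div, ← Real.sqrt_eq_rpow, Real.sq_sqrt h0]

theorem ae_eq_zero_of_l2_eq_zero {f : X → ℂ} (hf : MemLp f 2 μ) (h : l2 μ f = 0) :
    ∀ᵐ x ∂μ, f x = 0 := by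
  rw [l2, ENNReal.toReal_eq_zero_iff, or_iff_left hf.2.ne,
    eLpNorm_eq_zero_iff hf.1 (by simp)] at h
  exact h

end L2norm

/-! ### Uniqueness of weak solutions on the Fourier side. -/

section Uniqueness

variable {n m : ℕ}

/-- The weight `1 + ‖ξ‖` compensates the linear growth of the symbol. Since `H` vanishes outside a
ball, it lies in `L²` of the measure with density `(1 + ‖ξ‖)²`, where smooth compactly supported
functions are dense. -/
theorem exists_schwartz_approx {H : Space n → ℂ} (hH : MemLp H 2 volume) {R : ℝ}
    (hs : ∀ ξ, R ≤ ‖ξ‖ → H ξ = 0) {ε : ℝ} (hε : 0 < ε) :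
    ∃ g : 𝓢(Space n, ℂ), MemLp (fun ξ => ((1 + ‖ξ‖ : ℝ) : ℂ) * (H ξ - g ξ)) 2 volume ∧
      l2 volume (fun ξ => ((1 + ‖ξ‖ : ℝ) : ℂ) * (H ξ - g ξ)) ≤ ε := by
  set w : Space n → ℝ≥0 := fun ξ => (1 + ‖ξ‖₊) ^ 2 with hw
  have hwc : Continuous w := by fun_prop
  set μ' : Measure (Space n) := volume.withDensity fun ξ => (w ξ : ℝ≥0∞) with hμ'
  have : IsLocallyFiniteMeasure μ' := IsLocallyFiniteMeasure.withDensity_coe hwc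
  have hnorm : ∀ f : Space n → ℂ, eLpNorm f 2 μ' =
      eLpNorm (fun ξ => ((1 + ‖ξ‖ : ℝ) : ℂ) * f ξ) 2 volume := by
    intro f
    rw [eLpNorm_eq_lintegral_rpow_enorm_toReal (by simp) (by simp),
      eLpNorm_eq_lintegral_rpow_enorm_toReal (by simp) (by simp), hμ',
      lintegral_withDensity_eq_lintegral_mul_non_measurable _ (by fun_prop) (by simp)]
    congr 1
    refine lintegral_congr fun ξ => ?_
    have e : ‖((1 + ‖ξ‖ : ℝ) : ℂ)‖ₑ = ((1 + ‖ξ‖₊ : ℝ≥0) : ℝ≥0∞) := by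
      rw [← ofReal_norm, Complex.norm_real, Real.norm_of_nonneg (by positivity),
        ENNReal.ofReal_add zero_le_one (norm_nonneg _), ofReal_norm]
      simp [enorm_eq_nnnorm]
    simp only [Pi.mul_apply, enorm_mul, e, hw, ENNReal.toReal_ofNat, ENNReal.rpow_two, mul_pow]
    push_cast
    rfl
  have hHW : MemLp (fun ξ => ((1 + ‖ξ‖ : ℝ) : ℂ) * H ξ) 2 volume := by
    refine hH.of_le_mul (c := 1 + R) ?_ (Eventually.of_forall fun ξ => ?_)
    · exact (by fun_prop : Continuous fun ξ : Space n =>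
        ((1 + ‖ξ‖ : ℝ) : ℂ)).aestronglyMeasurable.mul hH.1
    · rw [norm_mul, Complex.norm_real, Real.norm_of_nonneg (by positivity)]
      by_cases h : R ≤ ‖ξ‖
      · simp [hs ξ h]
      · gcongr
        exact (not_le.1 h).le
  have hH' : MemLp H 2 μ' :=
    ⟨hH.1.mono_ac (withDensity_absolutelyContinuous _ _), by rw [hnorm]; exact hHW.2⟩
  obtain ⟨g, hg1, hg2, hg3⟩ := hH'.exist_eLpNorm_sub_le (by simp) (by norm_num) hε
  refine ⟨hg1.toSchwartzMap hg2, ?_⟩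
  change MemLp (fun ξ => ((1 + ‖ξ‖ : ℝ) : ℂ) * (H ξ - g ξ)) 2 volume ∧
      l2 volume (fun ξ => ((1 + ‖ξ‖ : ℝ) : ℂ) * (H ξ - g ξ)) ≤ ε
  rw [hnorm] at hg3
  simp only [Pi.sub_apply] at hg3
  refine ⟨⟨?_, hg3.trans_lt ENNReal.ofReal_lt_top⟩, ENNReal.toReal_le_of_le_ofReal hε.le hg3⟩
  exact (by fun_prop : Continuous fun ξ : Space n =>
        ((1 + ‖ξ‖ : ℝ) : ℂ)).aestronglyMeasurable.mul
    (hH.1.sub hg2.continuous.aestronglyMeasurable)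

/-- An `L²` weak solution of `∂ₜ D = i α D`, where `|α(t,ξ)| ≤ Λ |ξ|`. -/
structure IsWeakSolution (Λ : ℝ) (α : ℝ → Space n → Mat m) (D : ℝ → Space n → Fin m → ℂ) :
    Prop where
  memLp : ∀ t j, MemLp (fun ξ => D t ξ j) 2 volume
  bounded : ∀ T, ∃ C, ∀ t, |t| ≤ T → ∀ j, l2 volume (fun ξ => D t ξ j) ≤ C
  meas : ∀ t j k, AEStronglyMeasurable (fun ξ => α t ξ j k) volume
  coeff_le : ∀ t, ∀ᵐ ξ, ∀ j k, ‖α t ξ j k‖ ≤ Λ * ‖ξ‖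
  weak : ∀ (g : 𝓢(Space n, ℂ)) (j : Fin m) (t : ℝ),
    HasDerivAt (fun τ => ∫ ξ, g ξ * D τ ξ j)
      (Complex.I * ∫ ξ, g ξ * ∑ k, α t ξ j k * D t ξ k) t

namespace IsWeakSolution

variable {Λ : ℝ} {α : ℝ → Space n → Mat m} {D : ℝ → Space n → Fin m → ℂ}

theorem memLp_indicator (h : IsWeakSolution Λ α D) (R t : ℝ) (j : Fin m) :
    MemLp ((Metric.ball (0 : Space n) R).indicator fun ξ => D t ξ j) 2 volume :=
  (h.memLp t j).indicator measurableSet_ball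

/-- The symbol acts by multiplication, so truncation to a ball commutes with the equation and the
coefficient is bounded there by `Λ R`. The equation is tested against an approximation of the
conjugate of the truncated solution frozen at time `t`; the mean value inequality from `t₁` to `t`
then bounds the square of its norm. -/
theorem contraction (h : IsWeakSolution Λ α D) (hΛ : 0 ≤ Λ) {R t₁ δ C X : ℝ} (hR : 0 ≤ R)
    (hX0 : 0 ≤ X) (hδ : 0 ≤ δ) (hC0 : 0 ≤ C)
    (hC : ∀ t ∈ Icc (t₁ - δ) (t₁ + δ), ∀ j, l2 volume (fun ξ => D t ξ j) ≤ C)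
    (h1 : ∀ᵐ ξ, ξ ∈ Metric.ball (0 : Space n) R → ∀ j, D t₁ ξ j = 0)
    (hX : ∀ t ∈ Icc (t₁ - δ) (t₁ + δ), ∀ j,
      l2 volume ((Metric.ball (0 : Space n) R).indicator fun ξ => D t ξ j) ≤ X)
    {t : ℝ} (ht : t ∈ Icc (t₁ - δ) (t₁ + δ)) (j : Fin m) :
    l2 volume ((Metric.ball (0 : Space n) R).indicator fun ξ => D t ξ j) ≤
      δ * (m * (Λ * R)) * X := by
  set B := Metric.ball (0 : Space n) R with hB
  set P : ℝ → Fin m → Space n → ℂ := fun t j => B.indicator fun ξ => D t ξ j with hP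
  have hPm : ∀ t j, MemLp (P t j) 2 volume := h.memLp_indicator R
  set N := l2 volume (P t j) with hN
  have hN0 : 0 ≤ N := l2_nonneg _
  set H : Space n → ℂ := fun ξ => (starRingEnd ℂ) (P t j ξ) with hH
  have hHm : MemLp H 2 volume := (hPm t j).star
  have hHl : l2 volume H = N := by
    rw [hN, l2, l2]
    congr 1
    exact eLpNorm_congr_norm_ae (Eventually.of_forall fun ξ => by simp [hH])
  have hH0 : ∀ ξ, ξ ∉ B → H ξ = 0 := fun ξ hξ => by simp [hH, hP, hξ]
  have ht₁ : t₁ ∈ Icc (t₁ - δ) (t₁ + δ) := ⟨by linarith, by linarith⟩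
  -- The error `2 C ε` comes from replacing the test function at the two end times, and `δ m Λ C ε`
  -- from replacing it inside the time derivative.
  have key : ∀ ε > 0, N ^ 2 ≤ N * (δ * (m * (Λ * R)) * X) +
      ε * (2 * C + δ * (m * (Λ * C))) := by
    intro ε hε
    obtain ⟨g, hgm, hg⟩ := exists_schwartz_approx hHm
      (fun ξ hξ => hH0 ξ (by simpa [hB] using hξ)) hε
    set We : Space n → ℂ := fun ξ => ((1 + ‖ξ‖ : ℝ) : ℂ) * (H ξ - g ξ) with hWe
    set e : Space n → ℂ := fun ξ => H ξ - g ξ with he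
    have hnWe : ∀ ξ, ‖We ξ‖ = (1 + ‖ξ‖) * ‖e ξ‖ := fun ξ => by
      simp only [hWe, norm_mul, Complex.norm_real, he]
      rw [Real.norm_of_nonneg (by positivity)]
    have hem : MemLp e 2 volume := by
      refine hgm.mono (hHm.1.sub g.continuous.aestronglyMeasurable)
        (Eventually.of_forall fun ξ => ?_)
      rw [hnWe]
      nlinarith [norm_nonneg ξ, norm_nonneg (e ξ), mul_nonneg (norm_nonneg ξ) (norm_nonneg (e ξ))]
    have hel : l2 volume e ≤ ε := by
      refine (l2_le_mul_l2 zero_le_one hgm (Eventually.of_forall fun ξ => ?_)).trans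
        ((one_mul _).le.trans hg)
      rw [hnWe, one_mul]
      nlinarith [mul_nonneg (norm_nonneg ξ) (norm_nonneg (e ξ))]
    have hge : ∀ ξ, g ξ = H ξ - e ξ := fun ξ => by simp [he]
    have ha : ∀ r ∈ Icc (t₁ - δ) (t₁ + δ), ‖∫ ξ, e ξ * D r ξ j‖ ≤ ε * C := fun r hr =>
      (norm_integral_mul_le hem (h.memLp r j)).trans
        (mul_le_mul hel (hC r hr j) (l2_nonneg _) hε.le)
    have hsplit : ∀ r, ∫ ξ, g ξ * D r ξ j = (∫ ξ, H ξ * D r ξ j) - ∫ ξ, e ξ * D r ξ j := by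
      intro r
      rw [← integral_sub (integrable_mul_of_memLp hHm (h.memLp r j)) (integrable_mul_of_memLp hem (h.memLp r j))]
      refine integral_congr_ae (Eventually.of_forall fun ξ => ?_)
      simp only [hge]; ring
    have hHt : ∫ ξ, H ξ * D t ξ j = ((N ^ 2 : ℝ) : ℂ) := by
      rw [hN, ← integral_conj_mul_self (hPm t j)]
      refine integral_congr_ae (Eventually.of_forall fun ξ => ?_)
      by_cases hξ : ξ ∈ B
      · simp [hH, hP, hξ]
      · simp [hH, hP, hξ]
    have hHt₁ : ∫ ξ, H ξ * D t₁ ξ j = 0 := by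
      rw [← integral_zero (Space n) ℂ]
      refine integral_congr_ae ?_
      filter_upwards [h1] with ξ hξ
      by_cases hξB : ξ ∈ B
      · simp [hξ hξB]
      · simp [hH0 ξ hξB]
    have hder : ∀ r ∈ Icc (t₁ - δ) (t₁ + δ),
        ‖Complex.I * ∫ ξ, g ξ * ∑ k, α r ξ j k * D r ξ k‖ ≤
          m * (N * (Λ * R * X) + Λ * ε * C) := by
      intro r hr
      rw [norm_mul, Complex.norm_I, one_mul]
      set Q : Fin m → Space n → ℂ := fun k => B.indicator fun ξ => α r ξ j k * D r ξ k with hQ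
      set F : Fin m → Space n → ℂ := fun k ξ => e ξ * α r ξ j k with hF
      have hQb : ∀ k, ∀ᵐ ξ, ‖Q k ξ‖ ≤ Λ * R * ‖P r k ξ‖ := by
        intro k
        filter_upwards [h.coeff_le r] with ξ hξ
        by_cases hξB : ξ ∈ B
        · simp only [hQ, hP, hξB, indicator_of_mem, norm_mul]
          gcongr
          refine (hξ j k).trans ?_
          gcongr
          simpa [hB] using (mem_ball_zero_iff.1 hξB).le
        · simp [hQ, hP, hξB]
      have hQm : ∀ k, MemLp (Q k) 2 volume := fun k =>
        (hPm r k).of_le_mul (((h.meas r j k).mul (h.memLp r k).1).indicator measurableSet_ball)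
          (hQb k)
      -- Here the weighted approximation is needed: the error multiplied by the unbounded symbol
      -- remains small in `L²`.
      have hFb : ∀ k, ∀ᵐ ξ, ‖F k ξ‖ ≤ Λ * ‖We ξ‖ := by
        intro k
        filter_upwards [h.coeff_le r] with ξ hξ
        rw [hnWe]
        simp only [hF, norm_mul]
        refine (mul_le_mul_of_nonneg_left (hξ j k) (norm_nonneg _)).trans ?_
        nlinarith [mul_nonneg hΛ (norm_nonneg (e ξ))]
      have hFm : ∀ k, MemLp (F k) 2 volume := fun k =>
        hgm.of_le_mul (hem.1.mul (h.meas r j k)) (hFb k)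
      have e1 : ∫ ξ, g ξ * ∑ k, α r ξ j k * D r ξ k =
          ∑ k, ((∫ ξ, H ξ * Q k ξ) - ∫ ξ, F k ξ * D r ξ k) := by
        have hi : ∀ k, Integrable (fun ξ => H ξ * Q k ξ - F k ξ * D r ξ k) := fun k =>
          (integrable_mul_of_memLp hHm (hQm k)).sub (integrable_mul_of_memLp (hFm k) (h.memLp r k))
        rw [← Finset.sum_congr rfl fun k _ => integral_sub (integrable_mul_of_memLp hHm (hQm k))
          (integrable_mul_of_memLp (hFm k) (h.memLp r k))]
        rw [← integral_finsetSum _ fun k _ => hi k]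
        refine integral_congr_ae (Eventually.of_forall fun ξ => ?_)
        simp only [Finset.mul_sum]
        refine Finset.sum_congr rfl fun k _ => ?_
        by_cases hξB : ξ ∈ B
        · simp only [hge, hQ, hξB, indicator_of_mem, hF]; ring
        · simp only [hge, hH0 ξ hξB, hF]; ring
      rw [e1]
      calc ‖∑ k, ((∫ ξ, H ξ * Q k ξ) - ∫ ξ, F k ξ * D r ξ k)‖
          ≤ ∑ _k : Fin m, (N * (Λ * R * X) + Λ * ε * C) := by
            refine norm_sum_le_of_le _ fun k _ => (norm_sub_le _ _).trans (add_le_add ?_ ?_)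
            · refine (norm_integral_mul_le hHm (hQm k)).trans ?_
              rw [hHl]
              gcongr
              refine (l2_le_mul_l2 (by positivity) (hPm r k) (hQb k)).trans ?_
              gcongr
              exact hX r hr k
            · refine (norm_integral_mul_le (hFm k) (h.memLp r k)).trans ?_
              refine mul_le_mul ?_ (hC r hr k) (l2_nonneg _) (by positivity)
              refine (l2_le_mul_l2 hΛ hgm (hFb k)).trans ?_
              gcongr
        _ = _ := by rw [Finset.sum_const, Finset.card_univ, Fintype.card_fin, nsmul_eq_mul]
    have hmv := (convex_Icc (t₁ - δ) (t₁ + δ)).norm_image_sub_le_of_norm_hasDerivWithin_le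
      (fun r _ => (h.weak g j r).hasDerivWithinAt) hder ht₁ ht
    have htd : ‖t - t₁‖ ≤ δ := by
      rw [Real.norm_eq_abs, abs_le]; constructor <;> linarith [ht.1, ht.2]
    have e2 : ((N ^ 2 : ℝ) : ℂ) = ((∫ ξ, g ξ * D t ξ j) - ∫ ξ, g ξ * D t₁ ξ j) +
        ((∫ ξ, e ξ * D t ξ j) - ∫ ξ, e ξ * D t₁ ξ j) := by
      rw [hsplit, hsplit, hHt, hHt₁]; ring
    have e3 : N ^ 2 = ‖((N ^ 2 : ℝ) : ℂ)‖ := by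
      rw [Complex.norm_real, Real.norm_of_nonneg (by positivity)]
    rw [e3, e2]
    calc _ ≤ m * (N * (Λ * R * X) + Λ * ε * C) * δ + (ε * C + ε * C) := by
          refine (norm_add_le _ _).trans (add_le_add (hmv.trans ?_)
            ((norm_sub_le _ _).trans (add_le_add (ha t ht) (ha t₁ ht₁))))
          gcongr
      _ = _ := by ring
  have hle : N ^ 2 ≤ N * (δ * (m * (Λ * R)) * X) := by
    refine le_of_forall_pos_le_add fun ε hε => ?_
    set c := 2 * C + δ * (m * (Λ * C)) with hc
    have hc0 : 0 ≤ c := by positivity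
    refine (key (ε / (c + 1)) (by positivity)).trans ?_
    gcongr
    rw [div_mul_eq_mul_div, div_le_iff₀ (by positivity)]
    nlinarith
  rcases hN0.eq_or_lt with h0 | h0
  · rw [← h0]; positivity
  · rw [sq] at hle
    exact le_of_mul_le_mul_left hle h0

/-- The contraction factor is at most `1 / 2`, and iterating it on the same interval drives the
uniform bound to zero. -/
theorem ae_eq_zero_of_abs_sub_le (h : IsWeakSolution Λ α D) (hΛ : 0 ≤ Λ) {R t₁ δ : ℝ} (hR : 0 ≤ R)
    (hδ : 0 ≤ δ) (hsmall : δ * (m * (Λ * R)) ≤ 1 / 2)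
    (h1 : ∀ᵐ ξ, ξ ∈ Metric.ball (0 : Space n) R → ∀ j, D t₁ ξ j = 0)
    {t : ℝ} (ht : t ∈ Icc (t₁ - δ) (t₁ + δ)) :
    ∀ᵐ ξ, ξ ∈ Metric.ball (0 : Space n) R → ∀ j, D t ξ j = 0 := by
  obtain ⟨C, hC⟩ := h.bounded (|t₁| + δ)
  have hC' : ∀ t ∈ Icc (t₁ - δ) (t₁ + δ), ∀ j, l2 volume (fun ξ => D t ξ j) ≤ |C| := by
    intro t ht j
    refine (hC t ?_ j).trans (le_abs_self _)
    rw [abs_le]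
    constructor <;> linarith [ht.1, ht.2, le_abs_self t₁, neg_abs_le t₁]
  have hit : ∀ k : ℕ, ∀ t ∈ Icc (t₁ - δ) (t₁ + δ), ∀ j,
      l2 volume ((Metric.ball (0 : Space n) R).indicator fun ξ => D t ξ j) ≤
        |C| * (1 / 2) ^ k := by
    intro k
    induction k with
    | zero =>
      intro t ht j
      refine (l2_le_mul_l2 zero_le_one (h.memLp t j) (Eventually.of_forall fun ξ => ?_)).trans ?_
      · rw [one_mul]; exact norm_indicator_le_norm_self _ _
      · simpa using hC' t ht j
    | succ k ih =>
      intro t ht j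
      refine (h.contraction hΛ hR (by positivity) hδ (abs_nonneg C) hC' h1 ih ht j).trans ?_
      calc δ * (m * (Λ * R)) * (|C| * (1 / 2) ^ k) ≤ 1 / 2 * (|C| * (1 / 2) ^ k) := by gcongr
        _ = _ := by ring
  have hz : ∀ j, l2 volume ((Metric.ball (0 : Space n) R).indicator fun ξ => D t ξ j) = 0 := by
    intro j
    refine le_antisymm ?_ (l2_nonneg _)
    refine ge_of_tendsto' (x := atTop) (f := fun k : ℕ => |C| * (1 / 2) ^ k) ?_ fun k => hit k t ht j
    have := (tendsto_pow_atTop_nhds_zero_of_lt_one (r := (1 / 2 : ℝ)) (by norm_num)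
      (by norm_num)).const_mul |C|
    rwa [mul_zero] at this
  filter_upwards [ae_all_iff.2 fun j => ae_eq_zero_of_l2_eq_zero (h.memLp_indicator R t j) (hz j)]
    with ξ hξ hB j
  have := hξ j
  rwa [indicator_of_mem hB] at this

/-- For a fixed ball the step `δ` depends only on its radius, so finitely many steps reach any time.
Countably many balls exhaust the frequency space. -/
theorem ae_eq_zero (h : IsWeakSolution Λ α D) (hΛ : 0 ≤ Λ) (h0 : ∀ᵐ ξ, ∀ j, D 0 ξ j = 0)
    (t : ℝ) : ∀ᵐ ξ, ∀ j, D t ξ j = 0 := by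
  have hball : ∀ R : ℕ, ∀ᵐ ξ, ξ ∈ Metric.ball (0 : Space n) R → ∀ j, D t ξ j = 0 := by
    intro R
    set δ : ℝ := 1 / (2 * (m * (Λ * R) + 1)) with hδ
    have hδ0 : 0 < δ := by positivity
    have hsmall : δ * (m * (Λ * R)) ≤ 1 / 2 := by
      rw [hδ, one_div, inv_mul_le_iff₀ (by positivity)]
      linarith
    have hk : ∀ k : ℕ, ∀ t, |t| ≤ k * δ →
        ∀ᵐ ξ, ξ ∈ Metric.ball (0 : Space n) R → ∀ j, D t ξ j = 0 := by
      intro k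
      induction k with
      | zero =>
        intro t ht
        have : t = 0 := by simpa using ht
        subst this
        exact h0.mono fun ξ hξ _ => hξ
      | succ k ih =>
        intro t ht
        push_cast at ht
        obtain ⟨ht1, ht2⟩ := abs_le.1 ht
        rcases le_total 0 t with hs | hs
        -- The base point lies one step nearer to `0` than `t`, truncated at `0`, so that the
        -- induction hypothesis covers it.
        · refine h.ae_eq_zero_of_abs_sub_le hΛ R.cast_nonneg hδ0.le hsmall
            (ih (max 0 (t - δ)) ?_) (t := t) ?_
          · rw [abs_of_nonneg (le_max_left _ _)]
            exact max_le (by positivity) (by linarith)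
          · constructor
            · rcases max_cases 0 (t - δ) with ⟨h1, h2⟩ | ⟨h1, h2⟩ <;> rw [h1] <;> linarith
            · linarith [le_max_right 0 (t - δ)]
        · refine h.ae_eq_zero_of_abs_sub_le hΛ R.cast_nonneg hδ0.le hsmall
            (ih (min 0 (t + δ)) ?_) (t := t) ?_
          · rw [abs_of_nonpos (min_le_left _ _)]
            have : -(k * δ) ≤ min 0 (t + δ) := le_min (by simp; positivity) (by linarith)
            linarith
          · constructor
            · linarith [min_le_right 0 (t + δ)]
            · rcases min_cases 0 (t + δ) with ⟨h1, h2⟩ | ⟨h1, h2⟩ <;> rw [h1] <;> linarith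
    obtain ⟨k, hk'⟩ := exists_nat_ge (|t| / δ)
    exact hk k t ((div_le_iff₀ hδ0).1 hk')
  filter_upwards [ae_all_iff.2 hball] with ξ hξ
  obtain ⟨R, hR⟩ := exists_nat_gt ‖ξ‖
  exact hξ R (by simpa using hR)

end IsWeakSolution

end Uniqueness

/-! ### The flow on rays and its quadratic counterpart. -/

section Flow
open scoped Matrix.Norms.Frobenius
attribute [local instance] matTopology

variable {n m : ℕ}

/-- The fundamental solution `Y` of `∂ₜ v = i ρ a(t, ω) v`. -/
structure FundamentalFlow (a : ℝ → Sphere n → Mat m) (Y : ℝ → Sphere n × ℝ → Mat m) : Prop where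
  meas : StronglyMeasurable (Function.uncurry Y)
  at_zero : ∀ p, Y 0 p = 1
  deriv : ∀ t p, HasDerivAt (fun t => Y t p)
    (((Complex.I * (p.2 : ℂ)) • a t p.1) * Y t p) t

theorem exists_fundamentalFlow {a : ℝ → Sphere n → Mat m} {ℓ : ℝ}
    (hm : StronglyMeasurable (Function.uncurry a)) (hc : ∀ ω, Continuous fun t => a t ω)
    (hℓ : ∀ ω t, ‖a t ω‖ ≤ ℓ) : ∃ Y, FundamentalFlow a Y := by
  have h1 : StronglyMeasurable fun q : ℝ × Sphere n × ℝ => a q.1 q.2.1 :=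
    hm.comp_measurable (by fun_prop : Measurable fun q : ℝ × Sphere n × ℝ => (q.1, q.2.1))
  have h2 : Continuous fun q : ℝ × Sphere n × ℝ => Complex.I * (q.2.2 : ℂ) := by fun_prop
  obtain ⟨Y, h3, h4, h5⟩ := exists_measurable_fundamental_solution (X := Sphere n × ℝ)
    (𝔸 := Mat m) (A := fun t p => (Complex.I * (p.2 : ℂ)) • a t p.1) (C := fun p => |p.2| * ℓ)
    (h2.stronglyMeasurable.smul h1) (fun p => (continuous_const_smul (Complex.I * (p.2 : ℂ))).comp (hc p.1)) fun t p => by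
      rw [norm_smul, norm_mul, Complex.norm_I, one_mul, Complex.norm_real, Real.norm_eq_abs]
      exact mul_le_mul_of_nonneg_left (hℓ _ _) (abs_nonneg _)
  exact ⟨Y, h3, h4, h5⟩

/-- The solution `v(t, ω, ρ) = Y(t, ω, ρ) Û(ρω)` of the equation on the ray through `ω`. -/
def rayVec (Y : ℝ → Sphere n × ℝ → Mat m) (u : L2 n m) (t : ℝ) (ω : Sphere n) (ρ : ℝ) :
    Fin m → ℂ :=
  (Y t (ω, ρ)).mulVec fun k => fhat u (ρ • (ω : Space n)) k

/-- The matrix `v v^*`. -/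
def rayMat (Y : ℝ → Sphere n × ℝ → Mat m) (u : L2 n m) (t : ℝ) (ω : Sphere n) (ρ : ℝ) : Mat m :=
  Y t (ω, ρ) * Matrix.vecMulVec (fun k => fhat u (ρ • (ω : Space n)) k)
    (star fun k => fhat u (ρ • (ω : Space n)) k) * star (Y t (ω, ρ))

theorem rayMat_apply (Y : ℝ → Sphere n × ℝ → Mat m) (u : L2 n m) (t : ℝ) (ω : Sphere n) (ρ : ℝ)
    (j k : Fin m) :
    rayMat Y u t ω ρ j k = rayVec Y u t ω ρ j * (starRingEnd ℂ) (rayVec Y u t ω ρ k) := by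
  rw [rayMat, Matrix.mul_vecMulVec, Matrix.vecMulVec_mul, Matrix.vecMulVec_apply,
    Matrix.star_eq_conjTranspose, ← Matrix.star_mulVec]
  rfl

namespace FundamentalFlow

variable {a : ℝ → Sphere n → Mat m} {Y : ℝ → Sphere n × ℝ → Mat m} {u : L2 n m}

theorem rayVec_zero (h : FundamentalFlow a Y) (ω : Sphere n) (ρ : ℝ) (j : Fin m) :
    rayVec Y u 0 ω ρ j = fhat u (ρ • (ω : Space n)) j := by
  simp [rayVec, h.at_zero]

theorem stronglyMeasurable_rayVec (h : FundamentalFlow a Y) (j : Fin m) :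
    StronglyMeasurable fun p : ℝ × Sphere n × ℝ => rayVec Y u p.1 p.2.1 p.2.2 j := by
  simp only [rayVec, Matrix.mulVec, dotProduct]
  refine Finset.stronglyMeasurable_fun_sum _ fun k _ => ?_
  have h1 : StronglyMeasurable fun p : ℝ × Sphere n × ℝ => Y p.1 (p.2.1, p.2.2) j k :=
    h.meas.entry j k
  have h2 : StronglyMeasurable fun p : ℝ × Sphere n × ℝ => fhat u (p.2.2 • (p.2.1 : Space n)) :=
    (stronglyMeasurable_fhat u).comp_measurable (by fun_prop)
  have h3 : StronglyMeasurable fun p : ℝ × Sphere n × ℝ => fhat u (p.2.2 • (p.2.1 : Space n)) k :=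
    (by fun_prop : Continuous fun w : EuclideanSpace ℂ (Fin m) => w k).comp_stronglyMeasurable h2
  exact h1.mul h3

theorem stronglyMeasurable_rayMat (h : FundamentalFlow a Y) :
    StronglyMeasurable fun p : ℝ × Sphere n × ℝ => rayMat Y u p.1 p.2.1 p.2.2 := by
  refine stronglyMeasurable_of_entries fun j k => ?_
  simp only [rayMat_apply]
  exact (h.stronglyMeasurable_rayVec j).mul
    (Complex.continuous_conj.comp_stronglyMeasurable (h.stronglyMeasurable_rayVec k))

theorem hasDerivAt_rayVec (h : FundamentalFlow a Y) (t : ℝ) (ω : Sphere n) (ρ : ℝ) (j : Fin m) :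
    HasDerivAt (fun t => rayVec Y u t ω ρ j)
      (Complex.I * ∑ k, (ρ : ℂ) * a t ω j k * rayVec Y u t ω ρ k) t := by
  have hY : ∀ k, HasDerivAt (fun t => Y t (ω, ρ) j k)
      ((((Complex.I * (ρ : ℂ)) • a t ω) * Y t (ω, ρ)) j k) t := fun k =>
    ((entryCLM j k).restrictScalars ℝ).hasFDerivAt.comp_hasDerivAt t (h.deriv t (ω, ρ))
  have := HasDerivAt.fun_sum (u := Finset.univ) fun k _ =>
    (hY k).mul_const (fhat u (ρ • (ω : Space n)) k)
  refine this.congr_deriv ?_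
  have e := congrFun (Matrix.mulVec_mulVec (fun k => fhat u (ρ • (ω : Space n)) k)
    ((Complex.I * (ρ : ℂ)) • a t ω) (Y t (ω, ρ))) j
  refine (Eq.trans ?_ e.symm).trans ?_
  · rfl
  · simp only [rayVec, Matrix.mulVec, dotProduct, Matrix.smul_apply, smul_eq_mul, Finset.mul_sum]
    exact Finset.sum_congr rfl fun k _ => Finset.sum_congr rfl fun l _ => by ring

/-- The conjugate of `iρ` is `-iρ` since `ρ` is real; this produces the minus sign of the
commutator. -/
theorem hasDerivAt_rayMat (h : FundamentalFlow a Y) (t : ℝ) (ω : Sphere n) (ρ : ℝ) :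
    HasDerivAt (fun t => rayMat Y u t ω ρ) ((Complex.I * (ρ : ℂ)) •
      (a t ω * rayMat Y u t ω ρ - rayMat Y u t ω ρ * star (a t ω))) t := by
  have h1 := h.deriv t (ω, ρ)
  have h2 := (h1.mul_const (Matrix.vecMulVec (fun k => fhat u (ρ • (ω : Space n)) k)
    (star fun k => fhat u (ρ • (ω : Space n)) k))).mul h1.star
  refine h2.congr_deriv ?_
  simp only [rayMat, star_mul, star_smul, smul_mul_assoc, mul_smul_comm, mul_assoc, smul_sub]
  have : star (ρ : ℂ) * star Complex.I = -(Complex.I * ρ) := by simp [mul_comm]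
  rw [this, neg_smul, sub_eq_add_neg]

/-- `|vⱼ|²` is a diagonal entry of `v v^*`, so a bound for the matrix flow gives the square root of
that bound for the vector. -/
theorem norm_rayVec_le {M : ℝ} (hM0 : 0 ≤ M) (h : FundamentalFlow a Y) {ω : Sphere n}
    (hM : ∀ t ρ, ‖rayMat Y u t ω ρ‖ ≤ M * ‖rayMat Y u 0 ω ρ‖) (t ρ : ℝ) (j : Fin m) :
    ‖rayVec Y u t ω ρ j‖ ≤ √M * ∑ k, ‖fhat u (ρ • (ω : Space n)) k‖ := by
  have h1 : ‖rayVec Y u t ω ρ j‖ ^ 2 ≤ M * (∑ k, ‖fhat u (ρ • (ω : Space n)) k‖) ^ 2 := by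
    calc ‖rayVec Y u t ω ρ j‖ ^ 2 = ‖rayMat Y u t ω ρ j j‖ := by
          rw [rayMat_apply, norm_mul, RCLike.norm_conj, sq]
      _ ≤ ‖rayMat Y u t ω ρ‖ := norm_entry_le _ _ _
      _ ≤ M * ‖rayMat Y u 0 ω ρ‖ := hM t ρ
      _ ≤ M * ∑ i, ∑ k, ‖rayMat Y u 0 ω ρ i k‖ := by gcongr; exact norm_le_sum_entries _
      _ = _ := by
        simp only [rayMat_apply, h.rayVec_zero, norm_mul, RCLike.norm_conj]
        rw [sq, Finset.sum_mul_sum]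
  have h2 := Real.sqrt_le_sqrt h1
  rwa [Real.sqrt_sq (norm_nonneg _), Real.sqrt_mul hM0, Real.sqrt_sq (by positivity)] at h2

end FundamentalFlow

theorem memLp_fhat_apply (u : L2 n m) (j : Fin m) : MemLp (fun ξ => fhat u ξ j) 2 volume :=
  (memLp_fhat u).of_le ((by fun_prop : Continuous fun w : EuclideanSpace ℂ (Fin m) =>
    w j).comp_aestronglyMeasurable (memLp_fhat u).1)
    (Eventually.of_forall fun ξ => PiLp.norm_apply_le _ _)

theorem l2_fhat_apply_le (u : L2 n m) (j : Fin m) :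
    l2 volume (fun ξ => fhat u ξ j) ≤ √((2 * Real.pi) ^ n) * ‖u‖ := by
  have h1 : eLpNorm (fun ξ => fhat u ξ j) 2 volume ≤ eLpNorm (fhat u) 2 volume :=
    eLpNorm_mono fun ξ => PiLp.norm_apply_le _ _
  refine (ENNReal.toReal_mono (memLp_fhat u).2.ne h1).trans_eq ?_
  rw [(memLp_fhat u).eLpNorm_eq_integral_rpow_norm (by simp) (by simp)]
  simp only [ENNReal.toReal_ofNat, Real.rpow_two]
  rw [integral_norm_sq_fhat, ENNReal.toReal_ofReal (by positivity), ← one_div,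
    ← Real.sqrt_eq_rpow, Real.sqrt_mul (by positivity), Real.sqrt_sq (norm_nonneg _)]

theorem memLp_norm_mul_schwartz (g : 𝓢(Space n, ℂ)) :
    MemLp (fun ξ => ((‖ξ‖ : ℝ) : ℂ) * g ξ) 2 volume := by
  have hc : Continuous fun ξ => ((‖ξ‖ : ℝ) : ℂ) * g ξ :=
    (by fun_prop : Continuous fun ξ : Space n => ((‖ξ‖ : ℝ) : ℂ)).mul g.continuous
  rw [memLp_two_iff_integrable_sq_norm hc.aestronglyMeasurable]
  obtain ⟨C, hC0, hC⟩ := g.decay 0 0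
  refine ((g.integrable_pow_mul volume 2).const_mul C).mono'
    (hc.norm.pow 2).aestronglyMeasurable (Eventually.of_forall fun ξ => ?_)
  have h1 : ‖g ξ‖ ≤ C := by simpa using hC ξ
  rw [Real.norm_of_nonneg (by positivity), norm_mul, Complex.norm_real, norm_norm]
  nlinarith [mul_nonneg (mul_nonneg (sq_nonneg ‖ξ‖) (norm_nonneg (g ξ))) (sub_nonneg.2 h1)]

end Flow

/-! ### Identification of the weak solution with the flow on rays. -/

section Identification
open scoped Matrix.Norms.Frobenius
attribute [local instance] matTopology

variable {n m : ℕ} {a : ℝ → Sphere n → Mat m} {Y : ℝ → Sphere n × ℝ → Mat m}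

/-- The symbol `|ξ| a(t, ξ/|ξ|)`. -/
def homogeneousExt (e : Sphere n) (a : ℝ → Sphere n → Mat m) (t : ℝ) (ξ : Space n) : Mat m :=
  ((‖ξ‖ : ℝ) : ℂ) • a t (direction e ξ)

theorem ae_eq_homogeneousExt (hn : 1 ≤ n) (e : Sphere n) {Λ K : ℝ} {A : ℝ → Space n → Mat m}
    (hA : ClassK Λ K A) {t : ℝ} (h : ∀ᵐ ω ∂(surf n), a t ω = restr A t ω) :
    ∀ᵐ ξ, homogeneousExt e a t ξ = A t ξ := by
  have : Nontrivial (Space n) := by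
    have : Nonempty (Fin n) := ⟨⟨0, hn⟩⟩
    infer_instance
  have h0 : ∀ᵐ ξ : Space n, ξ ≠ 0 := Measure.ae_ne volume 0
  filter_upwards [(quasiMeasurePreserving_direction hn e).ae h, h0] with ξ hξ hξ0
  have hd : (direction e ξ : Space n) ≠ 0 := by
    intro h
    have := norm_smul_direction e ξ
    rw [h, smul_zero] at this
    exact hξ0 this.symm
  conv_rhs => rw [← norm_smul_direction e ξ]
  rw [hA.homogeneous t ‖ξ‖ _ (norm_pos_iff.2 hξ0) hd, homogeneousExt, hξ]
  rfl

namespace FundamentalFlow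

theorem stronglyMeasurable_rayVec_direction (h : FundamentalFlow a Y) (u : L2 n m) (e : Sphere n)
    (t : ℝ) (j : Fin m) :
    StronglyMeasurable fun ξ => rayVec Y u t (direction e ξ) ‖ξ‖ j :=
  (h.stronglyMeasurable_rayVec j).comp_measurable
    (measurable_const.prodMk ((measurable_direction e).prodMk measurable_norm))

/-- The Fourier transform of a weak solution is given by the fundamental solutions on the rays. -/
theorem fhat_eq_rayVec (h : FundamentalFlow a Y) (hn : 1 ≤ n) (e : Sphere n) {Λ K ℓ M : ℝ}
    (hℓ0 : 0 ≤ ℓ) (hM0 : 0 ≤ M) {A : ℝ → Space n → Mat m} (hA : ClassK Λ K A)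
    (hm : StronglyMeasurable (Function.uncurry a)) (hℓ : ∀ ω t, ‖a t ω‖ ≤ ℓ)
    (haA : ∀ t, ∀ᵐ ω ∂(surf n), a t ω = restr A t ω) {U : ℝ → L2 n m} (hU : IsSolution A U)
    (hM : ∀ᵐ ω ∂(surf n), ∀ t ρ, ‖rayMat Y (U 0) t ω ρ‖ ≤ M * ‖rayMat Y (U 0) 0 ω ρ‖) (t : ℝ) :
    ∀ᵐ ξ, ∀ j, fhat (U t) ξ j = rayVec Y (U 0) t (direction e ξ) ‖ξ‖ j := by
  set α := homogeneousExt e a with hα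
  set v : ℝ → Space n → Fin m → ℂ := fun t ξ => rayVec Y (U 0) t (direction e ξ) ‖ξ‖ with hv
  -- A majorant in `L²` for the ray solution that does not depend on time; it justifies
  -- differentiation under the integral and the local boundedness required for uniqueness.
  set N : Space n → ℂ := fun ξ => ((√M * ∑ k, ‖fhat (U 0) ξ k‖ : ℝ) : ℂ) with hN
  have hNm : MemLp N 2 volume :=
    ((memLp_finsetSum Finset.univ fun k _ => (memLp_fhat_apply (U 0) k).norm).const_mul
      (√M)).ofReal
  have hαA : ∀ t, ∀ᵐ ξ, α t ξ = A t ξ := fun t => ae_eq_homogeneousExt hn e hA (haA t)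
  have hvm : ∀ t j, StronglyMeasurable fun ξ => v t ξ j :=
    h.stronglyMeasurable_rayVec_direction (U 0) e
  have hvb : ∀ᵐ ξ, ∀ t j, ‖v t ξ j‖ ≤ ‖N ξ‖ := by
    filter_upwards [(quasiMeasurePreserving_direction hn e).ae hM] with ξ hξ t j
    refine (h.norm_rayVec_le hM0 hξ t ‖ξ‖ j).trans ?_
    rw [norm_smul_direction, hN, Complex.norm_real]
    exact le_abs_self _
  have hvL : ∀ t j, MemLp (fun ξ => v t ξ j) 2 volume := fun t j =>
    hNm.mono (hvm t j).aestronglyMeasurable (hvb.mono fun ξ hξ => hξ t j)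
  have hαm : ∀ t j k, StronglyMeasurable fun ξ => α t ξ j k := by
    intro t j k
    have h1 : StronglyMeasurable fun ξ : Space n => a t (direction e ξ) :=
      hm.comp_measurable (measurable_const.prodMk (measurable_direction e))
    have h2 : Continuous fun ξ : Space n => ((‖ξ‖ : ℝ) : ℂ) := by fun_prop
    exact h2.stronglyMeasurable.mul (h1.entry j k)
  have hαb : ∀ t ξ j k, ‖α t ξ j k‖ ≤ ℓ * ‖ξ‖ := by
    intro t ξ j k
    change ‖((‖ξ‖ : ℝ) : ℂ) * a t (direction e ξ) j k‖ ≤ _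
    rw [norm_mul, Complex.norm_real, norm_norm, mul_comm]
    gcongr
    exact (norm_entry_le _ _ _).trans (hℓ _ _)
  have hterm : ∀ {w : ℝ → Space n → Fin m → ℂ} (_ : ∀ t j, MemLp (fun ξ => w t ξ j) 2 volume)
      (g : 𝓢(Space n, ℂ)) (t : ℝ) (j : Fin m),
      Integrable fun ξ => g ξ * ∑ k, α t ξ j k * w t ξ k := by
    intro w hw g t j
    simp only [Finset.mul_sum, ← mul_assoc]
    refine integrable_finsetSum _ fun k _ => integrable_mul_of_memLp (μ := volume)
      (f := fun ξ => g ξ * α t ξ j k) (g := fun ξ => w t ξ k) ?_ (hw t k)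
    refine (memLp_norm_mul_schwartz g).of_le_mul (c := ℓ)
      (g.continuous.aestronglyMeasurable.mul (hαm t j k).aestronglyMeasurable)
      (Eventually.of_forall fun ξ => ?_)
    rw [norm_mul, norm_mul, Complex.norm_real, norm_norm]
    nlinarith [mul_le_mul_of_nonneg_left (hαb t ξ j k) (norm_nonneg (g ξ))]
  have hgL : ∀ g : 𝓢(Space n, ℂ), MemLp (fun ξ => g ξ) 2 volume := fun g => g.memLp 2 volume
  have hvweak : ∀ (g : 𝓢(Space n, ℂ)) (j : Fin m) (t : ℝ),
      HasDerivAt (fun τ => ∫ ξ, g ξ * v τ ξ j)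
        (∫ ξ, g ξ * (Complex.I * ∑ k, α t ξ j k * v t ξ k)) t := by
    intro g j t
    refine (hasDerivAt_integral_of_dominated_loc_of_deriv_le (s := univ) univ_mem
      (F' := fun τ ξ => g ξ * (Complex.I * ∑ k, α τ ξ j k * v τ ξ k))
      (bound := fun ξ => (m * ℓ) * ‖(((‖ξ‖ : ℝ) : ℂ) * g ξ) * N ξ‖) ?_ ?_ ?_ ?_ ?_ ?_).2
    · exact Eventually.of_forall fun τ =>
        g.continuous.aestronglyMeasurable.mul (hvm τ j).aestronglyMeasurable
    · exact integrable_mul_of_memLp (hgL g) (hvL t j)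
    · refine g.continuous.aestronglyMeasurable.mul (StronglyMeasurable.aestronglyMeasurable ?_)
      exact stronglyMeasurable_const.mul (Finset.stronglyMeasurable_fun_sum _ fun k _ =>
        (hαm t j k).mul (hvm t k))
    · filter_upwards [hvb] with ξ hξ τ _
      rw [norm_mul, norm_mul, norm_mul, norm_mul, Complex.norm_I, one_mul, Complex.norm_real,
        norm_norm]
      have : ‖∑ k, α τ ξ j k * v τ ξ k‖ ≤ m * (ℓ * ‖ξ‖ * ‖N ξ‖) := by
        refine (norm_sum_le_of_le (n := fun _ => ℓ * ‖ξ‖ * ‖N ξ‖) _ fun k _ => ?_).trans_eq ?_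
        · rw [norm_mul]
          exact mul_le_mul (hαb τ ξ j k) (hξ τ k) (norm_nonneg _) (by positivity)
        · simp
      calc ‖g ξ‖ * ‖∑ k, α τ ξ j k * v τ ξ k‖ ≤ ‖g ξ‖ * (m * (ℓ * ‖ξ‖ * ‖N ξ‖)) := by gcongr
        _ = _ := by ring
    · exact (integrable_mul_of_memLp (memLp_norm_mul_schwartz g) hNm).norm.const_mul _
    · refine Eventually.of_forall fun ξ τ _ => ?_
      exact (h.hasDerivAt_rayVec τ (direction e ξ) ‖ξ‖ j).const_mul (g ξ)
  -- The two candidates agree at time zero, so their difference is a weak solution with zero data.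
  have hweak : IsWeakSolution ℓ α fun t ξ j => fhat (U t) ξ j - v t ξ j := by
    refine ⟨fun t j => (memLp_fhat_apply (U t) j).sub (hvL t j), fun T => ?_,
      fun t j k => (hαm t j k).aestronglyMeasurable, fun t => Eventually.of_forall (hαb t), ?_⟩
    · obtain ⟨C, hC⟩ := (isCompact_Icc (a := -T) (b := T)).exists_bound_of_continuousOn
        hU.1.continuousOn
      refine ⟨√((2 * Real.pi) ^ n) * C + l2 volume N, fun t ht j => ?_⟩
      have h1 := (memLp_fhat_apply (U t) j)
      have h2 : l2 volume (fun ξ => fhat (U t) ξ j - v t ξ j) ≤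
          l2 volume (fun ξ => fhat (U t) ξ j) + l2 volume fun ξ => v t ξ j := by
        have := eLpNorm_sub_le h1.1 (hvL t j).1 (p := 2) (by norm_num)
        have := ENNReal.toReal_mono (ENNReal.add_ne_top.2 ⟨h1.2.ne, (hvL t j).2.ne⟩) this
        rwa [ENNReal.toReal_add h1.2.ne (hvL t j).2.ne] at this
      refine h2.trans (add_le_add ((l2_fhat_apply_le _ _).trans ?_) ?_)
      · gcongr
        exact hC t (abs_le.1 ht)
      · have := l2_le_mul_l2 zero_le_one hNm (f := fun ξ => v t ξ j)
          (hvb.mono fun ξ hξ => by rw [one_mul]; exact hξ t j)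
        rwa [one_mul] at this
    · intro g j t
      have h1 := (hU.2 g j t).sub (hvweak g j t)
      refine (h1.congr_of_eventuallyEq (Eventually.of_forall fun τ => ?_)).congr_deriv ?_
      · simp only [Pi.sub_apply, mul_sub]
        exact integral_sub (integrable_mul_of_memLp (hgL g) (memLp_fhat_apply (U τ) j))
          (integrable_mul_of_memLp (hgL g) (hvL τ j))
      · have e1 : ∫ ξ, g ξ * ∑ k, A t ξ j k * fhat (U t) ξ k =
            ∫ ξ, g ξ * ∑ k, α t ξ j k * fhat (U t) ξ k :=
          integral_congr_ae ((hαA t).mono fun ξ hξ => by simp only [hξ])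
        have e2 : ∫ ξ, g ξ * (Complex.I * ∑ k, α t ξ j k * v t ξ k) =
            Complex.I * ∫ ξ, g ξ * ∑ k, α t ξ j k * v t ξ k := by
          rw [← integral_const_mul]
          exact integral_congr_ae (Eventually.of_forall fun ξ => by ring)
        rw [e1, e2, ← mul_sub, ← integral_sub (hterm (fun t j => memLp_fhat_apply (U t) j) g t j)
          (hterm hvL g t j)]
        congr 1
        refine integral_congr_ae (Eventually.of_forall fun ξ => ?_)
        simp only [← mul_sub, ← Finset.sum_sub_distrib]
  filter_upwards [hweak.ae_eq_zero hℓ0 (Eventually.of_forall fun ξ j => by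
    simp [hv, h.rayVec_zero, norm_smul_direction]) t] with ξ hξ j
  exact sub_eq_zero.1 (hξ j)

end FundamentalFlow

end Identification

/-! ### The time derivative of the quadratic form, direction by direction. -/

section Rate
open scoped Matrix.Norms.Frobenius
attribute [local instance] matTopology

variable {n m : ℕ}

/-- The functional `X ↦ tr(S X)`. -/
def traceCLM (S : Mat m) : Mat m →L[ℂ] ℂ :=
  LinearMap.toContinuousLinearMap
    ((Matrix.traceLinearMap (Fin m) ℂ ℂ).comp (LinearMap.mulLeft ℂ S))

theorem traceCLM_apply (S X : Mat m) : traceCLM S X = (S * X).trace := rfl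

theorem traceCLM_eq_sum (S X : Mat m) : traceCLM S X = ∑ b, ∑ l, S b l * X l b := by
  simp [traceCLM_apply, Matrix.trace, Matrix.mul_apply]

/-- The functional `X ↦ i tr(S (A X - X A^*))`. -/
def rateCLM (S A : Mat m) : Mat m →L[ℂ] ℂ :=
  Complex.I • (traceCLM S).comp
    (LinearMap.toContinuousLinearMap (LinearMap.mulLeft ℂ A - LinearMap.mulRight ℂ (star A)))

theorem rateCLM_apply (S A X : Mat m) :
    rateCLM S A X = Complex.I * traceCLM S (A * X - X * star A) := rfl

theorem continuous_rateCLM (S : Mat m) : Continuous fun p : Mat m × Mat m => rateCLM S p.1 p.2 := by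
  simp only [rateCLM_apply]
  refine continuous_const.mul ((traceCLM S).continuous.comp ?_)
  exact (continuous_fst.mul continuous_snd).sub (continuous_snd.mul continuous_fst.star)

theorem stronglyMeasurable_rateCLM_comp {X : Type*} [MeasurableSpace X] (S : Mat m) {f g : X → Mat m}
    (hf : StronglyMeasurable f) (hg : StronglyMeasurable g) :
    StronglyMeasurable fun x => rateCLM S (f x) (g x) :=
  Continuous.comp_stronglyMeasurable (g := fun p : Mat m × Mat m => rateCLM S p.1 p.2)
    (f := fun x => (f x, g x)) (continuous_rateCLM S) (hf.prodMk hg)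

theorem norm_rateCLM_le (S A X : Mat m) : ‖rateCLM S A X‖ ≤ ‖traceCLM S‖ * (2 * ‖A‖ * ‖X‖) := by
  rw [rateCLM_apply, norm_mul, Complex.norm_I, one_mul]
  refine (ContinuousLinearMap.le_opNorm _ _).trans ?_
  gcongr
  calc ‖A * X - X * star A‖ ≤ ‖A * X‖ + ‖X * star A‖ := norm_sub_le _ _
    _ ≤ ‖A‖ * ‖X‖ + ‖X‖ * ‖star A‖ := add_le_add (norm_mul_le _ _) (norm_mul_le _ _)
    _ = _ := by rw [norm_star]; ring

/-- A flow with the integrability properties and estimates valid for data in `𝒴`. -/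
structure RayEstimates (a : ℝ → Sphere n → Mat m) (Y : ℝ → Sphere n × ℝ → Mat m) (u : L2 n m)
    (ℓ M : ℝ) : Prop where
  flow : FundamentalFlow a Y
  meas : StronglyMeasurable (Function.uncurry a)
  cont : ∀ ω, Continuous fun t => a t ω
  norm_le : ∀ ω t, ‖a t ω‖ ≤ ℓ
  M_nonneg : 0 ≤ M
  integrable : ∀ᵐ ω ∂(surf n), IntegrableOn (fun ρ : ℝ => (ρ : ℂ) ^ n • rayMat Y u 0 ω ρ) (Ioi 0)
  rayMat_le : ∀ᵐ ω ∂(surf n), ∀ t ρ, ‖rayMat Y u t ω ρ‖ ≤ M * ‖rayMat Y u 0 ω ρ‖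
  lintegral_le : ∀ᵐ ω ∂(surf n), ∫⁻ t, ‖a t ω * radialFourier n (rayMat Y u t ω) 0 -
      radialFourier n (rayMat Y u t ω) 0 * star (a t ω)‖ₑ ≤
    ENNReal.ofReal M * ∫⁻ τ, ‖radialFourier n (rayMat Y u 0 ω) τ‖ₑ

/-- The contribution of the direction `ω` to the derivative of `s`. -/
def rayRate (S : Mat m) (a : ℝ → Sphere n → Mat m) (Y : ℝ → Sphere n × ℝ → Mat m) (u : L2 n m)
    (t : ℝ) (ω : Sphere n) : ℂ :=
  rateCLM S (a t ω) (radialFourier n (rayMat Y u t ω) 0)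

/-- The contribution of the direction `ω` to `s`. -/
def rayForm (S : Mat m) (Y : ℝ → Sphere n × ℝ → Mat m) (u : L2 n m) (t : ℝ) (ω : Sphere n) : ℂ :=
  ∫ ρ in Ioi (0 : ℝ), ρ ^ (n - 1) • traceCLM S (rayMat Y u t ω ρ)

theorem FundamentalFlow.stronglyMeasurable_rayMat_comp {a : ℝ → Sphere n → Mat m}
    {Y : ℝ → Sphere n × ℝ → Mat m} (h : FundamentalFlow a Y) (u : L2 n m) {X : Type*}
    [MeasurableSpace X] {f : X → ℝ} {g : X → Sphere n} {r : X → ℝ} (hf : Measurable f)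
    (hg : Measurable g) (hr : Measurable r) :
    StronglyMeasurable fun x => rayMat Y u (f x) (g x) (r x) :=
  StronglyMeasurable.comp_measurable (f := fun p : ℝ × Sphere n × ℝ => rayMat Y u p.1 p.2.1 p.2.2)
    (g := fun x => (f x, g x, r x)) h.stronglyMeasurable_rayMat (hf.prodMk (hg.prodMk hr))

theorem FundamentalFlow.stronglyMeasurable_radialFourier {a : ℝ → Sphere n → Mat m}
    {Y : ℝ → Sphere n × ℝ → Mat m} (h : FundamentalFlow a Y) (u : L2 n m) :
    StronglyMeasurable fun p : (ℝ × Sphere n) × ℝ => radialFourier n (rayMat Y u p.1.1 p.1.2) p.2 := by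
  refine StronglyMeasurable.integral_prod_right (f := fun (p : (ℝ × Sphere n) × ℝ) (ρ : ℝ) =>
    Complex.exp (Complex.I * p.2 * ρ) • ((ρ : ℂ) ^ n • rayMat Y u p.1.1 p.1.2 ρ)) ?_
  have h1 : StronglyMeasurable fun q : ((ℝ × Sphere n) × ℝ) × ℝ =>
      rayMat Y u q.1.1.1 q.1.1.2 q.2 :=
    h.stronglyMeasurable_rayMat_comp u (by fun_prop) (by fun_prop) (by fun_prop)
  have h2 : Continuous fun q : ((ℝ × Sphere n) × ℝ) × ℝ => Complex.exp (Complex.I * q.1.2 * q.2) := by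
    fun_prop
  have h3 : Continuous fun q : ((ℝ × Sphere n) × ℝ) × ℝ => (q.2 : ℂ) ^ n := by fun_prop
  exact h2.stronglyMeasurable.smul (h3.stronglyMeasurable.smul h1)

theorem FundamentalFlow.stronglyMeasurable_radialFourier_comp {a : ℝ → Sphere n → Mat m}
    {Y : ℝ → Sphere n × ℝ → Mat m} (h : FundamentalFlow a Y) (u : L2 n m) {X : Type*}
    [MeasurableSpace X] {f : X → ℝ} {g : X → Sphere n} {τ : X → ℝ} (hf : Measurable f)
    (hg : Measurable g) (hτ : Measurable τ) :
    StronglyMeasurable fun x => radialFourier n (rayMat Y u (f x) (g x)) (τ x) :=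
  StronglyMeasurable.comp_measurable
    (f := fun p : (ℝ × Sphere n) × ℝ => radialFourier n (rayMat Y u p.1.1 p.1.2) p.2)
    (g := fun x => ((f x, g x), τ x)) (h.stronglyMeasurable_radialFourier u)
    ((hf.prodMk hg).prodMk hτ)

theorem lintegral_lintegral_sum_sum_swap {X ι : Type*} [MeasurableSpace X] {ν : Measure X}
    [SFinite ν] [Fintype ι] {f : ι → ι → ℝ × X → ℝ≥0∞} (hf : ∀ j k, Measurable (f j k)) :
    ∫⁻ ω, (∫⁻ τ, ∑ j, ∑ k, f j k (τ, ω)) ∂ν = ∑ j, ∑ k, ∫⁻ τ, ∫⁻ ω, f j k (τ, ω) ∂ν := by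
  have h1 : ∀ j k (ω : X), Measurable fun τ => f j k (τ, ω) := fun j k ω =>
    (hf j k).comp measurable_prodMk_right
  have h2 : ∀ j k, Measurable fun ω : X => ∫⁻ τ, f j k (τ, ω) := fun j k =>
    (hf j k).lintegral_prod_left'
  have e1 : ∀ ω : X, ∫⁻ τ, ∑ j, ∑ k, f j k (τ, ω) = ∑ j, ∑ k, ∫⁻ τ, f j k (τ, ω) := fun ω => by
    rw [lintegral_finsetSum _ fun j _ => Finset.measurable_fun_sum _ fun k _ => h1 j k ω]
    exact Finset.sum_congr rfl fun j _ => lintegral_finsetSum _ fun k _ => h1 j k ω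
  simp only [e1]
  rw [lintegral_finsetSum _ fun j _ => Finset.measurable_fun_sum _ fun k _ => h2 j k]
  refine Finset.sum_congr rfl fun j _ => (lintegral_finsetSum _ fun k _ => h2 j k).trans ?_
  exact Finset.sum_congr rfl fun k _ => lintegral_lintegral_swap
    (f := fun ω τ => f j k (τ, ω)) ((hf j k).comp measurable_swap).aemeasurable

namespace RayEstimates

variable {a : ℝ → Sphere n → Mat m} {Y : ℝ → Sphere n × ℝ → Mat m} {u : L2 n m} {ℓ M : ℝ}

theorem stronglyMeasurable_rayRate (h : RayEstimates a Y u ℓ M) (S : Mat m) :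
    StronglyMeasurable fun p : ℝ × Sphere n => rayRate S a Y u p.1 p.2 := by
  have h1 : StronglyMeasurable fun p : ℝ × Sphere n => radialFourier n (rayMat Y u p.1 p.2) 0 :=
    h.flow.stronglyMeasurable_radialFourier_comp u measurable_fst measurable_snd measurable_const
  have h2 : StronglyMeasurable fun p : ℝ × Sphere n => a p.1 p.2 := h.meas
  exact stronglyMeasurable_rateCLM_comp S h2 h1

theorem ae_integrableOn (h : RayEstimates a Y u ℓ M) : ∀ᵐ ω ∂(surf n), ∀ t,
    IntegrableOn (fun ρ : ℝ => (ρ : ℂ) ^ n • rayMat Y u t ω ρ) (Ioi 0) := by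
  filter_upwards [h.integrable, h.rayMat_le] with ω h1 h2 t
  refine (h1.norm.const_mul M).mono' ?_ (Eventually.of_forall fun ρ => ?_)
  · have h3 : StronglyMeasurable fun ρ : ℝ => rayMat Y u t ω ρ :=
      h.flow.stronglyMeasurable_rayMat_comp u measurable_const measurable_const measurable_id
    exact ((by fun_prop : Continuous fun ρ : ℝ => (ρ : ℂ) ^ n).stronglyMeasurable.smul
      h3).aestronglyMeasurable
  · rw [norm_smul, norm_smul]
    calc _ ≤ ‖(ρ : ℂ) ^ n‖ * (M * ‖rayMat Y u 0 ω ρ‖) := by gcongr; exact h2 t ρ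
      _ = _ := by ring

/-- Differentiating `X` in time produces a factor `ρ`, which raises the polar weight `ρⁿ⁻¹` to the
weight `ρⁿ` of the `𝒴`-norm. The bound on the flow provides the majorant for Fubini. -/
theorem rayForm_sub (h : RayEstimates a Y u ℓ M) (hn : 1 ≤ n) (S : Mat m) (t : ℝ) {ω : Sphere n}
    (h1 : ∀ t, IntegrableOn (fun ρ : ℝ => (ρ : ℂ) ^ n • rayMat Y u t ω ρ) (Ioi 0))
    (h2 : ∀ t ρ, ‖rayMat Y u t ω ρ‖ ≤ M * ‖rayMat Y u 0 ω ρ‖)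
    (h3 : IntegrableOn (fun ρ : ℝ => ρ ^ (n - 1) • traceCLM S (rayMat Y u t ω ρ)) (Ioi 0))
    (h4 : IntegrableOn (fun ρ : ℝ => ρ ^ (n - 1) • traceCLM S (rayMat Y u 0 ω ρ)) (Ioi 0)) :
    rayForm S Y u t ω - rayForm S Y u 0 ω = ∫ r in (0 : ℝ)..t, rayRate S a Y u r ω := by
  set x := rayMat Y u with hx
  have hℓ : 0 ≤ ℓ := (norm_nonneg _).trans (h.norm_le ω 0)
  have hxm : StronglyMeasurable fun p : ℝ × ℝ => x p.1 ω p.2 :=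
    h.flow.stronglyMeasurable_rayMat_comp u measurable_fst measurable_const measurable_snd
  have ham : StronglyMeasurable fun p : ℝ × ℝ => a p.1 ω :=
    h.meas.comp_measurable (by fun_prop : Measurable fun p : ℝ × ℝ => (p.1, ω))
  have : IsFiniteMeasure ((volume : Measure ℝ).restrict (uIoc 0 t)) := by
    rw [uIoc]; infer_instance
  have hF : Integrable (Function.uncurry fun (r ρ : ℝ) => rateCLM S (a r ω) ((ρ : ℂ) ^ n • x r ω ρ))
      ((volume.restrict (uIoc 0 t)).prod (volume.restrict (Ioi 0))) := by
    refine (((h1 0).norm.const_mul (‖traceCLM S‖ * (2 * ℓ * M))).comp_snd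
      (volume.restrict (uIoc 0 t))).mono' ?_ (Eventually.of_forall fun p => ?_)
    · have hpow : Continuous fun p : ℝ × ℝ => (p.2 : ℂ) ^ n := by fun_prop
      exact (stronglyMeasurable_rateCLM_comp S ham
        (hpow.stronglyMeasurable.smul hxm)).aestronglyMeasurable
    · refine (norm_rateCLM_le _ _ _).trans ?_
      rw [norm_smul, norm_smul]
      calc ‖traceCLM S‖ * (2 * ‖a p.1 ω‖ * (‖(p.2 : ℂ) ^ n‖ * ‖x p.1 ω p.2‖)) ≤
          ‖traceCLM S‖ * (2 * ℓ * (‖(p.2 : ℂ) ^ n‖ * (M * ‖x 0 ω p.2‖))) := by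
            gcongr
            · exact h.norm_le _ _
            · exact h2 _ _
        _ = _ := by ring
  have hrate : ∀ r, rayRate S a Y u r ω =
      ∫ ρ in Ioi (0 : ℝ), rateCLM S (a r ω) ((ρ : ℂ) ^ n • x r ω ρ) := by
    intro r
    rw [ContinuousLinearMap.integral_comp_comm _ (h1 r), rayRate, radialFourier]
    simp [hx]
  simp only [hrate]
  rw [intervalIntegral_integral_swap hF, rayForm, rayForm, ← integral_sub h3 h4]
  refine setIntegral_congr_fun measurableSet_Ioi fun ρ hρ => ?_
  have hxc : Continuous fun r => x r ω ρ :=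
    continuous_iff_continuousAt.2 fun r => (h.flow.hasDerivAt_rayMat r ω ρ).continuousAt
  have hd : ∀ r, HasDerivAt (fun r => ρ ^ (n - 1) • traceCLM S (x r ω ρ))
      (rateCLM S (a r ω) ((ρ : ℂ) ^ n • x r ω ρ)) r := by
    intro r
    have := (((traceCLM S).restrictScalars ℝ).hasFDerivAt.comp_hasDerivAt r
      (h.flow.hasDerivAt_rayMat (u := u) r ω ρ)).const_smul (ρ ^ (n - 1))
    refine this.congr_deriv ?_
    change ρ ^ (n - 1) • traceCLM S ((Complex.I * (ρ : ℂ)) •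
      (a r ω * x r ω ρ - x r ω ρ * star (a r ω))) = _
    rw [map_smul (traceCLM S), map_smul (rateCLM S (a r ω)), rateCLM_apply, Complex.real_smul,
      smul_eq_mul, smul_eq_mul]
    conv_rhs => rw [← Nat.sub_add_cancel hn, pow_succ]
    push_cast
    ring
  have hc : Continuous fun r => rateCLM S (a r ω) ((ρ : ℂ) ^ n • x r ω ρ) :=
    Continuous.comp (g := fun p : Mat m × Mat m => rateCLM S p.1 p.2)
      (f := fun r => (a r ω, (ρ : ℂ) ^ n • x r ω ρ)) (continuous_rateCLM S)
      ((h.cont ω).prodMk ((continuous_const_smul ((ρ : ℂ) ^ n)).comp hxc))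
  exact (intervalIntegral.integral_eq_sub_of_hasDerivAt (fun r _ => hd r)
    (hc.intervalIntegrable 0 t)).symm

theorem ae_radialFourier_entry (h : RayEstimates a Y u ℓ M) (j k : Fin m) :
    ∀ᵐ ω ∂(surf n), ∀ τ, radialFourier n (rayMat Y u 0 ω) τ j k =
      ∫ ρ in Ioi (0 : ℝ), Complex.exp (Complex.I * τ * ρ) * radial u j k ω ρ := by
  filter_upwards [h.integrable] with ω hω τ
  rw [radialFourier, integral_entry (DiagonalFlow.integrableOn_exp_smul hω τ)]
  refine integral_congr_ae (Eventually.of_forall fun ρ => ?_)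
  simp only [Matrix.smul_apply, smul_eq_mul, rayMat_apply, h.flow.rayVec_zero, radial]
  ring

/-- At time zero the entries of `rayMat` are the products occurring in the `𝒴`-norm; only the order
of the integrals over `τ` and `ω` differs. -/
theorem lintegral_sum_radialFourier_eq (h : RayEstimates a Y u ℓ M) :
    ∫⁻ ω, (∫⁻ τ, ∑ j, ∑ k, ‖radialFourier n (rayMat Y u 0 ω) τ j k‖ₑ) ∂(surf n) = yNorm u := by
  have hSM : ∀ j k, StronglyMeasurable fun p : ℝ × Sphere n =>
      radialFourier n (rayMat Y u 0 p.2) p.1 j k := fun j k =>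
    (h.flow.stronglyMeasurable_radialFourier_comp u measurable_const measurable_snd
      measurable_fst).entry j k
  rw [lintegral_lintegral_sum_sum_swap
    (f := fun j k p => ‖radialFourier n (rayMat Y u 0 p.2) p.1 j k‖ₑ) fun j k => (hSM j k).enorm,
    yNorm]
  refine Finset.sum_congr rfl fun j _ => Finset.sum_congr rfl fun k _ =>
    lintegral_congr fun τ => lintegral_congr_ae ?_
  filter_upwards [h.ae_radialFourier_entry j k] with ω hω
  rw [hω]

theorem enorm_rayRate_le (S : Mat m) (t : ℝ) (ω : Sphere n) :
    ‖rayRate S a Y u t ω‖ₑ ≤ ENNReal.ofReal ‖traceCLM S‖ *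
      ‖a t ω * radialFourier n (rayMat Y u t ω) 0 -
        radialFourier n (rayMat Y u t ω) 0 * star (a t ω)‖ₑ := by
  rw [rayRate, rateCLM_apply, enorm_mul, ← ofReal_norm Complex.I, Complex.norm_I,
    ENNReal.ofReal_one, one_mul, ← ofReal_norm, ← ofReal_norm,
    ← ENNReal.ofReal_mul (norm_nonneg _)]
  exact ENNReal.ofReal_le_ofReal (ContinuousLinearMap.le_opNorm _ _)

/-- `∫∫ |rayRate| dt dσ` is controlled by the `𝒴`-norm of the data. -/
theorem lintegral_rayRate_le (h : RayEstimates a Y u ℓ M) (S : Mat m) :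
    ∫⁻ ω, (∫⁻ t, ‖rayRate S a Y u t ω‖ₑ) ∂(surf n) ≤
      ENNReal.ofReal (‖traceCLM S‖ * M) * yNorm u := by
  rw [← h.lintegral_sum_radialFourier_eq, ← lintegral_const_mul' _ _ ENNReal.ofReal_ne_top]
  refine lintegral_mono_ae ?_
  filter_upwards [h.lintegral_le] with ω hω
  refine (lintegral_mono fun t => enorm_rayRate_le S t ω).trans ?_
  rw [lintegral_const_mul' _ _ ENNReal.ofReal_ne_top, ENNReal.ofReal_mul (norm_nonneg _),
    mul_assoc]
  gcongr
  refine hω.trans ?_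
  gcongr
  exact enorm_le_sum_entries _

end RayEstimates

end Rate

/-! ### Integration in polar coordinates. -/

section PolarIntegral

variable {n : ℕ} {E : Type*} [NormedAddCommGroup E] [NormedSpace ℝ E]

theorem integrable_comp_polar (hn : 1 ≤ n) {f : Space n → E} (hf : Integrable f) :
    Integrable (fun p : Sphere n × ℝ => f (p.2 • (p.1 : Space n)))
      ((surf n).prod (radialMeasure n)) :=
  (measurePreserving_polar hn).integrable_comp_of_integrable hf

theorem ae_integrableOn_polar (hn : 1 ≤ n) {f : Space n → E} (hf : Integrable f) :
    ∀ᵐ ω : Sphere n ∂(surf n),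
      IntegrableOn (fun ρ : ℝ => ρ ^ (n - 1) • f (ρ • (ω : Space n))) (Ioi 0) :=
  (integrable_comp_polar hn hf).prod_right_ae.mono fun _ h => integrable_radialMeasure.1 h

theorem integrable_integral_polar (hn : 1 ≤ n) {f : Space n → E} (hf : Integrable f) :
    Integrable (fun ω : Sphere n => ∫ ρ in Ioi (0 : ℝ), ρ ^ (n - 1) • f (ρ • (ω : Space n)))
      (surf n) := by
  simpa only [integral_radialMeasure] using (integrable_comp_polar hn hf).integral_prod_left

/-- Integration in polar coordinates. -/
theorem integral_polar (hn : 1 ≤ n) {f : Space n → E} (hf : Integrable f) :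
    ∫ ξ, f ξ = ∫ ω : Sphere n, (∫ ρ in Ioi (0 : ℝ), ρ ^ (n - 1) • f (ρ • (ω : Space n)))
      ∂(surf n) := by
  have hT := measurePreserving_polar hn
  simp only [← integral_radialMeasure]
  rw [← integral_prod _ (integrable_comp_polar hn hf)]
  conv_lhs => rw [← hT.map_eq]
  exact integral_map hT.measurable.aemeasurable (by rw [hT.map_eq]; exact hf.1)

end PolarIntegral

/-! ### Integrability of the derivative of `s`. -/

section Derivative
open scoped Matrix.Norms.Frobenius
attribute [local instance] matTopology

variable {n m : ℕ} {a : ℝ → Sphere n → Mat m} {Y : ℝ → Sphere n × ℝ → Mat m} {u : L2 n m}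

theorem quadForm_eq_integral_rayForm (hn : 1 ≤ n) (e : Sphere n) (S : Mat m) {w : L2 n m} {t : ℝ}
    (hw : ∀ᵐ ξ, ∀ j, fhat w ξ j = rayVec Y u t (direction e ξ) ‖ξ‖ j) :
    quadForm S w = ((2 * Real.pi) ^ n)⁻¹ * (∫ ω, rayForm S Y u t ω ∂(surf n)).re ∧
      Integrable (rayForm S Y u t) (surf n) ∧
      ∀ᵐ ω ∂(surf n),
        IntegrableOn (fun ρ : ℝ => ρ ^ (n - 1) • traceCLM S (rayMat Y u t ω ρ)) (Ioi 0) := by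
  set F : Space n → ℂ := fun ξ => traceCLM S (rayMat Y u t (direction e ξ) ‖ξ‖) with hF
  have hFe : (fun ξ => ∑ b, ∑ l, S b l * fhat w ξ l * (starRingEnd ℂ) (fhat w ξ b)) =ᵐ[volume] F := by
    filter_upwards [hw] with ξ hξ
    simp only [hF, traceCLM_eq_sum, rayMat_apply, hξ, mul_assoc]
  have hFi : Integrable F := by
    refine Integrable.congr ?_ hFe
    refine integrable_finsetSum _ fun b _ => integrable_finsetSum _ fun l _ => ?_
    simp only [mul_assoc]
    exact (integrable_mul_of_memLp (memLp_fhat_apply w l)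
      (memLp_fhat_apply w b).star).const_mul (S b l)
  have hFp : ∀ (ω : Sphere n), ∀ ρ ∈ Ioi (0 : ℝ), ρ ^ (n - 1) • F (ρ • (ω : Space n)) =
      ρ ^ (n - 1) • traceCLM S (rayMat Y u t ω ρ) := by
    intro ω ρ hρ
    simp only [hF]
    rw [direction_smul e hρ, norm_smul_sphere hρ]
  have hInt : ∀ ω : Sphere n, ∫ ρ in Ioi (0 : ℝ), ρ ^ (n - 1) • F (ρ • (ω : Space n)) =
      rayForm S Y u t ω := fun ω => setIntegral_congr_fun measurableSet_Ioi (hFp ω)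
  refine ⟨?_, ?_, ?_⟩
  · rw [quadForm_eq, integral_congr_ae hFe, integral_polar hn hFi]
    simp only [hInt]
  · have := integrable_integral_polar hn hFi
    simpa only [hInt] using this
  · filter_upwards [ae_integrableOn_polar hn hFi] with ω hω
    exact hω.congr_fun (hFp ω) measurableSet_Ioi

theorem RayEstimates.integrable_rayRate {ℓ M : ℝ} (h : RayEstimates a Y u ℓ M) (S : Mat m)
    (hu : yNorm u < ∞) : Integrable (fun p : Sphere n × ℝ => rayRate S a Y u p.2 p.1)
      ((surf n).prod volume) := by
  have hm : StronglyMeasurable fun p : Sphere n × ℝ => rayRate S a Y u p.2 p.1 :=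
    StronglyMeasurable.comp_measurable (f := fun p : ℝ × Sphere n => rayRate S a Y u p.1 p.2)
      (g := fun p : Sphere n × ℝ => (p.2, p.1)) (h.stronglyMeasurable_rayRate S)
      (measurable_snd.prodMk measurable_fst)
  refine ⟨hm.aestronglyMeasurable, ?_⟩
  rw [HasFiniteIntegral, lintegral_prod _ hm.enorm.aemeasurable]
  exact (h.lintegral_rayRate_le S).trans_lt (ENNReal.mul_lt_top ENNReal.ofReal_lt_top hu)

/-- `s` is a primitive of an integrable function controlled by the `𝒴`-norm of the data. -/
theorem exists_integrable_deriv_quadForm {ℓ M : ℝ} (h : RayEstimates a Y u ℓ M) (hn : 1 ≤ n)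
    (e : Sphere n) (S : Mat m) (hu : yNorm u < ∞) {U : ℝ → L2 n m}
    (hU : ∀ t, ∀ᵐ ξ, ∀ j, fhat (U t) ξ j = rayVec Y u t (direction e ξ) ‖ξ‖ j) :
    ∃ q : ℝ → ℝ, Integrable q ∧ (∀ t, sFun S U t - sFun S U 0 = ∫ r in (0 : ℝ)..t, q r) ∧
      ∫ t, |q t| ≤ ((2 * Real.pi) ^ n)⁻¹ * (‖traceCLM S‖ * M) * (yNorm u).toReal := by
  set c := ((2 * Real.pi) ^ n)⁻¹ with hc
  have hc0 : 0 ≤ c := by positivity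
  have hM := h.M_nonneg
  have hInt := h.integrable_rayRate S hu
  have hg : Integrable fun t => ∫ ω, rayRate S a Y u t ω ∂(surf n) := hInt.integral_prod_right
  refine ⟨fun t => c * (∫ ω, rayRate S a Y u t ω ∂(surf n)).re, hg.re.const_mul c, fun t => ?_, ?_⟩
  · obtain ⟨e1, i1, j1⟩ := quadForm_eq_integral_rayForm hn e S (hU t)
    obtain ⟨e0, i0, j0⟩ := quadForm_eq_integral_rayForm hn e S (hU 0)
    rw [sFun, sFun, e1, e0, ← mul_sub, ← Complex.sub_re, ← integral_sub i1 i0,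
      intervalIntegral.integral_const_mul]
    congr 1
    -- The fundamental theorem of calculus is used on each ray, and the directions are integrated
    -- only afterwards.
    have hall : ∀ᵐ ω ∂(surf n), rayForm S Y u t ω - rayForm S Y u 0 ω =
        ∫ r in (0 : ℝ)..t, rayRate S a Y u r ω := by
      have hj : ∀ᵐ ω ∂(surf n), ∀ r, IntegrableOn (fun ρ : ℝ => (ρ : ℂ) ^ n • rayMat Y u r ω ρ)
        (Ioi 0) := h.ae_integrableOn
      filter_upwards [hj, h.rayMat_le, j1, j0] with ω h1 h2 h3 h4
      exact h.rayForm_sub hn S t h1 h2 h3 h4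
    rw [integral_congr_ae hall]
    have hInt' : Integrable (Function.uncurry fun r ω => rayRate S a Y u r ω)
        ((volume.restrict (uIoc 0 t)).prod (surf n)) := by
      have := hInt.swap
      refine this.mono_measure ?_
      exact Measure.prod_mono Measure.restrict_le_self le_rfl
    rw [← intervalIntegral_integral_swap hInt']
    have := (Complex.reCLM.intervalIntegral_comp_comm (hg.intervalIntegrable (a := 0) (b := t)))
    exact this.symm
  · have h1 : ∫ t, |c * (∫ ω, rayRate S a Y u t ω ∂(surf n)).re| ≤
        c * ∫ t, ∫ ω, ‖rayRate S a Y u t ω‖ ∂(surf n) := by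
      rw [← integral_const_mul]
      refine integral_mono (hg.re.const_mul c).abs (hInt.norm.integral_prod_right.const_mul c)
        fun t => ?_
      simp only [abs_mul, abs_of_nonneg hc0]
      gcongr
      exact (Complex.abs_re_le_norm _).trans (norm_integral_le_integral_norm _)
    refine h1.trans ?_
    rw [mul_assoc]
    gcongr
    have h2 : ∫ t, ∫ ω, ‖rayRate S a Y u t ω‖ ∂(surf n) =
        ∫ p, ‖rayRate S a Y u p.2 p.1‖ ∂((surf n).prod volume) := by
      rw [integral_prod_symm _ hInt.norm]
    rw [h2, integral_norm_eq_lintegral_enorm hInt.1, lintegral_prod _ hInt.1.enorm]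
    refine (ENNReal.toReal_mono (ENNReal.mul_ne_top ENNReal.ofReal_ne_top hu.ne)
      (h.lintegral_rayRate_le S)).trans_eq ?_
    rw [ENNReal.toReal_mul, ENNReal.toReal_ofReal (by positivity)]

end Derivative

/-! ### Curves that are Lipschitz with respect to an absolutely continuous function. -/

section Composition

/-- The limit of the difference quotients with increments `1 / (k + 1)`. -/
def seqDeriv (f : ℝ → ℂ) (t : ℝ) : ℂ :=
  limUnder atTop fun k : ℕ => ((1 : ℝ) / (k + 1))⁻¹ • (f (t + 1 / (k + 1)) - f t)

theorem seqDeriv_eq {f : ℝ → ℂ} {f' : ℂ} {t : ℝ} (h : HasDerivAt f f' t) : seqDeriv f t = f' := by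
  refine Tendsto.limUnder_eq (h.tendsto_slope_zero.comp (tendsto_nhdsWithin_iff.2
    ⟨tendsto_one_div_add_atTop_nhds_zero_nat, Eventually.of_forall fun k => ?_⟩))
  have : (0 : ℝ) < 1 / (k + 1) := by positivity
  exact this.ne'

/-- A limit along a sequence of increments keeps joint measurability in time and parameter, which is
why the derivative is taken in this form. -/
theorem stronglyMeasurable_seqDeriv {X : Type*} [MeasurableSpace X] {f : X → ℝ → ℂ}
    (hf : StronglyMeasurable fun p : ℝ × X => f p.2 p.1) :
    StronglyMeasurable fun p : ℝ × X => seqDeriv (f p.2) p.1 := by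
  refine StronglyMeasurable.limUnder fun k => ?_
  have h1 : StronglyMeasurable fun p : ℝ × X => f p.2 (p.1 + 1 / (k + 1)) :=
    StronglyMeasurable.comp_measurable (f := fun p : ℝ × X => f p.2 p.1)
      (g := fun p : ℝ × X => (p.1 + 1 / (k + 1), p.2)) hf (by fun_prop)
  exact (h1.sub hf).const_smul ((1 : ℝ) / (k + 1))⁻¹

/-- A curve which is Lipschitz with respect to an absolutely continuous function. -/
theorem seqDeriv_of_norm_sub_le {f : ℝ → ℂ} {s : ℝ → ℝ} {L : ℝ}
    (hs : ∀ a b, AbsolutelyContinuousOnInterval s a b) (hi : Integrable (deriv s))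
    (hm : StronglyMeasurable (seqDeriv f)) (hf : ∀ t t', ‖f t - f t'‖ ≤ L * |s t - s t'|) :
    (∀ᵐ t, ‖seqDeriv f t‖ ≤ L * |deriv s t|) ∧ Integrable (seqDeriv f) ∧
      ∀ t t', ∫ τ in t..t', seqDeriv f τ = f t' - f t := by
  have hac : ∀ a b, AbsolutelyContinuousOnInterval f a b := fun a b =>
    absolutelyContinuousOnInterval_of_dist_le (C := |L|) one_pos (hs a b) (hs a b)
      fun x _ y _ _ => by
        rw [dist_eq_norm, Real.dist_eq]
        refine (hf x y).trans ?_
        gcongr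
        · exact le_abs_self L
        · linarith [abs_nonneg (s x - s y)]
  have hd : ∀ᵐ t, HasDerivAt f (seqDeriv f t) t := by
    filter_upwards [ae_differentiableAt_of_absolutelyContinuous hac] with t ht
    rw [seqDeriv_eq ht.hasDerivAt]
    exact ht.hasDerivAt
  have hle : ∀ᵐ t, ‖seqDeriv f t‖ ≤ L * |deriv s t| := by
    filter_upwards [hd, ae_differentiableAt_of_absolutelyContinuous hs] with t h1 h2
    exact norm_deriv_le_of_eventually_norm_sub_le h1 h2.hasDerivAt
      (Eventually.of_forall fun r => hf r t)
  have hInt : Integrable (seqDeriv f) := (hi.abs.const_mul L).mono' hm.aestronglyMeasurable hle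
  exact ⟨hle, hInt, fun t t' => integral_eq_sub_of_absolutelyContinuous (hac t t') hd
    fun a b => hInt.intervalIntegrable⟩

end Composition

/-! ### The coefficient evaluated along `s`. -/

section Coefficient
open scoped Matrix.Norms.Frobenius
attribute [local instance] matTopology

variable {n m : ℕ} {A : ℝ → Space n → Mat m} {s : ℝ → ℝ} {L Q : ℝ}

theorem linftyNorm_comp_le (hL : 0 ≤ L) (hLip : LipOnRange L A s) (hQ : ∀ t, |s t - s 0| ≤ Q)
    (t : ℝ) : linftyNorm (restr A (s t)) ≤
      linftyNorm (restr A (s 0)) + ENNReal.ofReal (L * Q) := by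
  refine linftyNorm_le_of_ae ?_
  filter_upwards [ae_enorm_le_linftyNorm (restr A (s 0)),
    ae_enorm_le_linftyNorm fun ω => restr A (s t) ω - restr A (s 0) ω] with ω h1 h2 i j
  have e : restr A (s t) ω i j =
      restr A (s 0) ω i j + (restr A (s t) ω - restr A (s 0) ω) i j := by
    rw [Matrix.sub_apply]; ring
  rw [e]
  refine (enorm_add_le _ _).trans (add_le_add (h1 i j) ((h2 i j).trans ((hLip t 0).trans ?_)))
  exact ENNReal.ofReal_le_ofReal (by gcongr; exact hQ t)

/-- For each pair of times the bound fails only on a null set depending on the pair. Rational pairs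
give one common null set, and continuity extends the bound to all pairs. -/
theorem ae_norm_sub_le {a : ℝ → Sphere n → Mat m} (hc : ∀ ω, Continuous fun t => a t ω)
    (haA : ∀ t, ∀ᵐ ω ∂(surf n), a t ω = restr A t ω) (hL : 0 ≤ L) (hs : Continuous s)
    (hLip : LipOnRange L A s) : ∀ᵐ ω ∂(surf n), ∀ i j t t',
      ‖a (s t) ω i j - a (s t') ω i j‖ ≤ L * |s t - s t'| := by
  have h1 : ∀ t t', ∀ᵐ ω ∂(surf n), ∀ i j,
      ‖a (s t) ω i j - a (s t') ω i j‖ ≤ L * |s t - s t'| := by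
    intro t t'
    filter_upwards [haA (s t), haA (s t'),
      ae_enorm_le_linftyNorm fun ω => restr A (s t) ω - restr A (s t') ω] with ω h1 h2 h3 i j
    have h4 := (h3 i j).trans (hLip t t')
    rw [Matrix.sub_apply, ← h1, ← h2, ← ofReal_norm] at h4
    exact (ENNReal.ofReal_le_ofReal_iff (by positivity)).1 h4
  have h2 : ∀ᵐ ω ∂(surf n), ∀ p : ℚ × ℚ, ∀ i j,
      ‖a (s p.1) ω i j - a (s p.2) ω i j‖ ≤ L * |s p.1 - s p.2| :=
    ae_all_iff.2 fun p => h1 p.1 p.2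
  filter_upwards [h2] with ω hω i j t t'
  have hce : Continuous fun r : ℝ => a (s r) ω i j :=
    ((entryCLM i j).continuous.comp (hc ω)).comp hs
  have hcl : IsClosed {p : ℝ × ℝ | ‖a (s p.1) ω i j - a (s p.2) ω i j‖ ≤ L * |s p.1 - s p.2|} :=
    isClosed_le ((hce.comp continuous_fst).sub (hce.comp continuous_snd)).norm
      (continuous_const.mul ((hs.comp continuous_fst).sub (hs.comp continuous_snd)).abs)
  have hden : DenseRange (Prod.map ((↑) : ℚ → ℝ) ((↑) : ℚ → ℝ)) :=
    (Rat.denseRange_cast (𝕜 := ℝ)).prodMap Rat.denseRange_cast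
  have : (t, t') ∈ closure (range (Prod.map ((↑) : ℚ → ℝ) ((↑) : ℚ → ℝ))) := hden (t, t')
  exact hcl.closure_subset_iff.2 (range_subset_iff.2 fun p => hω p i j) this

/-- For almost every direction the entries are `L`-Lipschitz with respect to `s`, hence absolutely
continuous with derivative at most `L |s'|`. -/
theorem exists_isTimeDeriv_comp {a : ℝ → Sphere n → Mat m}
    (hm : StronglyMeasurable (Function.uncurry a)) (hc : ∀ ω, Continuous fun t => a t ω)
    (haA : ∀ t, ∀ᵐ ω ∂(surf n), a t ω = restr A t ω) (hL : 0 ≤ L)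
    (hs : ∀ a b, AbsolutelyContinuousOnInterval s a b) (hsc : Continuous s)
    (hi : Integrable (deriv s)) (hQ : ∫ t, |deriv s t| ≤ Q) (hLip : LipOnRange L A s) :
    ∃ B : ℝ → Sphere n → Mat m, IsTimeDeriv (fun t => restr A (s t)) B ∧
      ∫⁻ t, linftyNorm (B t) ≤ ENNReal.ofReal (L * Q) := by
  set f : Fin m → Fin m → Sphere n → ℝ → ℂ := fun i j ω t => a (s t) ω i j with hf
  have hfm : ∀ i j, StronglyMeasurable fun p : ℝ × Sphere n => f i j p.2 p.1 := by
    intro i j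
    have h1 : StronglyMeasurable fun p : ℝ × Sphere n => a (s p.1) p.2 :=
      StronglyMeasurable.comp_measurable (f := Function.uncurry a)
        (g := fun p : ℝ × Sphere n => (s p.1, p.2)) hm
        ((hsc.measurable.comp measurable_fst).prodMk measurable_snd)
    exact h1.entry i j
  have hBm : ∀ i j, StronglyMeasurable fun p : ℝ × Sphere n => seqDeriv (f i j p.2) p.1 :=
    fun i j => stronglyMeasurable_seqDeriv (hfm i j)
  have hBω : ∀ i j ω, StronglyMeasurable (seqDeriv (f i j ω)) := fun i j ω =>
    StronglyMeasurable.comp_measurable (f := fun p : ℝ × Sphere n => seqDeriv (f i j p.2) p.1)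
      (g := fun t : ℝ => (t, ω)) (hBm i j) measurable_prodMk_right
  have hgood : ∀ᵐ ω ∂(surf n), ∀ i j, (∀ᵐ t, ‖seqDeriv (f i j ω) t‖ ≤ L * |deriv s t|) ∧
      Integrable (seqDeriv (f i j ω)) ∧
      ∀ t t', ∫ τ in t..t', seqDeriv (f i j ω) τ = f i j ω t' - f i j ω t := by
    filter_upwards [ae_norm_sub_le hc haA hL hsc hLip] with ω hω i j
    exact seqDeriv_of_norm_sub_le hs hi (hBω i j ω) (hω i j)
  refine ⟨fun t ω => Matrix.of fun i j => seqDeriv (f i j ω) t,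
    ⟨fun i j => (hBm i j).aestronglyMeasurable, fun t t' => ?_⟩, ?_⟩
  · filter_upwards [hgood, haA (s t), haA (s t')] with ω h1 h2 h3 i j
    obtain ⟨-, h4, h5⟩ := h1 i j
    refine ⟨h4.intervalIntegrable, ?_⟩
    rw [← h2, ← h3]
    exact (h5 t t').symm
  · have hbound : ∀ᵐ t, ∀ᵐ ω ∂(surf n), ∀ i j, ‖seqDeriv (f i j ω) t‖ ≤ L * |deriv s t| := by
      have h1 : ∀ i j, ∀ᵐ t, ∀ᵐ ω ∂(surf n), ‖seqDeriv (f i j ω) t‖ ≤ L * |deriv s t| := by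
        intro i j
        -- The estimate is known for almost every `t` with `ω` fixed. Joint measurability allows the
        -- order to be exchanged, as the essential supremum over `ω` requires.
        refine (Measure.ae_ae_comm ?_).2 (hgood.mono fun ω h => (h i j).1)
        exact measurableSet_le (hBm i j).norm.measurable
          (((measurable_deriv s).comp measurable_fst).abs.const_mul L)
      filter_upwards [ae_all_iff.2 fun i => ae_all_iff.2 (h1 i)] with t ht
      exact ae_all_iff.2 fun i => ae_all_iff.2 (ht i)
    calc ∫⁻ t, linftyNorm (fun ω => Matrix.of fun i j => seqDeriv (f i j ω) t)
        ≤ ∫⁻ t, ENNReal.ofReal (L * |deriv s t|) := by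
          refine lintegral_mono_ae ?_
          filter_upwards [hbound] with t ht
          refine linftyNorm_le_of_ae ?_
          filter_upwards [ht] with ω hω i j
          rw [← ofReal_norm]
          exact ENNReal.ofReal_le_ofReal (hω i j)
      _ = ENNReal.ofReal (∫ t, L * |deriv s t|) :=
          (ofReal_integral_eq_lintegral_ofReal (hi.abs.const_mul L)
            (Eventually.of_forall fun t => by positivity)).symm
      _ ≤ ENNReal.ofReal (L * Q) := by
          rw [integral_const_mul]
          exact ENNReal.ofReal_le_ofReal (by gcongr)

end Coefficient

/-! ### Uniform constants and conclusion. -/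

section Conclusion
open scoped Matrix.Norms.Frobenius
attribute [local instance] matTopology

variable {n m : ℕ}

theorem continuous_of_integral_eq {a b : ℝ → Mat m} (hab : ∀ s t, a t - a s = ∫ r in s..t, b r)
    (hb : Integrable b) : Continuous a := by
  have h := (intervalIntegral.continuous_primitive
    (fun s t => hb.intervalIntegrable (a := s) (b := t)) 0).const_add (a 0)
  refine h.congr fun t => ?_
  rw [← hab, add_sub_cancel]

theorem ClassK.exists_isTimeDeriv_comp {Λ K d L Q : ℝ} {A : ℝ → Space n → Mat m} {s : ℝ → ℝ}
    (hA : ClassK Λ K A) (hd : StrictlyHyperbolic d A) (hΛ : 0 ≤ Λ) (hK : 0 ≤ K) (hL : 0 ≤ L)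
    (hs : ∀ a b, AbsolutelyContinuousOnInterval s a b) (hsc : Continuous s)
    (hi : Integrable (deriv s)) (hQ : ∫ t, |deriv s t| ≤ Q) (hLip : LipOnRange L A s) :
    ∃ B : ℝ → Sphere n → Mat m, IsTimeDeriv (fun t => restr A (s t)) B ∧
      ∫⁻ t, linftyNorm (B t) ≤ ENNReal.ofReal (L * Q) := by
  obtain ⟨a, b, hm, hab, hb, -, haA, -⟩ := exists_representative hΛ hK hA hd
  exact Kirchhoff.exists_isTimeDeriv_comp hm
    (fun ω => continuous_of_integral_eq (hab ω) (hb ω)) haA hL hs hsc hi hQ hLip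

/-- For symbols of small variation, `s` is a primitive of an integrable function whose integral is
controlled by the `𝒴`-norm of the data. -/
theorem exists_uniform_bounds (hn : 1 ≤ n) (S : Mat m) {Λ d : ℝ} (hΛ : 0 < Λ) (hd : 0 < d) :
    ∃ K₀ M : ℝ, 0 < K₀ ∧ 0 < M ∧ ∀ K : ℝ, 0 < K → K ≤ K₀ → ∀ A : ℝ → Space n → Mat m,
      ClassK Λ K A → StrictlyHyperbolic d A → ∀ U : ℝ → L2 n m, IsSolution A U → MemY (U 0) →
      ∃ q : ℝ → ℝ, Integrable q ∧ (∀ t, sFun S U t - sFun S U 0 = ∫ r in (0 : ℝ)..t, q r) ∧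
        ∫ t, |q t| ≤ M * (yNorm (U 0)).toReal := by
  -- The symbol class bounds individual entries, whereas the ray estimates use the matrix norm; this
  -- costs the factor `m²`, for `K` as well as for `Λ`.
  obtain ⟨K₁, M, hK₁, hM, hray⟩ := exists_ray_bounds m (d := d) (Λ := m ^ 2 * Λ) hd (by positivity)
  refine ⟨K₁ / (m ^ 2 + 1), ((2 * Real.pi) ^ n)⁻¹ * (‖traceCLM S‖ * M) + 1, by positivity,
    by positivity, fun K hK0 hK A hA hS U hU hY => ?_⟩
  have hmK : m ^ 2 * K ≤ K₁ := by
    rw [le_div_iff₀ (by positivity)] at hK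
    nlinarith
  obtain ⟨a, b, hm, hab, hb, hle, haA, hgood⟩ := exists_representative hΛ.le hK0.le hA hS
  have hc : ∀ ω, Continuous fun t => a t ω := fun ω => continuous_of_integral_eq (hab ω) (hb ω)
  obtain ⟨Y, hflow⟩ := exists_fundamentalFlow hm hc hle
  obtain ⟨e⟩ := nonempty_sphere hn
  have hbounds : ∀ᵐ ω ∂(surf n), (∀ t ρ, ‖rayMat Y (U 0) t ω ρ‖ ≤ M * ‖rayMat Y (U 0) 0 ω ρ‖) ∧
      ∀ n : ℕ, IntegrableOn (fun ρ : ℝ => (ρ : ℂ) ^ n • rayMat Y (U 0) 0 ω ρ) (Ioi 0) →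
        ∫⁻ t, ‖a t ω * radialFourier n (rayMat Y (U 0) t ω) 0 -
            radialFourier n (rayMat Y (U 0) t ω) 0 * star (a t ω)‖ₑ ≤
          ENNReal.ofReal M * ∫⁻ τ, ‖radialFourier n (rayMat Y (U 0) 0 ω) τ‖ₑ := by
    filter_upwards [hgood] with ω hω
    exact hray (fun t => a t ω) (fun t => b t ω) (hab ω) (hb ω) (hle ω) hω.1 (hω.2.trans hmK)
      (fun t ρ => rayMat Y (U 0) t ω ρ)
      (hflow.stronglyMeasurable_rayMat_comp (U 0) measurable_fst measurable_const measurable_snd)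
      (fun t ρ => hflow.hasDerivAt_rayMat t ω ρ)
  have hI : ∀ᵐ ω ∂(surf n),
      IntegrableOn (fun ρ : ℝ => (ρ : ℂ) ^ n • rayMat Y (U 0) 0 ω ρ) (Ioi 0) := by
    filter_upwards [hY.1] with ω hω
    refine integrable_of_entries fun j k => (hω j k).congr (Eventually.of_forall fun ρ => ?_)
    simp only [Matrix.smul_apply, smul_eq_mul, rayMat_apply, hflow.rayVec_zero, radial]
    ring
  have hest : RayEstimates a Y (U 0) (m ^ 2 * Λ) M :=
    ⟨hflow, hm, hc, hle, hM.le, hI, hbounds.mono fun ω h => h.1, by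
      filter_upwards [hbounds, hI] with ω h1 h2
      exact h1.2 n h2⟩
  obtain ⟨q, hq1, hq2, hq3⟩ := exists_integrable_deriv_quadForm hest hn e S hY.2
    (hflow.fhat_eq_rayVec hn e (by positivity) hM.le hA hm hle haA hU hest.rayMat_le)
  refine ⟨q, hq1, hq2, hq3.trans ?_⟩
  gcongr
  linarith

/-- The ray estimates involve `|U₀|_𝒴` alone. The term `K ‖U₀‖²` is nonnegative and the factor `1 /
(1 - cK)` is at least `1`, so the stated form follows. -/
theorem le_dataSize {c K : ℝ} (hK : 0 ≤ K) (hc : 0 ≤ c * K) (hc1 : c * K < 1) (u : L2 n m) :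
    (yNorm u).toReal ≤ dataSize c K u := by
  have h1 : 1 ≤ 1 / (1 - c * K) := by
    rw [le_div_iff₀ (by linarith)]
    linarith
  have h2 : (0 : ℝ) ≤ (yNorm u).toReal := ENNReal.toReal_nonneg
  have h3 : 0 ≤ K * ‖u‖ ^ 2 := by positivity
  rw [dataSize]
  nlinarith

end Conclusion

end

end Kirchhoff

theorem mainTheorem6 (n m : ℕ) (hn : 1 ≤ n) (S : Kirchhoff.Mat m) (hS : S.IsHermitian)
    (Λ d : ℝ) (hΛ : 0 < Λ) (hd : 0 < d) :
    ∃ K₀ c M : ℝ, 0 < K₀ ∧ 0 < c ∧ 0 < M ∧ c * K₀ < 1 ∧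
      ∀ (K : ℝ), 0 < K → K ≤ K₀ →
      ∀ (A : ℝ → Kirchhoff.Space n → Kirchhoff.Mat m),
        Kirchhoff.ClassK Λ K A → Kirchhoff.StrictlyHyperbolic d A →
      ∀ (U : ℝ → Kirchhoff.L2 n m),
        Kirchhoff.IsSolution A U → Kirchhoff.MemY (U 0) →
      ∀ (s : ℝ → ℝ), s = Kirchhoff.sFun S U →
        -- `s` is absolutely continuous, and its derivative has a small integral
        ((∀ a b : ℝ, AbsolutelyContinuousOnInterval s a b) ∧ Integrable (deriv s) ∧
          ∫ t : ℝ, |deriv s t| ≤ M * Kirchhoff.dataSize c K (U 0)) ∧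
        -- bounds for `A(s(t), ω)` in terms of any Lipschitz constant of `A` on the range of `s`
        (∃ L : ℝ, 0 ≤ L ∧ Kirchhoff.LipOnRange L A s) ∧
        ∀ L : ℝ, 0 ≤ L → Kirchhoff.LipOnRange L A s →
          (∀ t : ℝ, Kirchhoff.linftyNorm (Kirchhoff.restr A (s t)) ≤
            Kirchhoff.linftyNorm (Kirchhoff.restr A (s 0)) +
              ENNReal.ofReal (M * L * Kirchhoff.dataSize c K (U 0))) ∧
          ∃ B : ℝ → Kirchhoff.Sphere n → Kirchhoff.Mat m,
            Kirchhoff.IsTimeDeriv (fun t => Kirchhoff.restr A (s t)) B ∧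
            ∫⁻ t : ℝ, Kirchhoff.linftyNorm (B t) ≤
              ENNReal.ofReal (M * L * Kirchhoff.dataSize c K (U 0)) := by
  obtain ⟨K₀, M, hK₀, hM, hmain⟩ := Kirchhoff.exists_uniform_bounds hn S hΛ hd
  -- The choice `c = 1 / (2 K₀)` makes `c K ≤ 1 / 2` for all admissible `K`.
  have hcK₀ : 1 / (2 * K₀) * K₀ = 1 / 2 := by field_simp
  refine ⟨K₀, 1 / (2 * K₀), M, hK₀, by positivity, hM, by rw [hcK₀]; norm_num, ?_⟩
  intro K hK hKK₀ A hA hhyp U hU hY s hs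
  obtain ⟨q, hq, hsq, hqM⟩ := hmain K hK hKK₀ A hA hhyp U hU hY
  rw [← hs] at hsq
  set c := 1 / (2 * K₀) with hc
  have hc0 : 0 < c := by positivity
  have hcK : c * K < 1 := by
    have : c * K ≤ c * K₀ := mul_le_mul_of_nonneg_left hKK₀ hc0.le
    linarith
  have hdata := Kirchhoff.le_dataSize hK.le (by positivity) hcK (U 0)
  have hqM' : ∫ t, |q t| ≤ M * Kirchhoff.dataSize c K (U 0) :=
    hqM.trans (mul_le_mul_of_nonneg_left hdata hM.le)
  have hi : ∀ a b, IntervalIntegrable q volume a b := fun a b => hq.intervalIntegrable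
  have hseq : s = fun t => s 0 + ∫ r in (0 : ℝ)..t, q r := by
    funext t
    rw [← hsq, add_sub_cancel]
  have hac : ∀ a b : ℝ, AbsolutelyContinuousOnInterval s a b := fun a b => by
    have h0 := Kirchhoff.absolutelyContinuousOnInterval_primitive hi 0 a b
    refine Kirchhoff.absolutelyContinuousOnInterval_of_dist_le (C := 1) one_pos h0 h0
      fun x _ y _ _ => ?_
    have e : dist (s x) (s y) = dist (∫ r in (0 : ℝ)..x, q r) (∫ r in (0 : ℝ)..y, q r) := by
      rw [← hsq, ← hsq, dist_sub_right]
    rw [e]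
    linarith [dist_nonneg (x := ∫ r in (0 : ℝ)..x, q r) (y := ∫ r in (0 : ℝ)..y, q r)]
  have hcont : Continuous s := by
    rw [hseq]
    exact continuous_const.add (intervalIntegral.continuous_primitive hi 0)
  have hder : deriv s =ᵐ[volume] q := by
    filter_upwards [_root_.LocallyIntegrable.ae_hasDerivAt_integral hq.locallyIntegrable] with t ht
    rw [hseq]
    exact ((ht 0).const_add (s 0)).deriv
  have hdi : Integrable (deriv s) := hq.congr hder.symm
  have hdint : ∫ t, |deriv s t| ≤ M * Kirchhoff.dataSize c K (U 0) := by
    have e : ∫ t, |deriv s t| = ∫ t, |q t| :=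
      integral_congr_ae (hder.mono fun t ht => congrArg abs ht)
    rwa [e]
  have hrange : ∀ t, |s t - s 0| ≤ M * Kirchhoff.dataSize c K (U 0) := fun t => by
    rw [hsq, ← Real.norm_eq_abs]
    refine (intervalIntegral.norm_integral_le_integral_norm_uIoc).trans (le_trans ?_ hqM')
    exact setIntegral_le_integral hq.norm (Filter.Eventually.of_forall fun t => norm_nonneg _)
  refine ⟨⟨hac, hdi, hdint⟩, ?_, fun L hL hLip => ⟨fun t => ?_, ?_⟩⟩
  -- The range of `s` lies in a bounded interval, since the variation of `s` is finite; the local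
  -- Lipschitz constant there is a valid `L`.
  · obtain ⟨L, hL⟩ := hA.locally_lipschitz (|s 0| + M * Kirchhoff.dataSize c K (U 0))
    have hmem : ∀ t, s t ∈ Icc (-(|s 0| + M * Kirchhoff.dataSize c K (U 0)))
        (|s 0| + M * Kirchhoff.dataSize c K (U 0)) := fun t => by
      refine abs_le.1 ?_
      have := abs_add_le (s 0) (s t - s 0)
      rw [add_sub_cancel] at this
      linarith [hrange t]
    exact ⟨L, L.coe_nonneg, fun t t' => hL _ (hmem t) _ (hmem t')⟩
  · rw [mul_right_comm, mul_comm _ L]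
    exact Kirchhoff.linftyNorm_comp_le hL hLip hrange t
  · rw [mul_right_comm, mul_comm _ L]
    exact hA.exists_isTimeDeriv_comp hhyp hΛ.le hK.le hL hac hcont hdi hdint hLip
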